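/- Let $N\ge 1$. Let $E_{ij}$ be the $3\times 3$ matrix units and let $X_1=\tfrac13(2E_{11}-E_{22}-E_{33})$, $X_2=\tfrac13(E_{11}+E_{22}-2E_{33})$, $X_3=E_{21}$, $X_4=E_{32}$, $X_5=E_{31}$, $X_6=E_{12}$, $X_7=E_{23}$, $X_8=E_{13}$ be a basis of $\mathfrak{sl}(3,\mathbb C)$, with trace-dual basis $X_1^*=E_{11}-E_{22}$, $X_2^*=E_{22}-E_{33}$, $X_3^*=E_{12}$, $X_4^*=E_{23}$, $X_5^*=E_{13}$, $X_6^*=E_{21}$, $X_7^*=E_{32}$, $X_8^*=E_{31}$. For $\ell\ge 0$ put $X_{a;\ell}=X_a z^\ell$ and $$X^*_{a;\ell}=z^{-\ell-1}X_a^*+\delta_{\ell,0}\big(\delta_{a,5}(E_{21}-2E_{32})-(\delta_{a,3}+\delta_{a,4})E_{31}\big),$$ which are dual for $\langle A,B\rangle=\operatorname{res}_{z=0}\operatorname{tr}(A(z)B(z))$. Let $\mathcal M_N\cong\mathbb C^{8N}$ be the set of $$\mathsf L_N(z)=zE_{31}+E_{12}+E_{23}+\sum_{\ell=0}^{N-1}\sum_{a=1}^{8}L_{a;\ell}X^*_{a;\ell},$$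 with the Lie–Poisson bracket $$\{F,H\}=\sum_{\ell,\ell'=0}^{N-1}\sum_{a,b=1}^{8}\langle \mathsf L_N(z),[X_{a;\ell},X_{b;\ell'}]\rangle\,\frac{\partial F}{\partial L_{a;\ell}}\frac{\partial H}{\partial L_{b;\ell'}}.$$ The loop group $SL(3,\mathbb C[[z]])$ acts on $\mathcal M_N$ by the coadjoint action: $\langle \mathrm{Ad}^*_g\mathsf L,Y\rangle=\langle\mathsf L,g^{-1}Yg\rangle$ for $Y\in\mathfrak{sl}(3)[[z]]$. The dimension of the orbit of $\mathsf L$ is the dimension of its tangent space at $\mathsf L$, that is, the rank of the Poisson tensor at $\mathsf L$. Set $\widetilde{\mathsf L}_N(z)=z^N\mathsf L_N(z)$ and let $h_{3k+2}$ be the coefficient of $z^{2N-k}$ in $\tfrac12\operatorname{tr}\widetilde{\mathsf L}_N(z)^2$, and $h_{3k+3}$ the coefficient of $z^{3N-k}$ in $\tfrac13\operatorname{tr}\widetilde{\mathsf L}_N(z)^3$. The hamiltonians are the $3N$ functions $h_{3k+2}$, $1\le k\le N$, and $h_{3k+3}$, $1\le k\le 2N$. Then: 1. If $\mathsf L\in\mathcal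 M_N$ is such that $L_{a;\ell}=0$ for all $a\ge 3$ and the three diagonal entries $L_{1;N-1}$, $L_{2;N-1}-L_{1;N-1}$, $-L_{2;N-1}$ of the coefficient of $z^{-N}$ are pairwise distinct (a regular initial element of the Weyl chamber), then its coadjoint orbit has dimension $6N$. 2. The $3N$ hamiltonians pairwise Poisson-commute on $\mathcal M_N$. 3. Every coadjoint orbit $\mathcal O\subset\mathcal M_N$ of dimension $6N$ is the phase space of a hamiltonian system with $3N$ degrees of freedom which is integrable in the sense of Liouville: the bracket is a Poisson bracket; $\mathcal O$ is an embedded complex submanifold of dimension $6N=2\cdot 3N$ whose tangent space at each point is the range of the Poisson tensor (so that $\mathcal O$ is symplectic); and the $3N$ hamiltonians are holomorphic, are in involution on $\mathcal O$, and the differentials of their restrictions to $\mathcal O$ are linearly independent on an open dense subset of $\mathcal O$. -/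

import Mathlib

open scoped Topology

noncomputable section

namespace Boussinesq

/-! ### Hamiltonian systems on subvarieties of a Poisson space -/

section General

variable {ι : Type*} [Fintype ι] [DecidableEq ι]

/-- The partial derivative of `F` along the `i`-th coordinate. -/
def partialDeriv (i : ι) (F : (ι → ℂ) → ℂ) (x : ι → ℂ) : ℂ :=
  fderiv ℂ F x (Pi.single i 1)

/-- The bracket `{F, H} = ∑ i j, W i j * ∂F/∂x_i * ∂H/∂x_j`. -/
def bracket (W : (ι → ℂ) → Matrix ι ι ℂ) (F H : (ι → ℂ) → ℂ) (x : ι → ℂ) : ℂ :=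
  ∑ i, ∑ j, W x i j * partialDeriv i F x * partialDeriv j H x

/-- `W` is a (holomorphic) Poisson structure: skew-symmetric, with the Jacobi identity. -/
structure IsPoissonTensor (W : (ι → ℂ) → Matrix ι ι ℂ) : Prop where
  analytic : ∀ i j, AnalyticOnNhd ℂ (fun x => W x i j) Set.univ
  skew : ∀ x i j, W x i j = - W x j i
  jacobi : ∀ x i j k,
    ∑ l, (W x i l * partialDeriv l (fun y => W y j k) x
        + W x j l * partialDeriv l (fun y => W y k i) x
        + W x k l * partialDeriv l (fun y => W y i j) x) = 0

/-- The values at `x` of all hamiltonian vector fields, i.e. the range of the Poisson tensor. -/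
def hamiltonianDirections (W : (ι → ℂ) → Matrix ι ι ℂ) (x : ι → ℂ) : Submodule ℂ (ι → ℂ) :=
  LinearMap.range (W x).mulVecLin

/-- `S` is an embedded complex submanifold of dimension `d`: locally it is a level set of
a holomorphic submersion whose fibres have dimension `d`. -/
def IsComplexSubmanifold (S : Set (ι → ℂ)) (d : ℕ) : Prop :=
  ∀ p ∈ S, ∃ (k : ℕ) (U : Set (ι → ℂ)) (Φ : (ι → ℂ) → (Fin k → ℂ)),
    d + k = Fintype.card ι ∧ IsOpen U ∧ p ∈ U ∧ AnalyticOnNhd ℂ Φ U ∧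
    (∀ x ∈ U, x ∈ S ↔ Φ x = 0) ∧
    (∀ x ∈ U, x ∈ S → Function.Surjective (fderiv ℂ Φ x))

/-- The tangent space of `S` at `p`: spanned by velocities of (complex) curves in `S`
through `p`. -/
def tangentSpace (S : Set (ι → ℂ)) (p : ι → ℂ) : Submodule ℂ (ι → ℂ) :=
  Submodule.span ℂ {v | ∃ γ : ℂ → (ι → ℂ), γ 0 = p ∧ (∀ᶠ t in 𝓝 (0 : ℂ), γ t ∈ S) ∧
    HasDerivAt γ v 0}

/-- Liouville integrability, with `n` degrees of freedom, of the functions `h` on the phase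
space `S` in the Poisson space `(ℂ^ι, W)`.

The phase space is a `2n`-dimensional complex submanifold whose tangent spaces are exactly
the ranges of the Poisson tensor; equivalently all hamiltonian vector fields are tangent to `S`
and the Poisson bracket restricts to a nondegenerate one on `S`, so that `S` is a symplectic
manifold with form `ω(X_F, X_H) = {F, H}`.  There are `n` functions, which are in involution,
and the differentials of their restrictions to `S` are linearly independent on an open dense
subset of `S`. -/
structure IsLiouvilleIntegrable {κ : Type*} [Fintype κ] (W : (ι → ℂ) → Matrix ι ι ℂ)
    (S : Set (ι → ℂ)) (n : ℕ) (h : κ → (ι → ℂ) → ℂ) : Prop where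
  poisson : IsPoissonTensor W
  submanifold : IsComplexSubmanifold S (2 * n)
  symplectic : ∀ p ∈ S, tangentSpace S p = hamiltonianDirections W p
  card : Fintype.card κ = n
  analytic : ∀ k, AnalyticOnNhd ℂ (h k) Set.univ
  involution : ∀ j k, ∀ p ∈ S, bracket W (h j) (h k) p = 0
  independent : ∃ U : Set (ι → ℂ), IsOpen U ∧ S ⊆ closure (S ∩ U) ∧
    ∀ p ∈ S ∩ U, LinearIndependent ℂ
      (fun k => (fderiv ℂ (h k) p).toLinearMap.domRestrict (tangentSpace S p))

end General

/-! ### The loop algebra of `sl(3)` and the manifold `M_N` -/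

/-- `3 × 3` matrices of formal Laurent series in `z`. -/
abbrev LaurentMat : Type := Matrix (Fin 3) (Fin 3) (LaurentSeries ℂ)

/-- The matrix `z ^ n * A`. -/
def monomialMat (n : ℤ) (A : Matrix (Fin 3) (Fin 3) ℂ) : LaurentMat :=
  A.map (HahnSeries.single n)

/-- The matrix unit `E_{ij}`, with the customary numbering of rows and columns by `1, 2, 3`
shifted to `0, 1, 2`. -/
def E (i j : Fin 3) : Matrix (Fin 3) (Fin 3) ℂ := Matrix.single i j 1

/-- The basis `X_1, …, X_8` of `sl(3)`. -/
def X : Fin 8 → Matrix (Fin 3) (Fin 3) ℂ :=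
  ![(1 / 3 : ℂ) • ((2 : ℂ) • E 0 0 - E 1 1 - E 2 2),
    (1 / 3 : ℂ) • (E 0 0 + E 1 1 - (2 : ℂ) • E 2 2),
    E 1 0, E 2 1, E 2 0, E 0 1, E 1 2, E 0 2]

/-- The basis of `sl(3)` dual to `X` with respect to `tr (A * B)`. -/
def XDual : Fin 8 → Matrix (Fin 3) (Fin 3) ℂ :=
  ![E 0 0 - E 1 1, E 1 1 - E 2 2, E 0 1, E 1 2, E 0 2, E 1 0, E 2 1, E 2 0]

/-- The constant terms, coming from the regular part of the r-matrix, of the dual basis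
elements with `ℓ = 0`. -/
def correction : Fin 8 → Matrix (Fin 3) (Fin 3) ℂ :=
  ![0, 0, - E 2 0, - E 2 0, E 1 0 - (2 : ℂ) • E 2 1, 0, 0, 0]

/-- The basis element `X_a z^ℓ` of the loop algebra. -/
def loopBasis (a : Fin 8) (l : ℕ) : LaurentMat := monomialMat l (X a)

/-- The basis element of the dual of the loop algebra which is dual to `X_a z^ℓ`. -/
def loopDualBasis (a : Fin 8) (l : ℕ) : LaurentMat :=
  monomialMat (-(l : ℤ) - 1) (XDual a) + if l = 0 then monomialMat 0 (correction a) else 0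

/-- The shift element `z E_31 + E_12 + E_23`. -/
def shift : LaurentMat :=
  monomialMat 1 (E 2 0) + monomialMat 0 (E 0 1) + monomialMat 0 (E 1 2)

/-- The pairing `⟨A, B⟩ = res_{z=0} tr (A(z) B(z))`. -/
def pairing (A B : LaurentMat) : ℂ := (A * B).trace.coeff (-1)

/-- Indices `(a, ℓ)` of the dynamic variables. -/
abbrev Idx (N : ℕ) : Type := Fin 8 × Fin N

/-- The manifold `M_N` in its global coordinates `L_{a;ℓ}`. -/
abbrev PhaseSpace (N : ℕ) : Type := Idx N → ℂ

/-- The Lax matrix `L_N(z) = s(z) + ∑ L_{a;ℓ} X*_{a;ℓ}(z)`. -/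
def lax (N : ℕ) (L : PhaseSpace N) : LaurentMat :=
  shift + ∑ i : Idx N, L i • loopDualBasis i.1 i.2

/-- The polynomial matrix `z^N L_N(z)`. -/
def laxPoly (N : ℕ) (L : PhaseSpace N) : LaurentMat :=
  (HahnSeries.single (N : ℤ) (1 : ℂ) : LaurentSeries ℂ) • lax N L

/-- The Lie–Poisson tensor `W = ⟨L_N(z), [X_{a;ℓ}, X_{b;ℓ'}]⟩`. -/
def liePoisson (N : ℕ) (L : PhaseSpace N) : Matrix (Idx N) (Idx N) ℂ :=
  fun i j => pairing (lax N L) ⁅loopBasis i.1 i.2, loopBasis j.1 j.2⁆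

/-! ### Coadjoint orbits -/

/-- The loop group of `SL(3)`: formal power series in `z`. -/
abbrev LoopGroup : Type := Matrix.SpecialLinearGroup (Fin 3) (PowerSeries ℂ)

/-- An element of the loop group as a matrix of Laurent series. -/
def LoopGroup.toMat (g : LoopGroup) : LaurentMat :=
  (g : Matrix (Fin 3) (Fin 3) (PowerSeries ℂ)).map (HahnSeries.ofPowerSeries ℤ ℂ)

/-- The coadjoint orbit of `L` in `M_N`: all `L'` with `L' = Ad*_g L` for some `g`, where
`⟨Ad*_g L, Y⟩ = ⟨L, g⁻¹ Y g⟩` for all `Y` in the loop algebra. -/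
def coadjointOrbit (N : ℕ) (L : PhaseSpace N) : Set (PhaseSpace N) :=
  {L' | ∃ g : LoopGroup, ∀ (a : Fin 8) (l : ℕ),
    pairing (lax N L') (loopBasis a l) =
      pairing (lax N L) (LoopGroup.toMat g⁻¹ * loopBasis a l * LoopGroup.toMat g)}

/-- The dimension of the coadjoint orbit of `L`: the dimension of its tangent space
`{ad*_Y L}` at `L`, which is the range of the Lie–Poisson tensor. -/
def orbitDim (N : ℕ) (L : PhaseSpace N) : ℕ :=
  Module.finrank ℂ (hamiltonianDirections (liePoisson N) L)

/-- The regular diagonal initial elements: only the coordinates along `X*_{1;ℓ}`, `X*_{2;ℓ}`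
are nonzero, and the diagonal coefficient
`diag (α₁, α₂ - α₁, -α₂)` of `z^{-N}` has pairwise distinct entries. -/
def weylChamber (N : ℕ) : Set (PhaseSpace N) :=
  {L | (∀ (a : Fin 8) (l : Fin N), a ≠ 0 → a ≠ 1 → L (a, l) = 0) ∧
    ∀ l : Fin N, (l : ℕ) + 1 = N →
      L (0, l) ≠ L (1, l) - L (0, l) ∧ L (1, l) - L (0, l) ≠ - L (1, l) ∧
      L (0, l) ≠ - L (1, l)}

/-! ### The hamiltonians -/

/-- `h_{3k+2}`: the coefficient of `z^{2N-k}` in `(1/2) tr (z^N L_N(z))²`. -/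
def hQuad (N k : ℕ) (L : PhaseSpace N) : ℂ :=
  (1 / 2 : ℂ) * ((laxPoly N L) ^ 2).trace.coeff (2 * (N : ℤ) - k)

/-- `h_{3k+3}`: the coefficient of `z^{3N-k}` in `(1/3) tr (z^N L_N(z))³`. -/
def hCub (N k : ℕ) (L : PhaseSpace N) : ℂ :=
  (1 / 3 : ℂ) * ((laxPoly N L) ^ 3).trace.coeff (3 * (N : ℤ) - k)

/-- The hamiltonians `h_{3k+2}`, `1 ≤ k ≤ N`, and `h_{3k+3}`, `1 ≤ k ≤ 2N`. -/
def hamiltonian (N : ℕ) : Fin N ⊕ Fin (2 * N) → PhaseSpace N → ℂ :=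
  Sum.elim (fun k => hQuad N (k + 1)) (fun k => hCub N (k + 1))

end Boussinesq

end

open scoped Topology
noncomputable section
namespace Boussinesq
open scoped Polynomial
open Finset.HasAntidiagonal (antidiagonal mem_antidiagonal)

/-! ### Linear algebra of the basis of `sl(3)` -/

/-! Write `Q = z^N L_N(z)` (`laxP`). Its coefficients below `z^N` form an arbitrary element of
`sl(3, R)`, `R = ℂ[z]/(z^N)`, linear in the coordinates; its two remaining coefficients are
constants plus corrections linear in the coefficient of `z^{N-1}`. Over `R` the Poisson tensor is `Y
↦ [Y, Q]` (`coeffMat_dirn_liePoisson_mulVec`) and the orbits are conjugacy classes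
(`mem_coadjointOrbit_iff`).

Regularity. Call a point regular if `Q(0)` has a cyclic vector. That vector stays cyclic over `R`,
so the centralizer of `Q` is `R[Q]`, with traceless part of dimension at most `2N`; and the `2N`
coefficients of `tr Q²` and `tr Q³` modulo `z^N` (the Casimirs) have independent differentials. Both
counts give `6N`, so the Poisson tensor has as range the common kernel of these differentials
(`hamiltonianDirections_eq_ker`). Regular matrices with equal Casimirs share a companion matrix and
are conjugate, so an orbit is a level set of the Casimirs inside the open set of regular points;
this yields the submanifold and its tangent spaces. A diagonal matrix with distinct entries has the
cyclic vector `(1,1,1)`. Conversely, rank `6N` forces regularity (`exists_isRegularAt_of_orbitDim`),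
by comparing the centralizers modulo `z^k` for `k ≤ N + 1`.

Involution. The corrections in the dual basis describe a subalgebra complementary to the power
series, and `Q` annihilates its commutators (`trForm_commutator_eq_zero`). The gradients of the
hamiltonians are the regular parts of matrices `F`, `G` commuting with `Q`. Splitting off the
complementary parts expresses the bracket through `[F, ·]`, `[G, ·]` and a commutator in the
complementary subalgebra, and each of these pairs to zero with `Q` (`sum_liePoisson_grad`).

Independence. Every regular orbit contains a point where `Q` has an explicit form whose centralizer
in the polynomial matrices is `ℂ[z][Q]`. A linear relation between the differentials there gives `A
Q + B Q²`, with `A`, `B` recording the relation, as a sum of a complementary part, `z^{2N}` times a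
polynomial in `Q`, and `z^{3N} G`. The first and last turn out to commute with `Q`, and degree
bounds leave no room for `A` and `B` (`eq_zero_of_sum_fderiv_hamiltonian`). Independence spreads to
a dense subset because any two points of an orbit are joined by an analytic curve in it
(`exists_analytic_path`), along which the identity theorem applies to a determinant. -/

theorem E_zero_zero : E 0 0 = !![1, 0, 0; 0, 0, 0; 0, 0, 0] := by
  ext i j
  fin_cases i <;> fin_cases j <;> rfl

theorem E_one_one : E 1 1 = !![0, 0, 0; 0, 1, 0; 0, 0, 0] := by
  ext i j
  fin_cases i <;> fin_cases j <;> rfl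

theorem E_two_two : E 2 2 = !![0, 0, 0; 0, 0, 0; 0, 0, 1] := by
  ext i j
  fin_cases i <;> fin_cases j <;> rfl

theorem E_one_zero : E 1 0 = !![0, 0, 0; 1, 0, 0; 0, 0, 0] := by
  ext i j
  fin_cases i <;> fin_cases j <;> rfl

theorem E_two_one : E 2 1 = !![0, 0, 0; 0, 0, 0; 0, 1, 0] := by
  ext i j
  fin_cases i <;> fin_cases j <;> rfl

theorem E_two_zero : E 2 0 = !![0, 0, 0; 0, 0, 0; 1, 0, 0] := by
  ext i j
  fin_cases i <;> fin_cases j <;> rfl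

theorem E_zero_one : E 0 1 = !![0, 1, 0; 0, 0, 0; 0, 0, 0] := by
  ext i j
  fin_cases i <;> fin_cases j <;> rfl

theorem E_one_two : E 1 2 = !![0, 0, 0; 0, 0, 1; 0, 0, 0] := by
  ext i j
  fin_cases i <;> fin_cases j <;> rfl

theorem E_zero_two : E 0 2 = !![0, 0, 1; 0, 0, 0; 0, 0, 0] := by
  ext i j
  fin_cases i <;> fin_cases j <;> rfl

theorem X_eq : X = ![!![2 / 3, 0, 0; 0, -1 / 3, 0; 0, 0, -1 / 3],
    !![1 / 3, 0, 0; 0, 1 / 3, 0; 0, 0, -2 / 3],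
    !![0, 0, 0; 1, 0, 0; 0, 0, 0], !![0, 0, 0; 0, 0, 0; 0, 1, 0], !![0, 0, 0; 0, 0, 0; 1, 0, 0],
    !![0, 1, 0; 0, 0, 0; 0, 0, 0], !![0, 0, 0; 0, 0, 1; 0, 0, 0],
    !![0, 0, 1; 0, 0, 0; 0, 0, 0]] := by
  simp only [X, E_zero_zero, E_one_one, E_two_two, E_one_zero, E_two_one, E_two_zero, E_zero_one,
    E_one_two, E_zero_two]
  congr 1
  · ext i j
    fin_cases i <;> fin_cases j <;> simp <;> norm_num
  congr 1
  ext i j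
  fin_cases i <;> fin_cases j <;> simp
  norm_num

theorem XDual_eq : XDual = ![!![1, 0, 0; 0, -1, 0; 0, 0, 0], !![0, 0, 0; 0, 1, 0; 0, 0, -1],
    !![0, 1, 0; 0, 0, 0; 0, 0, 0], !![0, 0, 0; 0, 0, 1; 0, 0, 0], !![0, 0, 1; 0, 0, 0; 0, 0, 0],
    !![0, 0, 0; 1, 0, 0; 0, 0, 0], !![0, 0, 0; 0, 0, 0; 0, 1, 0],
    !![0, 0, 0; 0, 0, 0; 1, 0, 0]] := by
  simp only [XDual, E_zero_zero, E_one_one, E_two_two, E_one_zero, E_two_one, E_two_zero,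
    E_zero_one, E_one_two, E_zero_two]
  congr 1
  · ext i j
    fin_cases i <;> fin_cases j <;> simp
  congr 1
  ext i j
  fin_cases i <;> fin_cases j <;> simp

theorem correction_eq : correction = ![0, 0, !![0, 0, 0; 0, 0, 0; -1, 0, 0],
    !![0, 0, 0; 0, 0, 0; -1, 0, 0], !![0, 0, 0; 1, 0, 0; 0, -2, 0], 0, 0, 0] := by
  have h1 : -E 2 0 = !![0, 0, 0; 0, 0, 0; -1, 0, 0] := by
    rw [E_two_zero]
    ext i j
    fin_cases i <;> fin_cases j <;> simp
  have h2 : E 1 0 - (2 : ℂ) • E 2 1 = !![0, 0, 0; 1, 0, 0; 0, -2, 0] := by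
    rw [E_one_zero, E_two_one]
    ext i j
    fin_cases i <;> fin_cases j <;> simp
  rw [correction, h1, h2]

theorem sum_fin_eight {M : Type*} [AddCommMonoid M]
    (f : Matrix (Fin 3) (Fin 3) ℂ → Matrix (Fin 3) (Fin 3) ℂ → M) :
    ∑ a, f (X a) (XDual a) =
      f !![2 / 3, 0, 0; 0, -1 / 3, 0; 0, 0, -1 / 3] !![1, 0, 0; 0, -1, 0; 0, 0, 0] +
      f !![1 / 3, 0, 0; 0, 1 / 3, 0; 0, 0, -2 / 3] !![0, 0, 0; 0, 1, 0; 0, 0, -1] +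
      f !![0, 0, 0; 1, 0, 0; 0, 0, 0] !![0, 1, 0; 0, 0, 0; 0, 0, 0] +
      f !![0, 0, 0; 0, 0, 0; 0, 1, 0] !![0, 0, 0; 0, 0, 1; 0, 0, 0] +
      f !![0, 0, 0; 0, 0, 0; 1, 0, 0] !![0, 0, 1; 0, 0, 0; 0, 0, 0] +
      f !![0, 1, 0; 0, 0, 0; 0, 0, 0] !![0, 0, 0; 1, 0, 0; 0, 0, 0] +
      f !![0, 0, 0; 0, 0, 1; 0, 0, 0] !![0, 0, 0; 0, 0, 0; 0, 1, 0] +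
      f !![0, 0, 1; 0, 0, 0; 0, 0, 0] !![0, 0, 0; 0, 0, 0; 1, 0, 0] := by
  rw [Fin.sum_univ_eight, X_eq, XDual_eq]
  rfl

theorem trace_X (a : Fin 8) : (X a).trace = 0 := by
  rw [X_eq]
  fin_cases a <;> simp [Matrix.trace_fin_three] <;> norm_num

theorem trace_XDual (a : Fin 8) : (XDual a).trace = 0 := by
  rw [XDual_eq]
  fin_cases a <;> simp [Matrix.trace_fin_three]

theorem trace_correction (a : Fin 8) : (correction a).trace = 0 := by
  rw [correction_eq]
  fin_cases a <;> simp [Matrix.trace_fin_three]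

theorem trace_mul_fin_three {R : Type*} [CommRing R] (A B : Matrix (Fin 3) (Fin 3) R) :
    (A * B).trace = A 0 0 * B 0 0 + A 0 1 * B 1 0 + A 0 2 * B 2 0
      + (A 1 0 * B 0 1 + A 1 1 * B 1 1 + A 1 2 * B 2 1)
      + (A 2 0 * B 0 2 + A 2 1 * B 1 2 + A 2 2 * B 2 2) := by
  simp [Matrix.trace_fin_three, Matrix.mul_apply, Fin.sum_univ_three]

/-- Completeness of the dual bases, stated for all matrices: since they span only `sl(3)`, the
expansion loses the scalar part. -/
theorem sum_trace_mul_XDual_smul_X (M : Matrix (Fin 3) (Fin 3) ℂ) :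
    ∑ a, (M * XDual a).trace • X a = M - (M.trace / 3) • 1 := by
  rw [sum_fin_eight fun A B => (M * B).trace • A]
  simp only [trace_mul_fin_three]
  rw [Matrix.trace_fin_three M]
  ext i j
  fin_cases i <;> fin_cases j <;> simp <;> ring

theorem sum_trace_mul_X_smul_XDual (M : Matrix (Fin 3) (Fin 3) ℂ) :
    ∑ a, (M * X a).trace • XDual a = M - (M.trace / 3) • 1 := by
  rw [sum_fin_eight fun A B => (M * A).trace • B]
  simp only [trace_mul_fin_three]
  rw [Matrix.trace_fin_three M]
  ext i j
  fin_cases i <;> fin_cases j <;> simp <;> ring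

theorem trace_X_mul_XDual (a b : Fin 8) : (X a * XDual b).trace = if a = b then 1 else 0 := by
  rw [trace_mul_fin_three, X_eq, XDual_eq]
  fin_cases a <;> fin_cases b <;> simp <;> norm_num

theorem trace_sum_smul_X_mul_XDual (c : Fin 8 → ℂ) (b : Fin 8) :
    ((∑ a, c a • X a) * XDual b).trace = c b := by
  simp [Finset.sum_mul, Matrix.trace_sum, trace_X_mul_XDual]

theorem trace_sum_smul_XDual_mul_X (c : Fin 8 → ℂ) (b : Fin 8) :
    ((∑ a, c a • XDual a) * X b).trace = c b := by
  rw [Matrix.trace_mul_comm]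
  simp [Finset.mul_sum, Matrix.trace_sum, trace_X_mul_XDual]

/-! ### Polynomial matrices -/

/-- Polynomial `3 × 3` matrices. -/
abbrev PolyMat : Type := Matrix (Fin 3) (Fin 3) ℂ[X]

/-- The polynomial matrix `z ^ n * A`. -/
def monP (n : ℕ) (A : Matrix (Fin 3) (Fin 3) ℂ) : PolyMat := A.map (Polynomial.monomial n)

/-- The coefficient of `z ^ n` in a polynomial matrix. -/
def coeffMat (n : ℕ) : PolyMat →ₗ[ℂ] Matrix (Fin 3) (Fin 3) ℂ :=
  (Polynomial.lcoeff ℂ n).mapMatrix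

theorem coeffMat_apply (n : ℕ) (F : PolyMat) (i j : Fin 3) :
    coeffMat n F i j = (F i j).coeff n := rfl

theorem coeffMat_monP (n m : ℕ) (A : Matrix (Fin 3) (Fin 3) ℂ) :
    coeffMat n (monP m A) = if m = n then A else 0 := by
  ext i j
  rw [coeffMat_apply, monP, Matrix.map_apply, Polynomial.coeff_monomial]
  split_ifs <;> rfl

theorem polyMat_ext {F G : PolyMat} (h : ∀ n, coeffMat n F = coeffMat n G) : F = G := by
  ext i j n
  exact congrFun (congrFun (h n) i) j

theorem coeffMat_mul (n : ℕ) (F G : PolyMat) :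
    coeffMat n (F * G) = ∑ p ∈ antidiagonal n, coeffMat p.1 F * coeffMat p.2 G := by
  ext i j
  simp only [coeffMat_apply, Matrix.mul_apply, Polynomial.finsetSum_coeff, Polynomial.coeff_mul,
    Matrix.sum_apply]
  rw [Finset.sum_comm]

theorem coeff_trace (n : ℕ) (F : PolyMat) : F.trace.coeff n = (coeffMat n F).trace := by
  simp [Matrix.trace, coeffMat_apply]

theorem coeff_trace_mul (n : ℕ) (F G : PolyMat) :
    (F * G).trace.coeff n =
      ∑ p ∈ antidiagonal n, (coeffMat p.1 F * coeffMat p.2 G).trace := by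
  rw [coeff_trace, coeffMat_mul, Matrix.trace_sum]

theorem coeff_trace_mul_monP (n m : ℕ) (F : PolyMat) (A : Matrix (Fin 3) (Fin 3) ℂ) (h : m ≤ n) :
    (F * monP m A).trace.coeff n = (coeffMat (n - m) F * A).trace := by
  rw [coeff_trace_mul, Finset.sum_eq_single (n - m, m)]
  · simp [coeffMat_monP]
  · rintro ⟨a, b⟩ hab hne
    rw [mem_antidiagonal] at hab
    have : m ≠ b := by
      rintro rfl
      apply hne
      simp only [Prod.mk.injEq, and_true] at *
      omega
    simp [coeffMat_monP, this]
  · intro h'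
    exact absurd (mem_antidiagonal.2 (by simp; omega)) h'

/-- The principal part of the Lax matrix, as the polynomial matrix `∑ L_{a;ℓ} z^{N-1-ℓ} X*_a`. -/
def polar (N : ℕ) : PhaseSpace N →ₗ[ℂ] PolyMat :=
  Fintype.linearCombination ℂ (fun i : Idx N => monP (N - 1 - i.2) (XDual i.1))

/-- The linear part of `z^N L_N(z)` as a function of the coordinates. -/
def dirn (N : ℕ) : PhaseSpace N →ₗ[ℂ] PolyMat :=
  Fintype.linearCombination ℂ (fun i : Idx N => monP (N - 1 - i.2) (XDual i.1) +
    if (i.2 : ℕ) = 0 then monP N (correction i.1) else 0)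

/-- `z^N` times the shift element. -/
def shiftP (N : ℕ) : PolyMat := monP (N + 1) (E 2 0) + monP N (E 0 1) + monP N (E 1 2)

/-- The polynomial matrix `z^N L_N(z)`. -/
def laxP (N : ℕ) (L : PhaseSpace N) : PolyMat := shiftP N + dirn N L

/-- The element `∑ η_{a;ℓ} X_a z^ℓ` of the loop algebra. -/
def alg (N : ℕ) : PhaseSpace N →ₗ[ℂ] PolyMat :=
  Fintype.linearCombination ℂ (fun i : Idx N => monP i.2 (X i.1))

/-- Polynomials as Laurent series. -/
def toLaurent : ℂ[X] →+* LaurentSeries ℂ :=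
  (HahnSeries.ofPowerSeries ℤ ℂ).comp Polynomial.coeToPowerSeries.ringHom

theorem toLaurent_apply (p : ℂ[X]) :
    toLaurent p = HahnSeries.ofPowerSeries ℤ ℂ (p : PowerSeries ℂ) := rfl

theorem toLaurent_monomial (n : ℕ) (c : ℂ) :
    toLaurent (Polynomial.monomial n c) = HahnSeries.single (n : ℤ) c := by
  rw [← Polynomial.C_mul_X_pow_eq_monomial, map_mul, map_pow, toLaurent_apply, toLaurent_apply,
    Polynomial.coe_C, Polynomial.coe_X, HahnSeries.ofPowerSeries_C, HahnSeries.ofPowerSeries_X,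
    HahnSeries.C_apply, HahnSeries.single_pow, HahnSeries.single_mul_single]
  simp

theorem coeff_toLaurent (p : ℂ[X]) (n : ℕ) : (toLaurent p).coeff (n : ℤ) = p.coeff n := by
  rw [toLaurent_apply, HahnSeries.ofPowerSeries_apply_coeff, Polynomial.coeff_coe]

theorem map_toLaurent_monP (n : ℕ) (A : Matrix (Fin 3) (Fin 3) ℂ) :
    (monP n A).map toLaurent = monomialMat n A := by
  ext1 i j
  simp [monP, monomialMat, toLaurent_monomial]

/-- The Laurent monomial `z ^ m`. -/
def zPow (m : ℤ) : LaurentSeries ℂ := HahnSeries.single m 1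

theorem zPow_mul_zPow (m n : ℤ) : zPow m * zPow n = zPow (m + n) := by
  simp [zPow]

/-- The scalar matrix `z ^ m`. -/
def zMat (m : ℤ) : LaurentMat := Matrix.diagonal fun _ => zPow m

theorem single_smul_eq_zMat_mul (m : ℤ) (A : LaurentMat) :
    (HahnSeries.single m (1 : ℂ) : LaurentSeries ℂ) • A = zMat m * A := by
  ext1 i j
  rw [zMat, Matrix.diagonal_mul]
  rfl

theorem zMat_mul_zMat (m n : ℤ) : zMat m * zMat n = zMat (m + n) := by
  rw [zMat, zMat, Matrix.diagonal_mul_diagonal]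
  simp only [zPow_mul_zPow]
  rfl

theorem zMat_zero : zMat 0 = 1 := Matrix.diagonal_one

theorem trace_zMat_mul (m : ℤ) (A : LaurentMat) : (zMat m * A).trace = zPow m * A.trace := by
  rw [Matrix.trace, Matrix.trace, Finset.mul_sum]
  simp only [zMat, Matrix.diag_apply, Matrix.diagonal_mul]

theorem zMat_mul_monomialMat (m n : ℤ) (A : Matrix (Fin 3) (Fin 3) ℂ) :
    zMat m * monomialMat n A = monomialMat (m + n) A := by
  ext1 i j
  rw [zMat, Matrix.diagonal_mul]
  simp [monomialMat, zPow]

theorem zMat_mul_smul (m : ℤ) (c : ℂ) (A : LaurentMat) : zMat m * c • A = c • (zMat m * A) := by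
  ext1 i j
  rw [zMat, Matrix.diagonal_mul, Matrix.smul_apply, Matrix.smul_apply, Matrix.diagonal_mul,
    ← HahnSeries.C_mul_eq_smul, ← HahnSeries.C_mul_eq_smul, mul_left_comm]

theorem map_toLaurent_smul (c : ℂ) (F : PolyMat) :
    (c • F).map toLaurent = c • F.map toLaurent := by
  ext1 i j
  simp only [Matrix.map_apply, Matrix.smul_apply]
  rw [Polynomial.smul_eq_C_mul, map_mul, toLaurent_apply (Polynomial.C c), Polynomial.coe_C,
    HahnSeries.ofPowerSeries_C, HahnSeries.C_mul_eq_smul]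

theorem laxPoly_eq (N : ℕ) (L : PhaseSpace N) : laxPoly N L = (laxP N L).map toLaurent := by
  have hmap : ∀ F : PolyMat, F.map toLaurent = toLaurent.mapMatrix F := fun F => rfl
  rw [laxPoly, single_smul_eq_zMat_mul, lax, laxP, dirn, Fintype.linearCombination_apply, mul_add,
    shift, shiftP, hmap, map_add, map_add, map_add, map_sum, Finset.mul_sum]
  simp only [← hmap, map_toLaurent_monP, mul_add, zMat_mul_monomialMat, map_toLaurent_smul]
  congr 1
  refine Finset.sum_congr rfl fun i _ => ?_
  rw [zMat_mul_smul]
  congr 1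
  rw [loopDualBasis, mul_add, zMat_mul_monomialMat, hmap, map_add, ← hmap, map_toLaurent_monP]
  congr 1
  · congr 1
    have := i.2.2
    push_cast [Nat.sub_sub, Nat.cast_sub (show 1 + (i.2 : ℕ) ≤ N by omega)]
    ring
  · split_ifs
    · rw [zMat_mul_monomialMat, ← hmap, map_toLaurent_monP, add_zero]
    · rw [mul_zero, map_zero]

theorem lax_eq (N : ℕ) (L : PhaseSpace N) :
    lax N L = zMat (-(N : ℤ)) * (laxP N L).map toLaurent := by
  rw [← laxPoly_eq, laxPoly, single_smul_eq_zMat_mul, ← mul_assoc, zMat_mul_zMat,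
    neg_add_cancel, zMat_zero, one_mul]

theorem trace_map_toLaurent (F : PolyMat) : (F.map toLaurent).trace = toLaurent F.trace := by
  simp [Matrix.trace]

theorem map_toLaurent_pow (F : PolyMat) (n : ℕ) :
    (F.map toLaurent) ^ n = (F ^ n).map toLaurent :=
  (map_pow (toLaurent.mapMatrix) F n).symm

theorem hQuad_eq (N k : ℕ) (hk : k ≤ 2 * N) (L : PhaseSpace N) :
    hQuad N k L = (1 / 2) * ((laxP N L) ^ 2).trace.coeff (2 * N - k) := by
  rw [hQuad, laxPoly_eq, map_toLaurent_pow, trace_map_toLaurent, ← coeff_toLaurent]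
  push_cast [Nat.cast_sub hk]
  rfl

theorem hCub_eq (N k : ℕ) (hk : k ≤ 3 * N) (L : PhaseSpace N) :
    hCub N k L = (1 / 3) * ((laxP N L) ^ 3).trace.coeff (3 * N - k) := by
  rw [hCub, laxPoly_eq, map_toLaurent_pow, trace_map_toLaurent, ← coeff_toLaurent]
  push_cast [Nat.cast_sub hk]
  rfl

/-- Matrices of power series. -/
abbrev SeriesMat : Type := Matrix (Fin 3) (Fin 3) (PowerSeries ℂ)

/-- A polynomial matrix as a matrix of power series. -/
def toSeries : PolyMat →+* SeriesMat := Polynomial.coeToPowerSeries.ringHom.mapMatrix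

theorem toSeries_apply (F : PolyMat) (i j : Fin 3) :
    toSeries F i j = ((F i j : ℂ[X]) : PowerSeries ℂ) := rfl

/-- The factor `z^{-N}` moves the residue to the coefficient of `z^{N-1}`. Power series are allowed
on the right because conjugation by the loop group leaves the polynomials. -/
theorem pairing_lax_eq_coeff_laxP (N : ℕ) (hN : 1 ≤ N) (L : PhaseSpace N) (Y : SeriesMat) :
    pairing (lax N L) (Y.map (HahnSeries.ofPowerSeries ℤ ℂ)) =
      PowerSeries.coeff (N - 1) (toSeries (laxP N L) * Y).trace := by
  have h1 : (laxP N L).map toLaurent =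
      (HahnSeries.ofPowerSeries ℤ ℂ).mapMatrix (toSeries (laxP N L)) := rfl
  have h2 : Y.map (HahnSeries.ofPowerSeries ℤ ℂ) =
      (HahnSeries.ofPowerSeries ℤ ℂ).mapMatrix Y := rfl
  rw [pairing, lax_eq, h1, h2, mul_assoc, ← map_mul, trace_zMat_mul]
  have h3 : ((HahnSeries.ofPowerSeries ℤ ℂ).mapMatrix (toSeries (laxP N L) * Y)).trace =
      HahnSeries.ofPowerSeries ℤ ℂ (toSeries (laxP N L) * Y).trace := by
    rw [Matrix.trace, Matrix.trace, map_sum]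
    rfl
  rw [h3, zPow]
  have h4 := HahnSeries.coeff_single_mul_add (r := (1 : ℂ))
    (x := HahnSeries.ofPowerSeries ℤ ℂ (toSeries (laxP N L) * Y).trace)
    (a := ((N - 1 : ℕ) : ℤ)) (b := -(N : ℤ))
  rw [HahnSeries.ofPowerSeries_apply_coeff, one_mul] at h4
  rw [← h4]
  congr 1
  push_cast [Nat.cast_sub hN]
  ring

theorem map_ofPowerSeries_toSeries (F : PolyMat) :
    (toSeries F).map (HahnSeries.ofPowerSeries ℤ ℂ) = F.map toLaurent := rfl

theorem loopBasis_eq (a : Fin 8) (l : ℕ) : loopBasis a l = (monP l (X a)).map toLaurent := by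
  rw [map_toLaurent_monP, loopBasis]

/-! ### The residue pairing of polynomial matrices -/

/-- The bilinear form `(F, G) ↦` the coefficient of `z ^ n` in `tr (F * G)`. -/
def trForm (n : ℕ) : PolyMat →ₗ[ℂ] PolyMat →ₗ[ℂ] ℂ :=
  (LinearMap.mul ℂ PolyMat).compr₂ (Polynomial.lcoeff ℂ n ∘ₗ Matrix.traceLinearMap (Fin 3) ℂ ℂ[X])

theorem trForm_apply (n : ℕ) (F G : PolyMat) : trForm n F G = (F * G).trace.coeff n := rfl

theorem trForm_comm (n : ℕ) (F G : PolyMat) : trForm n F G = trForm n G F := by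
  rw [trForm_apply, trForm_apply, Matrix.trace_mul_comm]

theorem trForm_mul_left (n : ℕ) (A B C : PolyMat) : trForm n (A * B) C = trForm n A (B * C) := by
  rw [trForm_apply, trForm_apply, mul_assoc]

/-- Invariance of the trace form, from cyclicity of the trace; it converts the Lie–Poisson bracket
into a commutator with `Q`. -/
theorem trForm_commutator (n : ℕ) (A B C : PolyMat) :
    trForm n (A * B - B * A) C = trForm n A (B * C - C * B) := by
  rw [map_sub, LinearMap.sub_apply, map_sub, trForm_mul_left, ← trForm_mul_left n A C B,
    trForm_comm n (A * C), ← trForm_mul_left n B A C]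

theorem trForm_congr {n : ℕ} {F F' G G' : PolyMat} (hF : ∀ m ≤ n, coeffMat m F = coeffMat m F')
    (hG : ∀ m ≤ n, coeffMat m G = coeffMat m G') : trForm n F G = trForm n F' G' := by
  rw [trForm_apply, trForm_apply, coeff_trace_mul, coeff_trace_mul]
  refine Finset.sum_congr rfl ?_
  rintro ⟨a, b⟩ hab
  rw [mem_antidiagonal] at hab
  simp only at hab
  rw [hF a (by omega), hG b (by omega)]

theorem trForm_monP_right (n m : ℕ) (F : PolyMat) (A : Matrix (Fin 3) (Fin 3) ℂ) (h : m ≤ n) :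
    trForm n F (monP m A) = (coeffMat (n - m) F * A).trace := coeff_trace_mul_monP n m F A h

theorem coeffMat_mul_congr {n : ℕ} {F F' G G' : PolyMat}
    (hF : ∀ m ≤ n, coeffMat m F = coeffMat m F') (hG : ∀ m ≤ n, coeffMat m G = coeffMat m G') :
    coeffMat n (F * G) = coeffMat n (F' * G') := by
  rw [coeffMat_mul, coeffMat_mul]
  refine Finset.sum_congr rfl ?_
  rintro ⟨a, b⟩ hab
  rw [mem_antidiagonal] at hab
  simp only at hab
  rw [hF a (by omega), hG b (by omega)]

theorem trace_coeffMat_commutator (n : ℕ) (F G : PolyMat) :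
    (coeffMat n (F * G - G * F)).trace = 0 := by
  rw [← coeff_trace, Matrix.trace_sub, Matrix.trace_mul_comm, sub_self, Polynomial.coeff_zero]

/-! ### Coefficients of the Lax matrix -/

theorem coeffMat_polar (N : ℕ) (v : PhaseSpace N) (l : Fin N) :
    coeffMat (N - 1 - l) (polar N v) = ∑ a, v (a, l) • XDual a := by
  rw [polar, Fintype.linearCombination_apply, map_sum, Fintype.sum_prod_type]
  refine Finset.sum_congr rfl fun a _ => ?_
  rw [Finset.sum_eq_single l]
  · rw [map_smul, coeffMat_monP, if_pos rfl]
  · intro b _ hb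
    have h1 := b.2
    have h2 := l.2
    have h3 : (b : ℕ) ≠ l := fun h => hb (Fin.ext h)
    rw [map_smul, coeffMat_monP, if_neg (by simp only; omega), smul_zero]
  · simp

theorem coeffMat_polar_of_le (N n : ℕ) (v : PhaseSpace N) (h : N ≤ n) :
    coeffMat n (polar N v) = 0 := by
  rw [polar, Fintype.linearCombination_apply, map_sum]
  refine Finset.sum_eq_zero fun i _ => ?_
  have := i.2.2
  rw [map_smul, coeffMat_monP, if_neg (by omega), smul_zero]

theorem coeffMat_alg (N : ℕ) (v : PhaseSpace N) (l : Fin N) :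
    coeffMat l (alg N v) = ∑ a, v (a, l) • X a := by
  rw [alg, Fintype.linearCombination_apply, map_sum, Fintype.sum_prod_type]
  refine Finset.sum_congr rfl fun a _ => ?_
  rw [Finset.sum_eq_single l]
  · rw [map_smul, coeffMat_monP, if_pos rfl]
  · intro b _ hb
    have h3 : (b : ℕ) ≠ l := fun h => hb (Fin.ext h)
    rw [map_smul, coeffMat_monP, if_neg h3, smul_zero]
  · simp

theorem coeffMat_alg_of_le (N n : ℕ) (v : PhaseSpace N) (h : N ≤ n) :
    coeffMat n (alg N v) = 0 := by
  rw [alg, Fintype.linearCombination_apply, map_sum]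
  refine Finset.sum_eq_zero fun i _ => ?_
  have := i.2.2
  rw [map_smul, coeffMat_monP, if_neg (by omega), smul_zero]

theorem alg_single (N : ℕ) (i : Idx N) : alg N (Pi.single i 1) = monP i.2 (X i.1) := by
  rw [alg, Fintype.linearCombination_apply_single, one_smul]

theorem dirn_eq (N : ℕ) (v : PhaseSpace N) : dirn N v = polar N v +
    monP N (∑ i : Idx N, if (i.2 : ℕ) = 0 then v i • correction i.1 else 0) := by
  have h : monP N (∑ i : Idx N, if (i.2 : ℕ) = 0 then v i • correction i.1 else 0) =
      ∑ i : Idx N, v i • (if (i.2 : ℕ) = 0 then monP N (correction i.1) else 0) := by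
    refine polyMat_ext fun n => ?_
    rw [coeffMat_monP, map_sum]
    split_ifs with hn
    · refine Finset.sum_congr rfl fun i _ => ?_
      rw [map_smul]
      split_ifs
      · rw [coeffMat_monP, if_pos hn]
      · simp
    · symm
      refine Finset.sum_eq_zero fun i _ => ?_
      rw [map_smul]
      split_ifs
      · rw [coeffMat_monP, if_neg hn, smul_zero]
      · simp
  rw [h, dirn, polar, Fintype.linearCombination_apply, Fintype.linearCombination_apply,
    ← Finset.sum_add_distrib]
  simp only [smul_add]

theorem coeffMat_dirn (N n : ℕ) (v : PhaseSpace N) (h : n < N) :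
    coeffMat n (dirn N v) = coeffMat n (polar N v) := by
  rw [dirn_eq, map_add, coeffMat_monP, if_neg (by omega), add_zero]

theorem coeffMat_laxP (N n : ℕ) (L : PhaseSpace N) (h : n < N) :
    coeffMat n (laxP N L) = coeffMat n (polar N L) := by
  rw [laxP, map_add, coeffMat_dirn N n L h, shiftP, map_add, map_add, coeffMat_monP, coeffMat_monP,
    coeffMat_monP, if_neg (by omega), if_neg (by omega), if_neg (by omega)]
  simp

theorem coeffMat_laxP_sub (N : ℕ) (L : PhaseSpace N) (l : Fin N) :
    coeffMat (N - 1 - l) (laxP N L) = ∑ a, L (a, l) • XDual a := by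
  have := l.2
  rw [coeffMat_laxP N _ L (by omega), coeffMat_polar]

theorem trace_dirn (N : ℕ) (v : PhaseSpace N) : (dirn N v).trace = 0 := by
  rw [dirn, Fintype.linearCombination_apply, Matrix.trace_sum]
  refine Finset.sum_eq_zero fun i _ => ?_
  have h : ∀ (n : ℕ) (A : Matrix (Fin 3) (Fin 3) ℂ), A.trace = 0 → (monP n A).trace = 0 := by
    intro n A hA
    ext m
    rw [coeff_trace, coeffMat_monP]
    split_ifs <;> simp [hA]
  rw [Matrix.trace_smul, Matrix.trace_add, h _ _ (trace_XDual _), zero_add]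
  split_ifs
  · rw [h _ _ (trace_correction _), smul_zero]
  · simp

theorem trace_laxP (N : ℕ) (L : PhaseSpace N) : (laxP N L).trace = 0 := by
  rw [laxP, Matrix.trace_add, trace_dirn, shiftP]
  simp [Matrix.trace_fin_three, monP, E_two_zero, E_zero_one, E_one_two]

theorem eq_zero_of_coeffMat_polar (N : ℕ) (v : PhaseSpace N)
    (h : ∀ n < N, coeffMat n (polar N v) = 0) : v = 0 := by
  funext ⟨a, l⟩
  have h1 := trace_sum_smul_XDual_mul_X (fun a => v (a, l)) a
  have := l.2
  rw [← coeffMat_polar, h _ (by omega)] at h1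
  simpa using h1.symm

theorem eq_zero_of_coeffMat_alg (N : ℕ) (v : PhaseSpace N)
    (h : ∀ n < N, coeffMat n (alg N v) = 0) : v = 0 := by
  funext ⟨a, l⟩
  have h1 := trace_sum_smul_X_mul_XDual (fun a => v (a, l)) a
  rw [← coeffMat_alg, h _ l.2] at h1
  simpa using h1.symm

/-! ### The Lie–Poisson tensor -/

theorem pairing_lax_map_toLaurent (N : ℕ) (hN : 1 ≤ N) (L : PhaseSpace N) (F : PolyMat) :
    pairing (lax N L) (F.map toLaurent) = trForm (N - 1) (laxP N L) F := by
  rw [← map_ofPowerSeries_toSeries, pairing_lax_eq_coeff_laxP N hN, ← map_mul, trForm_apply,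
    ← Polynomial.coeff_coe]
  congr 1

theorem liePoisson_eq (N : ℕ) (hN : 1 ≤ N) (L : PhaseSpace N) (i j : Idx N) :
    liePoisson N L i j = trForm (N - 1) (laxP N L)
      (monP i.2 (X i.1) * monP j.2 (X j.1) - monP j.2 (X j.1) * monP i.2 (X i.1)) := by
  have hmap : ∀ F : PolyMat, F.map toLaurent = toLaurent.mapMatrix F := fun F => rfl
  rw [liePoisson, ← pairing_lax_map_toLaurent N hN, loopBasis_eq, loopBasis_eq, Ring.lie_def, hmap,
    hmap, hmap, map_sub, map_mul, map_mul]

theorem sum_liePoisson (N : ℕ) (hN : 1 ≤ N) (L ξ η : PhaseSpace N) :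
    ∑ i, ∑ j, liePoisson N L i j * ξ i * η j = trForm (N - 1) (laxP N L)
      (alg N ξ * alg N η - alg N η * alg N ξ) := by
  rw [alg, Fintype.linearCombination_apply, Fintype.linearCombination_apply, Finset.sum_mul_sum,
    Finset.sum_mul_sum, Finset.sum_comm (f := fun i j => η i • monP i.2 (X i.1) * _),
    ← Finset.sum_sub_distrib, map_sum]
  refine Finset.sum_congr rfl fun i _ => ?_
  rw [← Finset.sum_sub_distrib, map_sum]
  refine Finset.sum_congr rfl fun j _ => ?_
  rw [smul_mul_smul_comm, smul_mul_smul_comm, mul_comm (η j), ← smul_sub, map_smul,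
    ← liePoisson_eq N hN, smul_eq_mul]
  ring

theorem liePoisson_mulVec (N : ℕ) (hN : 1 ≤ N) (L η : PhaseSpace N) (i : Idx N) :
    (liePoisson N L).mulVec η i =
      (coeffMat (N - 1 - i.2) (alg N η * laxP N L - laxP N L * alg N η) * X i.1).trace := by
  have h := sum_liePoisson N hN L (Pi.single i 1) η
  have := i.2.2
  rw [alg_single, ← neg_sub, map_neg, ← trForm_commutator, ← LinearMap.neg_apply, ← map_neg,
    neg_sub, trForm_monP_right _ _ _ _ (by omega)] at h
  rw [← h, Finset.sum_eq_single i]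
  · simp [Matrix.mulVec, dotProduct]
  · intro b _ hb
    simp [Pi.single_eq_of_ne hb]
  · simp

/-- Hamiltonian vector fields in Lax form. Testing against the `X_a z^ℓ` gives the components, and
since commutators are traceless the dual basis reassembles the whole coefficient. All computations
of the rank rest on this. -/
theorem coeffMat_dirn_liePoisson_mulVec (N : ℕ) (hN : 1 ≤ N) (L η : PhaseSpace N) (n : ℕ)
    (hn : n < N) : coeffMat n (dirn N ((liePoisson N L).mulVec η)) =
      coeffMat n (alg N η * laxP N L - laxP N L * alg N η) := by
  rw [coeffMat_dirn N n _ hn]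
  obtain ⟨l, rfl⟩ : ∃ l : Fin N, n = N - 1 - l :=
    ⟨⟨N - 1 - n, by omega⟩, by simp only; omega⟩
  rw [coeffMat_polar]
  simp only [liePoisson_mulVec N hN]
  rw [sum_trace_mul_X_smul_XDual, trace_coeffMat_commutator]
  simp

theorem liePoisson_mulVec_eq_zero_iff (N : ℕ) (hN : 1 ≤ N) (L η : PhaseSpace N) :
    (liePoisson N L).mulVec η = 0 ↔
      ∀ n < N, coeffMat n (alg N η * laxP N L - laxP N L * alg N η) = 0 := by
  refine ⟨fun h n hn => ?_, fun h => eq_zero_of_coeffMat_polar N _ fun n hn => ?_⟩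
  · rw [← coeffMat_dirn_liePoisson_mulVec N hN L η n hn, h, map_zero, map_zero]
  · rw [← coeffMat_dirn N n _ hn, coeffMat_dirn_liePoisson_mulVec N hN L η n hn, h n hn]

theorem liePoisson_skew (N : ℕ) (hN : 1 ≤ N) (L : PhaseSpace N) (i j : Idx N) :
    liePoisson N L i j = -liePoisson N L j i := by
  rw [liePoisson_eq N hN, liePoisson_eq N hN, ← map_neg, neg_sub]

theorem liePoisson_affine (N : ℕ) (hN : 1 ≤ N) (i j : Idx N) :
    ∃ (c : ℂ) (f : PhaseSpace N →L[ℂ] ℂ), (∀ v, f v = trForm (N - 1) (dirn N v)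
      (monP i.2 (X i.1) * monP j.2 (X j.1) - monP j.2 (X j.1) * monP i.2 (X i.1))) ∧
      (fun L => liePoisson N L i j) = fun L => c + f L := by
  refine ⟨trForm (N - 1) (shiftP N) (monP i.2 (X i.1) * monP j.2 (X j.1) -
    monP j.2 (X j.1) * monP i.2 (X i.1)), LinearMap.toContinuousLinearMap
      (((trForm (N - 1)).flip (monP i.2 (X i.1) * monP j.2 (X j.1) -
        monP j.2 (X j.1) * monP i.2 (X i.1))) ∘ₗ dirn N), fun v => rfl, ?_⟩
  funext L
  rw [liePoisson_eq N hN, laxP, map_add, LinearMap.add_apply]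
  rfl

theorem partialDeriv_liePoisson (N : ℕ) (hN : 1 ≤ N) (i j l : Idx N) (L : PhaseSpace N) :
    partialDeriv l (fun y => liePoisson N y i j) L = trForm (N - 1) (dirn N (Pi.single l 1))
      (monP i.2 (X i.1) * monP j.2 (X j.1) - monP j.2 (X j.1) * monP i.2 (X i.1)) := by
  obtain ⟨c, f, hf, h⟩ := liePoisson_affine N hN i j
  rw [partialDeriv, h, fderiv_const_add, ContinuousLinearMap.fderiv, hf]

/-- The tensor is affine in the point, so this contraction evaluates its linear part on a
hamiltonian vector field, which is a commutator with `Q`; invariance then yields a double bracket.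
The Jacobi identity for the tensor thus reduces to the one for commutators. -/
theorem sum_liePoisson_mul_partialDeriv (N : ℕ) (hN : 1 ≤ N) (i j k : Idx N) (L : PhaseSpace N) :
    ∑ l, liePoisson N L i l * partialDeriv l (fun y => liePoisson N y j k) L =
      trForm (N - 1) (laxP N L) (monP i.2 (X i.1) *
        (monP j.2 (X j.1) * monP k.2 (X k.1) - monP k.2 (X k.1) * monP j.2 (X j.1)) -
        (monP j.2 (X j.1) * monP k.2 (X k.1) - monP k.2 (X k.1) * monP j.2 (X j.1)) *
          monP i.2 (X i.1)) := by
  have hv : ∑ l, liePoisson N L i l • (Pi.single l 1 : PhaseSpace N) =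
      -(liePoisson N L).mulVec (Pi.single i 1) := by
    funext m
    rw [Finset.sum_apply, Finset.sum_eq_single m]
    · simp [liePoisson_skew N hN L i m]
    · intro b _ hb
      simp [Pi.single_eq_of_ne hb.symm]
    · simp
  simp only [partialDeriv_liePoisson N hN]
  rw [← trForm_commutator]
  generalize monP j.2 (X j.1) * monP k.2 (X k.1) - monP k.2 (X k.1) * monP j.2 (X j.1) = F
  have h : ∀ l, liePoisson N L i l * trForm (N - 1) (dirn N (Pi.single l 1)) F =
      ((trForm (N - 1)).flip F ∘ₗ dirn N) (liePoisson N L i l • Pi.single l 1) := by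
    intro l
    rw [map_smul]
    rfl
  simp only [h]
  rw [← map_sum, hv, LinearMap.comp_apply, LinearMap.flip_apply]
  refine trForm_congr (fun m hm => ?_) fun _ _ => rfl
  rw [map_neg, map_neg, coeffMat_dirn_liePoisson_mulVec N hN L _ m (by omega), ← map_neg, neg_sub,
    alg_single]

theorem isPoissonTensor_liePoisson (N : ℕ) (hN : 1 ≤ N) : IsPoissonTensor (liePoisson N) where
  analytic i j := by
    obtain ⟨c, f, -, h⟩ := liePoisson_affine N hN i j
    rw [h]
    exact fun x _ => analyticAt_const.add (f.analyticAt x)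
  skew := liePoisson_skew N hN
  jacobi L i j k := by
    rw [Finset.sum_add_distrib, Finset.sum_add_distrib, sum_liePoisson_mul_partialDeriv N hN,
      sum_liePoisson_mul_partialDeriv N hN, sum_liePoisson_mul_partialDeriv N hN, ← map_add,
      ← map_add]
    convert map_zero (trForm (N - 1) (laxP N L)) using 2
    noncomm_ring

/-! ### Calculus of functions with values in polynomials or power series -/

section Calculus

variable {E : Type*} [NormedAddCommGroup E] [NormedSpace ℂ E]

/-- Coefficientwise differentiability of a polynomial-valued function, with derivative `f'`. -/
def HasCoeffDerivAt (f f' : E → ℂ[X]) (x : E) : Prop :=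
  ∀ n, ∃ L : E →L[ℂ] ℂ, (∀ v, L v = (f' v).coeff n) ∧ HasFDerivAt (fun y => (f y).coeff n) L x

theorem HasCoeffDerivAt.mul {f f' g g' : E → ℂ[X]} {x : E} (hf : HasCoeffDerivAt f f' x)
    (hg : HasCoeffDerivAt g g' x) :
    HasCoeffDerivAt (fun y => f y * g y) (fun v => f x * g' v + f' v * g x) x := by
  intro n
  choose Lf hf1 hf2 using hf
  choose Lg hg1 hg2 using hg
  refine ⟨∑ p ∈ antidiagonal n, ((f x).coeff p.1 • Lg p.2 + (g x).coeff p.2 • Lf p.1), ?_, ?_⟩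
  · intro v
    rw [Polynomial.coeff_add, Polynomial.coeff_mul, Polynomial.coeff_mul, ← Finset.sum_add_distrib,
      _root_.sum_apply]
    refine Finset.sum_congr rfl fun p _ => ?_
    simp [hf1, hg1, mul_comm]
  · simp only [Polynomial.coeff_mul]
    exact HasFDerivAt.fun_sum fun p _ => (hf2 p.1).mul (hg2 p.2)

theorem HasCoeffDerivAt.sum {ι : Type*} {s : Finset ι} {f f' : ι → E → ℂ[X]} {x : E}
    (hf : ∀ i, HasCoeffDerivAt (f i) (f' i) x) :
    HasCoeffDerivAt (fun y => ∑ i ∈ s, f i y) (fun v => ∑ i ∈ s, f' i v) x := by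
  intro n
  choose L h1 h2 using hf
  refine ⟨∑ i ∈ s, L i n, ?_, ?_⟩
  · intro v
    simp [h1, Polynomial.finsetSum_coeff]
  · simp only [Polynomial.finsetSum_coeff]
    exact HasFDerivAt.fun_sum fun i _ => h2 i n

/-- Entrywise and coefficientwise differentiability of a function with values in polynomial
matrices. -/
def HasMatDerivAt (F F' : E → PolyMat) (x : E) : Prop :=
  ∀ i j, HasCoeffDerivAt (fun y => F y i j) (fun v => F' v i j) x

theorem HasMatDerivAt.mul {F F' G G' : E → PolyMat} {x : E} (hF : HasMatDerivAt F F' x)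
    (hG : HasMatDerivAt G G' x) :
    HasMatDerivAt (fun y => F y * G y) (fun v => F x * G' v + F' v * G x) x := by
  intro i j
  simp only [Matrix.mul_apply, Matrix.add_apply, ← Finset.sum_add_distrib]
  exact HasCoeffDerivAt.sum fun k => (hF i k).mul (hG k j)

theorem HasMatDerivAt.trace {F F' : E → PolyMat} {x : E} (hF : HasMatDerivAt F F' x) :
    HasCoeffDerivAt (fun y => (F y).trace) (fun v => (F' v).trace) x :=
  HasCoeffDerivAt.sum fun i => hF i i

/-- Coefficientwise analyticity of a function with values in power series. -/
def CoeffAnalyticOn (f : E → PowerSeries ℂ) (s : Set E) : Prop :=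
  ∀ n, AnalyticOnNhd ℂ (fun y => PowerSeries.coeff n (f y)) s

theorem CoeffAnalyticOn.mul {f g : E → PowerSeries ℂ} {s : Set E} (hf : CoeffAnalyticOn f s)
    (hg : CoeffAnalyticOn g s) : CoeffAnalyticOn (fun y => f y * g y) s := by
  intro n x hx
  simp only [PowerSeries.coeff_mul]
  exact Finset.analyticAt_fun_sum _ fun p _ => (hf p.1 x hx).mul (hg p.2 x hx)

theorem CoeffAnalyticOn.sum {ι : Type*} {t : Finset ι} {f : ι → E → PowerSeries ℂ} {s : Set E}
    (hf : ∀ i, CoeffAnalyticOn (f i) s) : CoeffAnalyticOn (fun y => ∑ i ∈ t, f i y) s := by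
  intro n x hx
  simp only [map_sum]
  exact Finset.analyticAt_fun_sum _ fun i _ => hf i n x hx

theorem CoeffAnalyticOn.add {f g : E → PowerSeries ℂ} {s : Set E} (hf : CoeffAnalyticOn f s)
    (hg : CoeffAnalyticOn g s) : CoeffAnalyticOn (fun y => f y + g y) s := by
  intro n x hx
  simp only [map_add]
  exact (hf n x hx).add (hg n x hx)

/-- Entrywise and coefficientwise analyticity of a function with values in matrices of power
series. -/
def MatAnalyticOn (F : E → SeriesMat) (s : Set E) : Prop :=
  ∀ i j, CoeffAnalyticOn (fun y => F y i j) s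

theorem MatAnalyticOn.mul {F G : E → SeriesMat} {s : Set E} (hF : MatAnalyticOn F s)
    (hG : MatAnalyticOn G s) : MatAnalyticOn (fun y => F y * G y) s := by
  intro i j
  simp only [Matrix.mul_apply]
  exact CoeffAnalyticOn.sum fun k => (hF i k).mul (hG k j)

theorem MatAnalyticOn.trace {F : E → SeriesMat} {s : Set E} (hF : MatAnalyticOn F s) :
    CoeffAnalyticOn (fun y => (F y).trace) s :=
  CoeffAnalyticOn.sum fun i => hF i i

end Calculus

/-! ### Differentials of the trace invariants of the Lax matrix -/

/-- The coefficient functions of the entries of the Lax matrix are affine. -/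
theorem coeff_laxP_eq (N : ℕ) (i j : Fin 3) (n : ℕ) :
    ∃ L : PhaseSpace N →L[ℂ] ℂ, (∀ v, L v = (dirn N v i j).coeff n) ∧
      (fun y => (laxP N y i j).coeff n) = fun y => (shiftP N i j).coeff n + L y := by
  refine ⟨LinearMap.toContinuousLinearMap (Polynomial.lcoeff ℂ n ∘ₗ
    Matrix.entryLinearMap ℂ ℂ[X] i j ∘ₗ dirn N), fun v => rfl, ?_⟩
  funext y
  rw [laxP, Matrix.add_apply, Polynomial.coeff_add]
  rfl

theorem hasMatDerivAt_laxP (N : ℕ) (x : PhaseSpace N) :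
    HasMatDerivAt (laxP N) (dirn N) x := by
  intro i j n
  obtain ⟨L, h1, h2⟩ := coeff_laxP_eq N i j n
  refine ⟨L, h1, ?_⟩
  rw [h2]
  exact L.hasFDerivAt.const_add _

theorem matAnalyticOn_laxP (N : ℕ) (s : Set (PhaseSpace N)) :
    MatAnalyticOn (fun y => toSeries (laxP N y)) s := by
  intro i j n x _
  obtain ⟨L, h1, h2⟩ := coeff_laxP_eq N i j n
  simp only [toSeries_apply, Polynomial.coeff_coe]
  rw [h2]
  exact analyticAt_const.add (L.analyticAt x)

/-- The coefficient of `z ^ n` in `(1/2) tr (z^N L_N(z))²`. -/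
def quadInv (N n : ℕ) (x : PhaseSpace N) : ℂ := (1 / 2) * ((laxP N x) ^ 2).trace.coeff n

/-- The coefficient of `z ^ n` in `(1/3) tr (z^N L_N(z))³`. -/
def cubInv (N n : ℕ) (x : PhaseSpace N) : ℂ := (1 / 3) * ((laxP N x) ^ 3).trace.coeff n

theorem trace_toSeries (F : PolyMat) :
    (toSeries F).trace = ((F.trace : ℂ[X]) : PowerSeries ℂ) :=
  (map_sum Polynomial.coeToPowerSeries.ringHom _ _).symm

theorem analyticOnNhd_quadInv (N n : ℕ) : AnalyticOnNhd ℂ (quadInv N n) Set.univ := by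
  have h := ((matAnalyticOn_laxP N Set.univ).mul (matAnalyticOn_laxP N Set.univ)).trace n
  intro x hx
  refine ((analyticAt_const (v := (1 / 2 : ℂ))).mul (h x hx)).congr (Filter.Eventually.of_forall fun y => ?_)
  simp only [Pi.mul_apply]
  rw [quadInv, ← map_mul, trace_toSeries, Polynomial.coeff_coe, pow_two]

theorem analyticOnNhd_cubInv (N n : ℕ) : AnalyticOnNhd ℂ (cubInv N n) Set.univ := by
  have h := (((matAnalyticOn_laxP N Set.univ).mul (matAnalyticOn_laxP N Set.univ)).mul
    (matAnalyticOn_laxP N Set.univ)).trace n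
  intro x hx
  refine ((analyticAt_const (v := (1 / 3 : ℂ))).mul (h x hx)).congr (Filter.Eventually.of_forall fun y => ?_)
  simp only [Pi.mul_apply]
  rw [cubInv, ← map_mul, ← map_mul, trace_toSeries, Polynomial.coeff_coe, pow_succ, pow_two]

theorem fderiv_quadInv (N n : ℕ) (x v : PhaseSpace N) :
    fderiv ℂ (quadInv N n) x v = trForm n (laxP N x) (dirn N v) := by
  obtain ⟨L, h1, h2⟩ := ((hasMatDerivAt_laxP N x).mul (hasMatDerivAt_laxP N x)).trace n
  have h3 : HasFDerivAt (quadInv N n) ((1 / 2 : ℂ) • L) x := by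
    have := h2.const_mul (1 / 2 : ℂ)
    simp only [← pow_two] at this
    exact this
  rw [h3.fderiv, _root_.smul_apply, h1]
  simp only
  rw [Matrix.trace_add,
    Matrix.trace_mul_comm (dirn N v), Polynomial.coeff_add, ← trForm_apply, smul_eq_mul]
  ring

/-- The three terms of the product rule agree by cyclicity of the trace, which cancels the factor
`1/3`. -/
theorem fderiv_cubInv (N n : ℕ) (x v : PhaseSpace N) :
    fderiv ℂ (cubInv N n) x v = trForm n (laxP N x ^ 2) (dirn N v) := by
  obtain ⟨L, h1, h2⟩ := (((hasMatDerivAt_laxP N x).mul (hasMatDerivAt_laxP N x)).mul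
    (hasMatDerivAt_laxP N x)).trace n
  have h3 : HasFDerivAt (cubInv N n) ((1 / 3 : ℂ) • L) x := by
    have := h2.const_mul (1 / 3 : ℂ)
    simp only [← pow_two, ← pow_succ] at this
    exact this
  rw [h3.fderiv, _root_.smul_apply, h1]
  simp only
  rw [add_mul, Matrix.trace_add, Matrix.trace_add,
    mul_assoc (dirn N v), Matrix.trace_mul_comm (dirn N v), mul_assoc (laxP N x) (dirn N v),
    Matrix.trace_mul_comm (laxP N x), mul_assoc (dirn N v), Matrix.trace_mul_comm (dirn N v),
    Polynomial.coeff_add, Polynomial.coeff_add, ← pow_two, ← trForm_apply, smul_eq_mul]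
  ring

theorem hamiltonian_inl (N : ℕ) (k : Fin N) :
    hamiltonian N (Sum.inl k) = quadInv N (2 * N - (k + 1)) := by
  funext L
  have := k.2
  exact hQuad_eq N (k + 1) (by omega) L

theorem hamiltonian_inr (N : ℕ) (k : Fin (2 * N)) :
    hamiltonian N (Sum.inr k) = cubInv N (3 * N - (k + 1)) := by
  funext L
  have := k.2
  exact hCub_eq N (k + 1) (by omega) L

theorem analyticOnNhd_hamiltonian (N : ℕ) (k : Fin N ⊕ Fin (2 * N)) :
    AnalyticOnNhd ℂ (hamiltonian N k) Set.univ := by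
  cases k with
  | inl k => rw [hamiltonian_inl]; exact analyticOnNhd_quadInv _ _
  | inr k => rw [hamiltonian_inr]; exact analyticOnNhd_cubInv _ _

/-! ### The complementary subalgebra and the involution theorem -/

theorem coeffMat_mul_top {a b k : ℕ} {A B : PolyMat} (hA : ∀ m, a < m → coeffMat m A = 0)
    (hB : ∀ m, b < m → coeffMat m B = 0) (hka : k ≤ a) (hkb : k ≤ b) :
    coeffMat (a + b - k) (A * B) =
      ∑ p ∈ antidiagonal k, coeffMat (a - p.1) A * coeffMat (b - p.2) B := by
  rw [coeffMat_mul]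
  symm
  refine Finset.sum_of_injOn (fun p => (a - p.1, b - p.2)) ?_ ?_ ?_ fun _ _ => rfl
  · rintro ⟨p, q⟩ hp ⟨p', q'⟩ hp' h
    simp only [Finset.mem_coe, mem_antidiagonal, Prod.mk.injEq] at *
    omega
  · rintro ⟨p, q⟩ hp
    simp only [Finset.mem_coe, mem_antidiagonal] at *
    omega
  · rintro ⟨p, q⟩ hp hn
    simp only [mem_antidiagonal] at hp
    rcases lt_or_ge a p with h | h
    · simp [hA p h]
    rcases lt_or_ge b q with h' | h'
    · simp [hB q h']
    exfalso
    refine hn ⟨(a - p, b - q), ?_, ?_⟩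
    · simp only [Finset.mem_coe, mem_antidiagonal]
      omega
    · simp only [Prod.mk.injEq]
      omega

theorem coeffMat_mul_eq_zero {a b m : ℕ} {A B : PolyMat} (hA : ∀ m, a < m → coeffMat m A = 0)
    (hB : ∀ m, b < m → coeffMat m B = 0) (h : a + b < m) : coeffMat m (A * B) = 0 := by
  rw [coeffMat_mul]
  refine Finset.sum_eq_zero ?_
  rintro ⟨p, q⟩ hp
  simp only [mem_antidiagonal] at hp
  rcases lt_or_ge a p with h' | h'
  · simp [hA p h']
  · simp [hB q (by omega)]

theorem antidiagonal_two_sum {M : Type*} [AddCommMonoid M] (f : ℕ × ℕ → M) :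
    ∑ p ∈ antidiagonal 2, f p = f (0, 2) + f (1, 1) + f (2, 0) := by
  simp [Finset.Nat.antidiagonal_succ, add_assoc]

theorem antidiagonal_one_sum {M : Type*} [AddCommMonoid M] (f : ℕ × ℕ → M) :
    ∑ p ∈ antidiagonal 1, f p = f (0, 1) + f (1, 0) := by
  simp [Finset.Nat.antidiagonal_succ]

/-- The second coefficient below the top of a triple product. -/
theorem trForm_mul_top {a b c : ℕ} {A B C : PolyMat} (hA : ∀ m, a < m → coeffMat m A = 0)
    (hB : ∀ m, b < m → coeffMat m B = 0) (hC : ∀ m, c < m → coeffMat m C = 0)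
    (ha : 2 ≤ a) (hb : 2 ≤ b) (hc : 2 ≤ c) :
    trForm (a + (b + c) - 2) A (B * C) =
      (coeffMat a A * (coeffMat b B * coeffMat (c - 2) C + coeffMat (b - 1) B * coeffMat (c - 1) C +
        coeffMat (b - 2) B * coeffMat c C) +
      coeffMat (a - 1) A * (coeffMat b B * coeffMat (c - 1) C + coeffMat (b - 1) B * coeffMat c C) +
      coeffMat (a - 2) A * (coeffMat b B * coeffMat c C)).trace := by
  rw [trForm_apply, coeff_trace,
    coeffMat_mul_top hA (fun m hm => coeffMat_mul_eq_zero hB hC hm) ha (by omega),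
    antidiagonal_two_sum]
  simp only [Nat.sub_zero]
  have h0 := coeffMat_mul_top hB hC (k := 0) (by omega) (by omega)
  rw [coeffMat_mul_top hB hC hb hc, antidiagonal_two_sum,
    coeffMat_mul_top hB hC (k := 1) (by omega) (by omega), antidiagonal_one_sum]
  simp only [Nat.sub_zero, Finset.HasAntidiagonal.antidiagonal_zero, Finset.sum_singleton] at h0 ⊢
  rw [h0]

/-- The constant term of an element of the complementary subalgebra, in terms of its residue. -/
def kappa (M : Matrix (Fin 3) (Fin 3) ℂ) : Matrix (Fin 3) (Fin 3) ℂ :=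
  !![0, 0, 0; M 0 2, 0, 0; 2 * M 1 2 - M 0 1, M 0 2, 0]

theorem correction_values : correction 0 = 0 ∧ correction 1 = 0 ∧
    correction 2 = !![0, 0, 0; 0, 0, 0; -1, 0, 0] ∧ correction 3 = !![0, 0, 0; 0, 0, 0; -1, 0, 0] ∧
    correction 4 = !![0, 0, 0; 1, 0, 0; 0, -2, 0] ∧ correction 5 = 0 ∧ correction 6 = 0 ∧
    correction 7 = 0 := by
  rw [correction_eq]
  exact ⟨rfl, rfl, rfl, rfl, rfl, rfl, rfl, rfl⟩

theorem XDual_values : XDual 0 = !![1, 0, 0; 0, -1, 0; 0, 0, 0] ∧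
    XDual 1 = !![0, 0, 0; 0, 1, 0; 0, 0, -1] ∧ XDual 2 = !![0, 1, 0; 0, 0, 0; 0, 0, 0] ∧
    XDual 3 = !![0, 0, 0; 0, 0, 1; 0, 0, 0] ∧ XDual 4 = !![0, 0, 1; 0, 0, 0; 0, 0, 0] ∧
    XDual 5 = !![0, 0, 0; 1, 0, 0; 0, 0, 0] ∧ XDual 6 = !![0, 0, 0; 0, 0, 0; 0, 1, 0] ∧
    XDual 7 = !![0, 0, 0; 0, 0, 0; 1, 0, 0] := by
  rw [XDual_eq]
  exact ⟨rfl, rfl, rfl, rfl, rfl, rfl, rfl, rfl⟩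

/-- This determines `kappa`: it says that `z^{-1} M + kappa M` has zero residue pairing with the
dual basis elements at `ℓ = 0`. -/
theorem trace_kappa_mul_XDual (M : Matrix (Fin 3) (Fin 3) ℂ) (a : Fin 8) :
    (kappa M * XDual a).trace = -(M * correction a).trace := by
  obtain ⟨c0, c1, c2, c3, c4, c5, c6, c7⟩ := correction_values
  obtain ⟨x0, x1, x2, x3, x4, x5, x6, x7⟩ := XDual_values
  have h : ∀ A B : Matrix (Fin 3) (Fin 3) ℂ, (kappa M * A).trace = -(M * B).trace ↔
      M 0 2 * A 0 1 + (2 * M 1 2 - M 0 1) * A 0 2 + M 0 2 * A 1 2 =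
      -(M 0 0 * B 0 0 + M 0 1 * B 1 0 + M 0 2 * B 2 0
      + (M 1 0 * B 0 1 + M 1 1 * B 1 1 + M 1 2 * B 2 1)
      + (M 2 0 * B 0 2 + M 2 1 * B 1 2 + M 2 2 * B 2 2)) := by
    intro A B
    rw [trace_mul_fin_three, trace_mul_fin_three, kappa]
    simp
    constructor <;> intro h <;> linear_combination h
  fin_cases a
  · exact (h (XDual 0) (correction 0)).2 (by rw [x0, c0]; simp)
  · exact (h (XDual 1) (correction 1)).2 (by rw [x1, c1]; simp)
  · exact (h (XDual 2) (correction 2)).2 (by rw [x2, c2]; simp)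
  · exact (h (XDual 3) (correction 3)).2 (by rw [x3, c3]; simp)
  · exact (h (XDual 4) (correction 4)).2 (by rw [x4, c4]; simp; ring)
  · exact (h (XDual 5) (correction 5)).2 (by rw [x5, c5]; simp)
  · exact (h (XDual 6) (correction 6)).2 (by rw [x6, c6]; simp)
  · exact (h (XDual 7) (correction 7)).2 (by rw [x7, c7]; simp)

/-- `z^{-2N} F` belongs to the subalgebra complementary to the power series. -/
structure IsNeg (N : ℕ) (F : PolyMat) : Prop where
  coeff_eq_zero : ∀ m, 2 * N < m → coeffMat m F = 0
  coeff_top : coeffMat (2 * N) F = kappa (coeffMat (2 * N - 1) F)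

theorem coeffMat_laxP_of_lt (N m : ℕ) (L : PhaseSpace N) (h : N + 1 < m) :
    coeffMat m (laxP N L) = 0 := by
  rw [laxP, dirn_eq, shiftP, map_add, map_add, map_add, map_add, coeffMat_polar_of_le _ _ _
    (by omega), coeffMat_monP, coeffMat_monP, coeffMat_monP, coeffMat_monP, if_neg (by omega),
    if_neg (by omega), if_neg (by omega), if_neg (by omega)]
  simp

theorem coeffMat_laxP_succ (N : ℕ) (L : PhaseSpace N) : coeffMat (N + 1) (laxP N L) = E 2 0 := by
  rw [laxP, dirn_eq, shiftP, map_add, map_add, map_add, map_add, coeffMat_polar_of_le _ _ _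
    (by omega), coeffMat_monP, coeffMat_monP, coeffMat_monP, coeffMat_monP, if_pos rfl,
    if_neg (by omega), if_neg (by omega), if_neg (by omega)]
  simp

theorem coeffMat_laxP_self (N : ℕ) (hN : 1 ≤ N) (L : PhaseSpace N) :
    coeffMat N (laxP N L) = E 0 1 + E 1 2 + (coeffMat (N - 1) (laxP N L) 0 2 •
      !![0, 0, 0; 1, 0, 0; 0, -2, 0] - (coeffMat (N - 1) (laxP N L) 0 1 +
        coeffMat (N - 1) (laxP N L) 1 2) • !![0, 0, 0; 0, 0, 0; 1, 0, 0]) := by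
  have h1 := coeffMat_laxP_sub N L ⟨0, hN⟩
  simp only [Nat.sub_zero] at h1
  rw [h1, laxP, dirn_eq, shiftP, map_add, map_add, map_add, map_add, coeffMat_polar_of_le _ _ _
    le_rfl, coeffMat_monP, coeffMat_monP, coeffMat_monP, coeffMat_monP, if_pos rfl,
    if_neg (by omega), if_pos rfl, if_pos rfl, zero_add, zero_add, Fintype.sum_prod_type]
  congr 1
  have h2 : ∀ a : Fin 8, (∑ l : Fin N, if (l : ℕ) = 0 then L (a, l) • correction a else 0) =
      L (a, ⟨0, hN⟩) • correction a := by
    intro a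
    rw [Finset.sum_eq_single ⟨0, hN⟩]
    · simp
    · intro b _ hb
      rw [if_neg fun h => hb (Fin.ext h)]
    · simp
  simp only [h2]
  obtain ⟨c0, c1, c2, c3, c4, c5, c6, c7⟩ := correction_values
  obtain ⟨x0, x1, x2, x3, x4, x5, x6, x7⟩ := XDual_values
  rw [Fin.sum_univ_eight, Fin.sum_univ_eight, c0, c1, c2, c3, c4, c5, c6, c7, x0, x1, x2, x3, x4,
    x5, x6, x7]
  ext i j
  fin_cases i <;> fin_cases j <;> simp
  ring

theorem kappa_mul_kappa_comm (f g : Matrix (Fin 3) (Fin 3) ℂ) :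
    kappa f * kappa g = kappa g * kappa f := by
  rw [kappa, kappa]
  ext i j
  fin_cases i <;> fin_cases j <;> simp [Matrix.mul_apply, Fin.sum_univ_three, mul_comm]

/-- The first factor is the coefficient of `z^N` in the Lax matrix when `q` is that of `z^{N-1}`. -/
theorem trace_character (q M : Matrix (Fin 3) (Fin 3) ℂ) :
    ((E 0 1 + E 1 2 + (q 0 2 • !![0, 0, 0; 1, 0, 0; 0, -2, 0] -
      (q 0 1 + q 1 2) • !![0, 0, 0; 0, 0, 0; 1, 0, 0])) * M).trace =
    M 1 0 + M 2 1 + q 0 2 * (M 0 1 - 2 * M 1 2) - (q 0 1 + q 1 2) * M 0 2 := by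
  rw [E_zero_one, E_one_two, trace_mul_fin_three]
  simp
  ring

theorem kappa_mul_apply (f g : Matrix (Fin 3) (Fin 3) ℂ) (j : Fin 3) :
    (kappa f * g) 0 j = 0 ∧ (kappa f * g) 1 j = f 0 2 * g 0 j ∧
      (kappa f * g) 2 j = (2 * f 1 2 - f 0 1) * g 0 j + f 0 2 * g 1 j := by
  simp [kappa, Matrix.mul_apply, Fin.sum_univ_three]

theorem mul_kappa_apply (f g : Matrix (Fin 3) (Fin 3) ℂ) (j : Fin 3) :
    (g * kappa f) j 0 = g j 1 * f 0 2 + g j 2 * (2 * f 1 2 - f 0 1) ∧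
      (g * kappa f) j 1 = g j 2 * f 0 2 ∧ (g * kappa f) j 2 = 0 := by
  simp [kappa, Matrix.mul_apply, Fin.sum_univ_three]

/-- The complementary subalgebra annihilates the Lax matrix: the shift element is a character. -/
theorem trForm_commutator_eq_zero (N : ℕ) (hN : 1 ≤ N) (L : PhaseSpace N) {F G : PolyMat}
    (hF : IsNeg N F) (hG : IsNeg N G) :
    trForm (5 * N - 1) (laxP N L) (F * G - G * F) = 0 := by
  -- The residue sits two places below the top degree `(N + 1) + 2N + 2N`, so only the three highest
  -- coefficients of each factor contribute.
  have hn : 5 * N - 1 = N + 1 + (2 * N + 2 * N) - 2 := by omega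
  rw [map_sub, hn,
    trForm_mul_top (coeffMat_laxP_of_lt N · L) hF.coeff_eq_zero hG.coeff_eq_zero (by omega)
      (by omega) (by omega),
    trForm_mul_top (coeffMat_laxP_of_lt N · L) hG.coeff_eq_zero hF.coeff_eq_zero (by omega)
      (by omega) (by omega), coeffMat_laxP_succ, Nat.add_sub_cancel,
    show N + 1 - 2 = N - 1 by omega, coeffMat_laxP_self N hN, hF.coeff_top, hG.coeff_top,
    Matrix.trace_add, Matrix.trace_add, Matrix.trace_add, Matrix.trace_add, trace_character,
    trace_character, kappa_mul_kappa_comm]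
  have hE : ∀ M : Matrix (Fin 3) (Fin 3) ℂ, (E 2 0 * M).trace = M 0 2 := by
    intro M
    rw [E_two_zero, trace_mul_fin_three]
    simp
  simp only [hE, Matrix.add_apply, kappa_mul_apply, mul_kappa_apply]
  simp only [Matrix.mul_apply, Fin.sum_univ_three]
  ring

/-! ### Gradients of the trace invariants -/

/-- The projection of `F` to the complementary subalgebra. -/
def negPart (N : ℕ) (F : PolyMat) : PolyMat :=
  ∑ m ∈ Finset.range (2 * N), monP m (coeffMat m F) + monP (2 * N) (kappa (coeffMat (2 * N - 1) F))

theorem coeffMat_negPart (N m : ℕ) (F : PolyMat) (h : m < 2 * N) :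
    coeffMat m (negPart N F) = coeffMat m F := by
  rw [negPart, map_add, coeffMat_monP, if_neg (by omega), add_zero, map_sum,
    Finset.sum_eq_single m]
  · rw [coeffMat_monP, if_pos rfl]
  · intro b _ hb
    rw [coeffMat_monP, if_neg hb]
  · intro h'
    exact absurd (Finset.mem_range.2 h) h'

theorem coeffMat_negPart_top (N : ℕ) (F : PolyMat) :
    coeffMat (2 * N) (negPart N F) = kappa (coeffMat (2 * N - 1) F) := by
  rw [negPart, map_add, coeffMat_monP, if_pos rfl, map_sum, Finset.sum_eq_zero, zero_add]
  intro b hb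
  rw [Finset.mem_range] at hb
  rw [coeffMat_monP, if_neg (by omega)]

theorem coeffMat_negPart_of_lt (N m : ℕ) (F : PolyMat) (h : 2 * N < m) :
    coeffMat m (negPart N F) = 0 := by
  rw [negPart, map_add, coeffMat_monP, if_neg (by omega), map_sum, Finset.sum_eq_zero, zero_add]
  intro b hb
  rw [Finset.mem_range] at hb
  rw [coeffMat_monP, if_neg (by omega)]

theorem isNeg_negPart (N : ℕ) (hN : 1 ≤ N) (F : PolyMat) : IsNeg N (negPart N F) where
  coeff_eq_zero m hm := coeffMat_negPart_of_lt N m F hm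
  coeff_top := by rw [coeffMat_negPart_top, coeffMat_negPart N _ F (by omega)]

theorem coeffMat_X_pow_smul (k m : ℕ) (F : PolyMat) :
    coeffMat (m + k) ((Polynomial.X : ℂ[X]) ^ k • F) = coeffMat m F := by
  ext i j
  rw [coeffMat_apply, coeffMat_apply, Matrix.smul_apply, smul_eq_mul, Polynomial.coeff_X_pow_mul]

theorem coeffMat_X_pow_smul_of_lt (k m : ℕ) (F : PolyMat) (h : m < k) :
    coeffMat m ((Polynomial.X : ℂ[X]) ^ k • F) = 0 := by
  ext i j
  rw [coeffMat_apply, Matrix.smul_apply, smul_eq_mul, Polynomial.coeff_X_pow_mul',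
    if_neg (by omega), Matrix.zero_apply]

theorem exists_eq_X_pow_smul (k : ℕ) (F : PolyMat) (h : ∀ m < k, coeffMat m F = 0) :
    ∃ G : PolyMat, F = (Polynomial.X : ℂ[X]) ^ k • G := by
  have h1 : ∀ i j, (Polynomial.X : ℂ[X]) ^ k ∣ F i j := fun i j =>
    Polynomial.X_pow_dvd_iff.2 fun d hd => congrFun (congrFun (h d hd) i) j
  choose G hG using h1
  exact ⟨Matrix.of G, by ext1 i j; exact hG i j⟩

theorem trForm_X_pow_smul (k n : ℕ) (F G : PolyMat) :
    trForm (n + k) ((Polynomial.X : ℂ[X]) ^ k • F) G = trForm n F G := by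
  rw [trForm_apply, trForm_apply, Matrix.smul_mul, Matrix.trace_smul, smul_eq_mul,
    Polynomial.coeff_X_pow_mul]

/-- The coordinates of the regular part of `z^{-2N} F`. -/
def grad (N : ℕ) (F : PolyMat) : PhaseSpace N := fun i =>
  (coeffMat (i.2 + 2 * N) (F - negPart N F) * XDual i.1).trace

theorem trForm_dirn (N : ℕ) (F : PolyMat) (v : PhaseSpace N) :
    trForm (3 * N - 1) F (dirn N v) = ∑ i, v i * grad N F i := by
  rw [dirn, Fintype.linearCombination_apply, map_sum]
  refine Finset.sum_congr rfl fun i _ => ?_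
  have h2 := i.2.2
  rw [map_smul, smul_eq_mul, map_add, grad, trForm_monP_right _ _ _ _ (by omega),
    show 3 * N - 1 - (N - 1 - (i.2 : ℕ)) = i.2 + 2 * N by omega, map_sub, Matrix.sub_mul,
    Matrix.trace_sub]
  congr 1
  -- For `ℓ = 0` the correction pairs with the residue of `z^{-2N} F`, which is exactly the term
  -- subtracted through `kappa`; for `ℓ > 0` there is neither correction nor complementary part.
  split_ifs with h
  · rw [h, trForm_monP_right _ _ _ _ (by omega), zero_add, coeffMat_negPart_top,
      trace_kappa_mul_XDual, show 3 * N - 1 - N = 2 * N - 1 by omega]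
    ring
  · rw [map_zero, coeffMat_negPart_of_lt _ _ _ (by omega)]
    simp

theorem trForm_dirn_single (N : ℕ) (F : PolyMat) (i : Idx N) :
    trForm (3 * N - 1) F (dirn N (Pi.single i 1)) = grad N F i := by
  rw [trForm_dirn, Finset.sum_eq_single i]
  · simp
  · intro b _ hb
    simp [Pi.single_eq_of_ne hb]
  · simp

/-- The element of the loop algebra with coordinates `grad N F` is the regular part of `z^{-2N} F`,
up to scalar matrices and higher powers of `z`. -/
theorem coeffMat_alg_grad (N m : ℕ) (hm : m < N) (F Z : PolyMat)
    (h : F - negPart N F = (Polynomial.X : ℂ[X]) ^ (2 * N) • Z) :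
    coeffMat m (alg N (grad N F)) = coeffMat m (Z - (Polynomial.C (1 / 3) * Z.trace) • 1) := by
  obtain ⟨l, rfl⟩ : ∃ l : Fin N, m = l := ⟨⟨m, hm⟩, rfl⟩
  rw [coeffMat_alg]
  simp only [grad]
  rw [sum_trace_mul_XDual_smul_X, h, coeffMat_X_pow_smul, map_sub, ← coeff_trace]
  congr 1
  ext i j
  rw [coeffMat_apply, Matrix.smul_apply, Matrix.smul_apply, Matrix.one_apply, Matrix.one_apply]
  split_ifs
  · simp
    ring
  · simp

theorem exists_sub_negPart_eq (N : ℕ) (F : PolyMat) :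
    ∃ Z : PolyMat, F - negPart N F = (Polynomial.X : ℂ[X]) ^ (2 * N) • Z :=
  exists_eq_X_pow_smul _ _ fun m hm => by rw [map_sub, coeffMat_negPart N m F hm, sub_self]

theorem sub_smul_one_commutator (A B : PolyMat) (s t : ℂ[X]) :
    (A - s • 1) * (B - t • 1) - (B - t • 1) * (A - s • 1) = A * B - B * A := by
  have h : ∀ (r : ℂ[X]) (M : PolyMat), (r • 1) * M = M * (r • 1) := by simp
  generalize hS : s • (1 : PolyMat) = S
  generalize hT : t • (1 : PolyMat) = T
  simp only [sub_mul, mul_sub]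
  rw [← hS, h s B, h s T, hS, ← hT, h t A]
  abel

/-- Gradients of functions whose gradients commute with the Lax matrix are in involution. -/
theorem sum_liePoisson_grad (N : ℕ) (hN : 1 ≤ N) (L : PhaseSpace N) (F G : PolyMat)
    (hF : laxP N L * F = F * laxP N L) (hG : laxP N L * G = G * laxP N L) :
    ∑ i, ∑ j, liePoisson N L i j * grad N F i * grad N G j = 0 := by
  obtain ⟨Y, hY⟩ := exists_sub_negPart_eq N F
  obtain ⟨Z, hZ⟩ := exists_sub_negPart_eq N G
  -- Scalars drop out of commutators and only degrees below `N` enter, so the gradients may be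
  -- replaced by the full quotients `Y` and `Z`.
  have h1 : trForm (N - 1) (laxP N L) (alg N (grad N F) * alg N (grad N G) -
      alg N (grad N G) * alg N (grad N F)) = trForm (N - 1) (laxP N L) (Y * Z - Z * Y) := by
    rw [← sub_smul_one_commutator Y Z (Polynomial.C (1 / 3) * Y.trace)
      (Polynomial.C (1 / 3) * Z.trace)]
    refine trForm_congr (fun _ _ => rfl) fun m hm => ?_
    rw [map_sub, map_sub]
    have hF' : ∀ k ≤ m, _ := fun k hk => coeffMat_alg_grad N k (by omega) F Y hY
    have hG' : ∀ k ≤ m, _ := fun k hk => coeffMat_alg_grad N k (by omega) G Z hZ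
    rw [coeffMat_mul_congr hF' hG', coeffMat_mul_congr hG' hF']
  have h2 : (F - negPart N F) * (G - negPart N G) - (G - negPart N G) * (F - negPart N F) =
      (Polynomial.X : ℂ[X]) ^ (4 * N) • (Y * Z - Z * Y) := by
    rw [hY, hZ, smul_mul_smul_comm, smul_mul_smul_comm, ← pow_add, ← smul_sub]
    congr 2
    omega
  have h3 : trForm (5 * N - 1) (laxP N L) ((F - negPart N F) * (G - negPart N G) -
      (G - negPart N G) * (F - negPart N F)) = trForm (N - 1) (laxP N L) (Y * Z - Z * Y) := by
    rw [h2, trForm_comm, show 5 * N - 1 = N - 1 + 4 * N by omega, trForm_X_pow_smul, trForm_comm]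
  have h4 : ∀ A : PolyMat, trForm (5 * N - 1) (laxP N L) (F * A - A * F) = 0 := fun A => by
    rw [← trForm_commutator, hF, sub_self, map_zero, LinearMap.zero_apply]
  have h5 : ∀ A : PolyMat, trForm (5 * N - 1) (laxP N L) (G * A - A * G) = 0 := fun A => by
    rw [← trForm_commutator, hG, sub_self, map_zero, LinearMap.zero_apply]
  have h6 := trForm_commutator_eq_zero N hN L (isNeg_negPart N hN F) (isNeg_negPart N hN G)
  rw [sum_liePoisson N hN, h1, ← h3]
  -- The first two commutators pair to zero with `Q` by invariance, since `F` and `G` commute with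
  -- it; the third lies in the commutators of the complementary subalgebra.
  have h7 : (F - negPart N F) * (G - negPart N G) - (G - negPart N G) * (F - negPart N F) =
      (F * (G - negPart N G) - (G - negPart N G) * F) + (G * negPart N F - negPart N F * G) +
        (negPart N F * negPart N G - negPart N G * negPart N F) := by
    noncomm_ring
  rw [h7, map_add, map_add, h4, h5, h6]
  simp

/-- The polynomial matrix whose regular part is the gradient of a hamiltonian. -/
def hamMat (N : ℕ) (L : PhaseSpace N) : Fin N ⊕ Fin (2 * N) → PolyMat :=
  Sum.elim (fun k => (Polynomial.X : ℂ[X]) ^ (N + k : ℕ) • laxP N L)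
    (fun k => (Polynomial.X : ℂ[X]) ^ (k : ℕ) • laxP N L ^ 2)

/-- The powers of `z` in `hamMat` move all the coefficients in question to the common position `3N -
1`, so that one notion of gradient serves both families. -/
theorem fderiv_hamiltonian (N : ℕ) (k : Fin N ⊕ Fin (2 * N)) (L v : PhaseSpace N) :
    fderiv ℂ (hamiltonian N k) L v = trForm (3 * N - 1) (hamMat N L k) (dirn N v) := by
  cases k with
  | inl k =>
    have := k.2
    rw [hamiltonian_inl, fderiv_quadInv, hamMat, Sum.elim_inl,
      show 3 * N - 1 = 2 * N - (k + 1) + (N + k) by omega, trForm_X_pow_smul]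
  | inr k =>
    have := k.2
    rw [hamiltonian_inr, fderiv_cubInv, hamMat, Sum.elim_inr,
      show 3 * N - 1 = 3 * N - (k + 1) + k by omega, trForm_X_pow_smul]

theorem laxP_mul_hamMat (N : ℕ) (L : PhaseSpace N) (k : Fin N ⊕ Fin (2 * N)) :
    laxP N L * hamMat N L k = hamMat N L k * laxP N L := by
  cases k with
  | inl k => simp [hamMat]
  | inr k => simp [hamMat, pow_two, mul_assoc]

theorem bracket_hamiltonian (N : ℕ) (hN : 1 ≤ N) (j k : Fin N ⊕ Fin (2 * N)) (L : PhaseSpace N) :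
    bracket (liePoisson N) (hamiltonian N j) (hamiltonian N k) L = 0 := by
  simp only [bracket, partialDeriv, fderiv_hamiltonian, trForm_dirn_single]
  exact sum_liePoisson_grad N hN L _ _ (laxP_mul_hamMat N L j) (laxP_mul_hamMat N L k)

/-! ### Cyclic vectors -/

section Krylov

variable {R : Type*} [CommRing R]

/-- The matrix with columns `v, Q v, Q² v`. -/
def krylov (Q : Matrix (Fin 3) (Fin 3) R) (v : Fin 3 → R) : Matrix (Fin 3) (Fin 3) R :=
  Matrix.of fun i j => ((Q ^ (j : ℕ)).mulVec v) i

theorem krylov_col (Q : Matrix (Fin 3) (Fin 3) R) (v : Fin 3 → R) (j : Fin 3) :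
    (krylov Q v).col j = (Q ^ (j : ℕ)).mulVec v := rfl

theorem krylov_mulVec (Q : Matrix (Fin 3) (Fin 3) R) (v c : Fin 3 → R) :
    (krylov Q v).mulVec c = (c 0 • 1 + c 1 • Q + c 2 • Q ^ 2).mulVec v := by
  funext i
  rw [Matrix.mulVec, dotProduct, Fin.sum_univ_three]
  simp only [krylov, Matrix.of_apply, Matrix.add_mulVec, Matrix.smul_mulVec, Pi.add_apply,
    Pi.smul_apply, smul_eq_mul]
  simp
  ring

theorem mul_krylov_of_commute {Y Q : Matrix (Fin 3) (Fin 3) R} (h : Y * Q = Q * Y)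
    (v : Fin 3 → R) : Y * krylov Q v = krylov Q (Y.mulVec v) := by
  refine Matrix.ext_col fun j => ?_
  have h2 : Y * Q ^ (j : ℕ) = Q ^ (j : ℕ) * Y := (Commute.pow_right (show Commute Y Q from h) _).eq
  rw [krylov_col, Matrix.mulVec_mulVec, ← h2, ← Matrix.mulVec_mulVec, ← krylov_col]
  rfl

theorem map_krylov {S : Type*} [CommRing S] (f : R →+* S) (Q : Matrix (Fin 3) (Fin 3) R)
    (v : Fin 3 → R) : f.mapMatrix (krylov Q v) = krylov (f.mapMatrix Q) (f ∘ v) := by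
  ext i j
  have h := RingHom.map_mulVec f (Q ^ (j : ℕ)) v i
  rw [show (Q ^ (j : ℕ)).map f = (f.mapMatrix Q) ^ (j : ℕ) from map_pow f.mapMatrix Q j] at h
  exact h

theorem eq_zero_of_mulVec_krylov {Y Q : Matrix (Fin 3) (Fin 3) R} (h : Y * Q = Q * Y)
    {v : Fin 3 → R} (hv : IsUnit (krylov Q v).det) (h0 : Y.mulVec v = 0) : Y = 0 := by
  have h1 : Y * krylov Q v = 0 := by
    rw [mul_krylov_of_commute h, h0]
    ext i j
    simp [krylov]
  rw [← Matrix.mul_nonsing_inv_cancel_right _ Y hv, h1, zero_mul]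

/-- The centralizer of a matrix with a cyclic vector consists of its polynomials. -/
theorem eq_of_commute_krylov {Y Q : Matrix (Fin 3) (Fin 3) R} (h : Y * Q = Q * Y)
    {v : Fin 3 → R} (hv : IsUnit (krylov Q v).det) {c : Fin 3 → R}
    (hc : c = (krylov Q v)⁻¹.mulVec (Y.mulVec v)) :
    Y = c 0 • 1 + c 1 • Q + c 2 • Q ^ 2 := by
  rw [← sub_eq_zero]
  refine eq_zero_of_mulVec_krylov (Q := Q) (v := v) ?_ hv ?_
  · have h2 : (c 0 • 1 + c 1 • Q + c 2 • Q ^ 2) * Q = Q * (c 0 • 1 + c 1 • Q + c 2 • Q ^ 2) := by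
      simp only [add_mul, mul_add, smul_mul_assoc, mul_smul_comm, one_mul, mul_one, ← pow_succ,
        ← pow_succ']
    rw [sub_mul, mul_sub, h, h2]
  · rw [Matrix.sub_mulVec, ← krylov_mulVec, hc, Matrix.mulVec_mulVec,
      Matrix.mul_nonsing_inv _ hv, Matrix.one_mulVec, sub_self]

/-- The Cayley–Hamilton theorem for traceless matrices. -/
theorem pow_three_eq [Algebra ℂ R] {Q : Matrix (Fin 3) (Fin 3) R} (h : Q.trace = 0) :
    Q ^ 3 = ((1 / 2 : ℂ) • (Q ^ 2).trace) • Q + ((1 / 3 : ℂ) • (Q ^ 3).trace) • 1 := by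
  -- Multiplying by `6` clears the denominators of `tr Q² / 2` and `tr Q³ / 3`; each entry then
  -- follows from the two trace relations by ring arithmetic.
  have h6 : IsUnit (6 : R) := by
    have : (6 : R) = algebraMap ℂ R 6 := (map_ofNat _ 6).symm
    rw [this]
    exact (IsUnit.mk0 (6 : ℂ) (by norm_num)).map _
  have h2 : (2 : R) * ((1 / 2 : ℂ) • (Q ^ 2).trace) = (Q ^ 2).trace := by
    rw [Algebra.smul_def, ← mul_assoc, ← map_ofNat (algebraMap ℂ R) 2, ← map_mul]
    norm_num
  have h3 : (3 : R) * ((1 / 3 : ℂ) • (Q ^ 3).trace) = (Q ^ 3).trace := by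
    rw [Algebra.smul_def, ← mul_assoc, ← map_ofNat (algebraMap ℂ R) 3, ← map_mul]
    norm_num
  generalize (1 / 2 : ℂ) • (Q ^ 2).trace = e at *
  generalize (1 / 3 : ℂ) • (Q ^ 3).trace = d at *
  rw [Matrix.trace_fin_three] at h
  have h4 : Q 2 2 = - Q 0 0 - Q 1 1 := by linear_combination h
  simp only [Matrix.trace_fin_three, pow_succ, pow_zero, one_mul, Matrix.mul_apply,
    Fin.sum_univ_three, h4] at h2 h3
  ext i j
  refine h6.mul_left_cancel ?_
  fin_cases i <;> fin_cases j <;>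
    simp [pow_succ, Matrix.mul_apply, Fin.sum_univ_three, h4]
  · linear_combination (-3 * Q 0 0) * h2 - 2 * h3
  · linear_combination (-3 * Q 0 1) * h2
  · linear_combination (-3 * Q 0 2) * h2
  · linear_combination (-3 * Q 1 0) * h2
  · linear_combination (-3 * Q 1 1) * h2 - 2 * h3
  · linear_combination (-3 * Q 1 2) * h2
  · linear_combination (-3 * Q 2 0) * h2
  · linear_combination (-3 * Q 2 1) * h2
  · linear_combination (-3 * (- Q 0 0 - Q 1 1)) * h2 - 2 * h3

/-- Cayley–Hamilton: on `v, Qv, Q²v` a traceless matrix acts by a companion matrix that depends only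
on its traces. Cyclicity of `v` is not needed here. -/
theorem mul_krylov [Algebra ℂ R] {Q : Matrix (Fin 3) (Fin 3) R} (h : Q.trace = 0)
    (v : Fin 3 → R) : Q * krylov Q v = krylov Q v *
      !![0, 0, (1 / 3 : ℂ) • (Q ^ 3).trace; 1, 0, (1 / 2 : ℂ) • (Q ^ 2).trace; 0, 1, 0] := by
  have h3 := pow_three_eq h
  set e := (1 / 2 : ℂ) • (Q ^ 2).trace
  set d := (1 / 3 : ℂ) • (Q ^ 3).trace
  rw [mul_krylov_of_commute rfl]
  ext i j
  rw [Matrix.mul_apply, Fin.sum_univ_three, krylov, krylov]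
  simp only [Matrix.of_apply, Matrix.mulVec_mulVec, ← pow_succ]
  fin_cases j
  · simp
  · simp
  · simp only [Fin.reduceFinMk, Fin.isValue, Fin.val_two, Nat.reduceAdd]
    rw [h3, Matrix.add_mulVec]
    simp [Matrix.smul_mulVec]
    ring

/-- Two traceless matrices with cyclic vectors and the same invariants are conjugate. -/
theorem conj_of_krylov [Algebra ℂ R] {P Q : Matrix (Fin 3) (Fin 3) R} (hP : P.trace = 0)
    (hQ : Q.trace = 0) (h2 : (P ^ 2).trace = (Q ^ 2).trace) (h3 : (P ^ 3).trace = (Q ^ 3).trace)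
    {v w : Fin 3 → R} (hv : IsUnit (krylov P v).det) :
    Q * (krylov Q w * (krylov P v)⁻¹) = krylov Q w * (krylov P v)⁻¹ * P := by
  have h4 := mul_krylov hP v
  rw [← mul_assoc, mul_krylov hQ, ← h2, ← h3, mul_assoc, mul_assoc]
  congr 1
  -- It remains to see that the inverse Krylov matrix of `P` intertwines `P` with the companion
  -- matrix: this is `h4` multiplied by the inverse on both sides.
  rw [← Matrix.mul_nonsing_inv_cancel_right _ (_ * (krylov P v)⁻¹) hv, mul_assoc _ _ (krylov P v),
    Matrix.nonsing_inv_mul _ hv, mul_one, ← Matrix.nonsing_inv_mul_cancel_left _ (!![_, _, _; _, _, _; _, _, _] : Matrix (Fin 3) (Fin 3) R) hv, ← h4]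
  simp only [mul_assoc]
  rw [Matrix.mul_nonsing_inv _ hv, mul_one]

end Krylov

/-! ### Truncation modulo `z ^ N` -/

/-- Power series modulo `z ^ N`. -/
abbrev TruncRing (N : ℕ) : Type :=
  PowerSeries ℂ ⧸ Ideal.span {(PowerSeries.X : PowerSeries ℂ) ^ N}

/-- Reduction of power series modulo `z ^ N`. -/
def trunc (N : ℕ) : PowerSeries ℂ →+* TruncRing N := Ideal.Quotient.mk _

theorem trunc_eq_zero_iff {N : ℕ} {f : PowerSeries ℂ} :
    trunc N f = 0 ↔ ∀ n < N, PowerSeries.coeff n f = 0 := by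
  rw [trunc, Ideal.Quotient.eq_zero_iff_mem, Ideal.mem_span_singleton, PowerSeries.X_pow_dvd_iff]

theorem trunc_eq_iff {N : ℕ} {f g : PowerSeries ℂ} :
    trunc N f = trunc N g ↔ ∀ n < N, PowerSeries.coeff n f = PowerSeries.coeff n g := by
  rw [← sub_eq_zero, ← map_sub, trunc_eq_zero_iff]
  simp only [map_sub, sub_eq_zero]

theorem trunc_surjective (N : ℕ) : Function.Surjective (trunc N) := Ideal.Quotient.mk_surjective

/-- Reduction of matrices of power series modulo `z ^ N`. -/
def red (N : ℕ) : SeriesMat →+* Matrix (Fin 3) (Fin 3) (TruncRing N) := (trunc N).mapMatrix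

theorem red_apply (N : ℕ) (F : SeriesMat) (i j : Fin 3) : red N F i j = trunc N (F i j) := rfl

theorem trace_red (N : ℕ) (F : SeriesMat) : (red N F).trace = trunc N F.trace := by
  simp [Matrix.trace_fin_three, red_apply]

theorem red_surjective (N : ℕ) : Function.Surjective (red N) := by
  intro M
  choose F hF using fun i j => trunc_surjective N (M i j)
  exact ⟨Matrix.of F, Matrix.ext fun i j => hF i j⟩

/-- Reduction of polynomial matrices modulo `z ^ N`. -/
def redP (N : ℕ) : PolyMat →+* Matrix (Fin 3) (Fin 3) (TruncRing N) := (red N).comp toSeries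

theorem redP_eq_iff {N : ℕ} {F G : PolyMat} :
    redP N F = redP N G ↔ ∀ n < N, coeffMat n F = coeffMat n G := by
  constructor
  · intro h n hn
    ext i j
    have h1 := trunc_eq_iff.1 (congrFun (congrFun h i) j) n hn
    simpa only [toSeries_apply, Polynomial.coeff_coe, coeffMat_apply] using h1
  · intro h
    ext i j
    refine trunc_eq_iff.2 fun n hn => ?_
    simpa only [toSeries_apply, Polynomial.coeff_coe, coeffMat_apply] using
      congrFun (congrFun (h n hn) i) j

theorem redP_eq_zero_iff {N : ℕ} {F : PolyMat} :
    redP N F = 0 ↔ ∀ n < N, coeffMat n F = 0 := by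
  rw [← map_zero (redP N), redP_eq_iff]
  simp only [map_zero]

theorem trace_redP (N : ℕ) (F : PolyMat) :
    (redP N F).trace = trunc N (F.trace : ℂ[X]) := by
  rw [redP, RingHom.comp_apply, trace_red, trace_toSeries]

theorem trunc_trace_eq_zero_of_redP {N : ℕ} {F : SeriesMat} (h : (red N F).trace = 0) (n : ℕ)
    (hn : n < N) : (F.map (PowerSeries.coeff n)).trace = 0 := by
  rw [trace_red, trunc_eq_zero_iff] at h
  rw [← h n hn]
  simp [Matrix.trace_fin_three]

/-- Every traceless matrix modulo `z ^ N` is the reduction of a direction of the phase space. -/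
theorem exists_redP_dirn_eq {N : ℕ} {M : Matrix (Fin 3) (Fin 3) (TruncRing N)}
    (hM : M.trace = 0) : ∃ v : PhaseSpace N, redP N (dirn N v) = M := by
  obtain ⟨F, rfl⟩ := red_surjective N M
  refine ⟨fun i => (F.map (PowerSeries.coeff (N - 1 - i.2)) * X i.1).trace, ?_⟩
  ext i j
  refine trunc_eq_iff.2 fun n hn => ?_
  rw [toSeries_apply, Polynomial.coeff_coe, ← coeffMat_apply, coeffMat_dirn N n _ hn]
  obtain ⟨l, rfl⟩ : ∃ l : Fin N, n = N - 1 - l := ⟨⟨N - 1 - n, by omega⟩, by simp; omega⟩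
  have h := sum_trace_mul_X_smul_XDual (F.map (PowerSeries.coeff (N - 1 - l)))
  rw [trunc_trace_eq_zero_of_redP hM _ hn, zero_div, zero_smul, sub_zero] at h
  rw [coeffMat_polar]
  exact congrFun (congrFun h i) j

/-- Every traceless matrix modulo `z ^ N` is the reduction of an element of the loop algebra. -/
theorem exists_redP_alg_eq {N : ℕ} {M : Matrix (Fin 3) (Fin 3) (TruncRing N)}
    (hM : M.trace = 0) : ∃ v : PhaseSpace N, redP N (alg N v) = M := by
  obtain ⟨F, rfl⟩ := red_surjective N M
  refine ⟨fun i => (F.map (PowerSeries.coeff i.2) * XDual i.1).trace, ?_⟩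
  ext i j
  refine trunc_eq_iff.2 fun n hn => ?_
  rw [toSeries_apply, Polynomial.coeff_coe, ← coeffMat_apply]
  obtain ⟨l, rfl⟩ : ∃ l : Fin N, n = l := ⟨⟨n, hn⟩, rfl⟩
  have h := sum_trace_mul_XDual_smul_X (F.map (PowerSeries.coeff l))
  rw [trunc_trace_eq_zero_of_redP hM _ hn, zero_div, zero_smul, sub_zero] at h
  rw [coeffMat_alg]
  exact congrFun (congrFun h i) j

theorem redP_dirn_injective {N : ℕ} {v w : PhaseSpace N}
    (h : redP N (dirn N v) = redP N (dirn N w)) : v = w := by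
  rw [← sub_eq_zero]
  refine eq_zero_of_coeffMat_polar N _ fun n hn => ?_
  rw [← coeffMat_dirn N n _ hn, map_sub, map_sub, redP_eq_iff.1 h n hn, sub_self]

theorem redP_laxP (N : ℕ) (x : PhaseSpace N) : redP N (laxP N x) = redP N (dirn N x) := by
  refine redP_eq_iff.2 fun n hn => ?_
  rw [coeffMat_laxP N n x hn, coeffMat_dirn N n x hn]

theorem trace_alg (N : ℕ) (v : PhaseSpace N) : (alg N v).trace = 0 := by
  rw [alg, Fintype.linearCombination_apply, Matrix.trace_sum]
  refine Finset.sum_eq_zero fun i _ => ?_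
  rw [Matrix.trace_smul, monP]
  have h := trace_X i.1
  rw [Matrix.trace_fin_three] at h ⊢
  simp only [Matrix.map_apply, ← map_add, h, map_zero, smul_zero]

theorem redP_dirn_liePoisson (N : ℕ) (hN : 1 ≤ N) (x η : PhaseSpace N) :
    redP N (dirn N ((liePoisson N x).mulVec η)) =
      redP N (alg N η) * redP N (laxP N x) - redP N (laxP N x) * redP N (alg N η) := by
  rw [← map_mul, ← map_mul, ← map_sub, redP_eq_iff]
  exact fun n hn => coeffMat_dirn_liePoisson_mulVec N hN x η n hn

theorem liePoisson_mulVec_eq_zero_iff_commute (N : ℕ) (hN : 1 ≤ N) (x η : PhaseSpace N) :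
    (liePoisson N x).mulVec η = 0 ↔
      redP N (alg N η) * redP N (laxP N x) = redP N (laxP N x) * redP N (alg N η) := by
  rw [liePoisson_mulVec_eq_zero_iff N hN, ← redP_eq_zero_iff, map_sub, map_mul, map_mul,
    sub_eq_zero]

/-! ### Regular elements -/

/-- The Lax matrix has a cyclic vector at the leading order. -/
def IsRegularAt (N : ℕ) (x : PhaseSpace N) (v : Fin 3 → ℂ) : Prop :=
  (krylov (coeffMat 0 (laxP N x)) v).det ≠ 0

/-- The matrix `(v, Q v, Q² v)` for the Lax matrix `Q` and a constant vector `v`. -/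
def laxKrylov (N : ℕ) (x : PhaseSpace N) (v : Fin 3 → ℂ) : SeriesMat :=
  krylov (toSeries (laxP N x)) (PowerSeries.C ∘ v)

theorem constantCoeff_toSeries (F : PolyMat) :
    PowerSeries.constantCoeff.mapMatrix (toSeries F) = coeffMat 0 F := by
  ext i j
  rw [coeffMat_apply, ← Polynomial.coeff_coe, PowerSeries.coeff_zero_eq_constantCoeff_apply]
  rfl

/-- A power series is invertible as soon as its constant term is, so cyclicity at `z = 0` propagates
to all orders. -/
theorem isUnit_det_laxKrylov {N : ℕ} {x : PhaseSpace N} {v : Fin 3 → ℂ}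
    (h : IsRegularAt N x v) : IsUnit (laxKrylov N x v).det := by
  rw [PowerSeries.isUnit_iff_constantCoeff, RingHom.map_det, laxKrylov, map_krylov,
    isUnit_iff_ne_zero]
  have h2 : (PowerSeries.constantCoeff (R := ℂ)) ∘ PowerSeries.C ∘ v = v := by
    funext i
    simp
  rwa [constantCoeff_toSeries, h2]

theorem red_laxKrylov (N : ℕ) (x : PhaseSpace N) (v : Fin 3 → ℂ) :
    red N (laxKrylov N x v) = krylov (redP N (laxP N x)) (trunc N ∘ PowerSeries.C ∘ v) :=
  map_krylov _ _ _

theorem isUnit_det_red {N : ℕ} {F : SeriesMat} (h : IsUnit F.det) : IsUnit (red N F).det := by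
  have := h.map (trunc N)
  rwa [RingHom.map_det] at this

theorem red_inv {N : ℕ} {F : SeriesMat} (h : IsUnit F.det) : red N F⁻¹ = (red N F)⁻¹ := by
  refine (Matrix.inv_eq_left_inv ?_).symm
  rw [← map_mul, Matrix.nonsing_inv_mul _ h, map_one]

/-! ### Casimirs and the rank of the Poisson tensor at regular points. -/

theorem forall_trForm_eq_iff {N : ℕ} (F G F' G' : PolyMat) :
    (∀ n < N, trForm n F G = trForm n F' G') ↔
      (redP N F * redP N G).trace = (redP N F' * redP N G').trace := by
  rw [← map_mul, ← map_mul, trace_redP, trace_redP, trunc_eq_iff]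
  simp only [Polynomial.coeff_coe, trForm_apply]

theorem forall_trForm_eq_zero_iff {N : ℕ} (F G : PolyMat) :
    (∀ n < N, trForm n F G = 0) ↔ (redP N F * redP N G).trace = 0 := by
  have := forall_trForm_eq_iff (N := N) F G 0 0
  simpa using this

/-- The differential of the Casimirs, i.e. of the coefficients of `z ^ n`, `n < N`, in the
invariants of the Lax matrix. -/
def dCasimir (N : ℕ) (x : PhaseSpace N) : PhaseSpace N →ₗ[ℂ] (Fin N ⊕ Fin N → ℂ) :=
  LinearMap.pi (Sum.elim (fun n => trForm n (laxP N x) ∘ₗ dirn N)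
    (fun n => trForm n (laxP N x ^ 2) ∘ₗ dirn N))

theorem mem_ker_dCasimir {N : ℕ} {x v : PhaseSpace N} :
    v ∈ LinearMap.ker (dCasimir N x) ↔ (redP N (laxP N x) * redP N (dirn N v)).trace = 0 ∧
      (redP N (laxP N x) ^ 2 * redP N (dirn N v)).trace = 0 := by
  rw [← map_pow, ← forall_trForm_eq_zero_iff, ← forall_trForm_eq_zero_iff, LinearMap.mem_ker,
    funext_iff, Sum.forall]
  exact ⟨fun h => ⟨fun n hn => h.1 ⟨n, hn⟩, fun n hn => h.2 ⟨n, hn⟩⟩,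
    fun h => ⟨fun n => h.1 n n.2, fun n => h.2 n n.2⟩⟩

theorem range_liePoisson_le_ker (N : ℕ) (hN : 1 ≤ N) (x : PhaseSpace N) :
    hamiltonianDirections (liePoisson N) x ≤ LinearMap.ker (dCasimir N x) := by
  rintro _ ⟨η, rfl⟩
  rw [mem_ker_dCasimir, Matrix.mulVecLin_apply, redP_dirn_liePoisson N hN]
  generalize redP N (alg N η) = Y
  generalize redP N (laxP N x) = Q
  constructor
  · rw [mul_sub, Matrix.trace_sub, ← mul_assoc, Matrix.trace_mul_comm (Q * Y), sub_self]
  · rw [mul_sub, Matrix.trace_sub, ← mul_assoc, Matrix.trace_mul_comm (Q ^ 2 * Y), pow_two]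
    simp only [mul_assoc, sub_self]

theorem trace_mul_vecMulVec {R : Type*} [CommRing R] (A : Matrix (Fin 3) (Fin 3) R)
    (v w : Fin 3 → R) : (A * Matrix.vecMulVec v w).trace = w ⬝ᵥ A.mulVec v := by
  rw [Matrix.mul_vecMulVec, Matrix.trace_vecMulVec, dotProduct_comm]

/-- Rank-one directions suffice: `tr (Q^j v wᵀ) = wᵀ Q^j v`, and for cyclic `v` these three values
can be prescribed through `w`. The value at `j = 0` is set to zero to make the direction traceless.
-/
theorem dCasimir_surjective {N : ℕ} {x : PhaseSpace N} {v : Fin 3 → ℂ} (h : IsRegularAt N x v) :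
    Function.Surjective (dCasimir N x) := by
  intro α
  set K := laxKrylov N x v with hK
  have hu := isUnit_det_red (N := N) (isUnit_det_laxKrylov h)
  rw [red_laxKrylov] at hu
  set Q := redP N (laxP N x) with hQ
  set v' := trunc N ∘ PowerSeries.C ∘ v
  set a : PowerSeries ℂ := PowerSeries.mk fun n => if h : n < N then α (Sum.inl ⟨n, h⟩) else 0
  set b : PowerSeries ℂ := PowerSeries.mk fun n => if h : n < N then α (Sum.inr ⟨n, h⟩) else 0
  set w := Matrix.vecMul ![0, trunc N a, trunc N b] (krylov Q v')⁻¹ with hw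
  have h1 : ∀ j : Fin 3, (Q ^ (j : ℕ) * Matrix.vecMulVec v' w).trace =
      ![0, trunc N a, trunc N b] j := by
    intro j
    have h2 : Matrix.vecMul w (krylov Q v') = ![0, trunc N a, trunc N b] := by
      rw [hw, Matrix.vecMul_vecMul, Matrix.nonsing_inv_mul _ hu, Matrix.vecMul_one]
    rw [trace_mul_vecMulVec, ← h2]
    rfl
  obtain ⟨u, hu⟩ := exists_redP_dirn_eq (N := N) (M := Matrix.vecMulVec v' w)
    (by simpa using h1 0)
  refine ⟨u, funext (Sum.forall.2 ⟨fun n => ?_, fun n => ?_⟩)⟩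
  · have h3 := h1 1
    rw [← hu, Fin.val_one, pow_one, hQ, ← map_mul, trace_redP] at h3
    have h4 := trunc_eq_iff.1 h3 n n.2
    rw [Polynomial.coeff_coe] at h4
    refine h4.trans ?_
    simp [a]
  · have h3 := h1 2
    rw [← hu, Fin.val_two, hQ, ← map_pow, ← map_mul, trace_redP] at h3
    have h4 := trunc_eq_iff.1 h3 n n.2
    rw [Polynomial.coeff_coe] at h4
    refine h4.trans ?_
    simp [b]

theorem redP_alg_injective {N : ℕ} {v w : PhaseSpace N}
    (h : redP N (alg N v) = redP N (alg N w)) : v = w := by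
  rw [← sub_eq_zero]
  refine eq_zero_of_coeffMat_alg N _ fun n hn => ?_
  rw [map_sub, map_sub, redP_eq_iff.1 h n hn, sub_self]

theorem eq_zero_of_commute_krylov {R : Type*} [CommRing R] {Y Q : Matrix (Fin 3) (Fin 3) R}
    (h : Y * Q = Q * Y) {v : Fin 3 → R} (hv : IsUnit (krylov Q v).det) (h3 : IsUnit (3 : R))
    (htr : Y.trace = 0) (h1 : (krylov Q v)⁻¹.mulVec (Y.mulVec v) 1 = 0)
    (h2 : (krylov Q v)⁻¹.mulVec (Y.mulVec v) 2 = 0) : Y = 0 := by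
  have hY := eq_of_commute_krylov h hv rfl
  rw [h1, h2, zero_smul, zero_smul, add_zero, add_zero] at hY
  generalize (krylov Q v)⁻¹.mulVec (Y.mulVec v) 0 = c at hY
  have hc : c = 0 := by
    refine h3.mul_left_cancel ?_
    rw [mul_zero, ← htr, hY]
    simp [Matrix.trace_fin_three]
    ring
  rw [hY, hc, zero_smul]

/-- An element of the kernel is `c₀ + c₁ Q + c₂ Q²` modulo `z^N`, and its vanishing trace determines
`c₀`. This leaves the `N` coefficients of each of `c₁` and `c₂`. -/
theorem finrank_ker_liePoisson_le {N : ℕ} (hN : 1 ≤ N) {x : PhaseSpace N} {v : Fin 3 → ℂ}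
    (h : IsRegularAt N x v) :
    Module.finrank ℂ (LinearMap.ker (liePoisson N x).mulVecLin) ≤ 2 * N := by
  have hu := isUnit_det_laxKrylov h
  have hu' := isUnit_det_red (N := N) hu
  have hinv := red_inv (N := N) hu
  rw [red_laxKrylov] at hinv hu'
  set K := laxKrylov N x v
  set Q := redP N (laxP N x) with hQ
  -- The coordinates are lifted to power series, where their coefficients are honest linear
  -- functions of `η`.
  let c : PhaseSpace N → Fin 3 → PowerSeries ℂ := fun η =>
    K⁻¹.mulVec ((toSeries (alg N η)).mulVec (PowerSeries.C ∘ v))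
  have hc : ∀ η, trunc N ∘ c η = (krylov Q (trunc N ∘ PowerSeries.C ∘ v))⁻¹.mulVec
      ((redP N (alg N η)).mulVec (trunc N ∘ PowerSeries.C ∘ v)) := by
    intro η
    rw [← hinv]
    funext i
    refine (RingHom.map_mulVec (trunc N) _ _ i).trans ?_
    congr 2
  have hts : ∀ (r : ℂ) (F : PolyMat), toSeries (r • F) = r • toSeries F := by
    intro r F
    ext i j n
    simp [toSeries_apply, Polynomial.coeff_coe]
  let f : LinearMap.ker (liePoisson N x).mulVecLin →ₗ[ℂ] (Fin N × Fin 2 → ℂ) :=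
    { toFun := fun η p => PowerSeries.coeff p.1 (c η p.2.succ)
      map_add' := by
        intro η ξ
        funext p
        simp [c, Matrix.mul_add, Matrix.add_mulVec]
      map_smul' := by
        intro r η
        funext p
        simp [c, hts, Matrix.smul_mulVec] }
  have hf : Function.Injective f := by
    rw [← LinearMap.ker_eq_bot, LinearMap.ker_eq_bot']
    intro η hη
    have h1 := (liePoisson_mulVec_eq_zero_iff_commute N hN x η).1 η.2
    have h2 : (redP N (alg N η)).trace = 0 := by
      rw [trace_redP, trace_alg]
      simp
    have h3 : ∀ i : Fin 2, trunc N (c η i.succ) = 0 := by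
      intro i
      rw [trunc_eq_zero_iff]
      exact fun n hn => congrFun hη (⟨n, hn⟩, i)
    have h4 : IsUnit (3 : TruncRing N) := by
      rw [← map_ofNat (algebraMap ℂ (TruncRing N)) 3]
      exact (IsUnit.mk0 (3 : ℂ) (by norm_num)).map _
    refine Subtype.ext (redP_alg_injective (Eq.trans (eq_zero_of_commute_krylov h1 hu' h4 h2
      ((congrFun (hc η) 1).symm.trans (h3 0)) ((congrFun (hc η) 2).symm.trans (h3 1))) ?_))
    rw [ZeroMemClass.coe_zero, map_zero, map_zero]
  have := LinearMap.finrank_le_finrank_of_injective hf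
  simpa [mul_comm] using this

theorem card_idx (N : ℕ) : Module.finrank ℂ (PhaseSpace N) = 8 * N := by
  simp

theorem finrank_ker_dCasimir {N : ℕ} {x : PhaseSpace N} {v : Fin 3 → ℂ} (h : IsRegularAt N x v) :
    Module.finrank ℂ (LinearMap.ker (dCasimir N x)) = 6 * N := by
  have h1 := LinearMap.finrank_range_add_finrank_ker (dCasimir N x)
  rw [LinearMap.range_eq_top.2 (dCasimir_surjective h), finrank_top, card_idx] at h1
  simp at h1
  omega

theorem hamiltonianDirections_eq_ker {N : ℕ} (hN : 1 ≤ N) {x : PhaseSpace N} {v : Fin 3 → ℂ}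
    (h : IsRegularAt N x v) :
    hamiltonianDirections (liePoisson N) x = LinearMap.ker (dCasimir N x) := by
  refine Submodule.eq_of_le_of_finrank_le (range_liePoisson_le_ker N hN x) ?_
  rw [finrank_ker_dCasimir h]
  have h1 := LinearMap.finrank_range_add_finrank_ker (liePoisson N x).mulVecLin
  have h2 := finrank_ker_liePoisson_le hN h
  rw [card_idx] at h1
  rw [hamiltonianDirections]
  omega

theorem orbitDim_of_isRegularAt {N : ℕ} (hN : 1 ≤ N) {x : PhaseSpace N} {v : Fin 3 → ℂ}
    (h : IsRegularAt N x v) : orbitDim N x = 6 * N := by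
  rw [orbitDim, hamiltonianDirections_eq_ker hN h, finrank_ker_dCasimir h]

theorem coeffMat_zero_laxP {N : ℕ} (x : PhaseSpace N) (l : Fin N) (hl : (l : ℕ) + 1 = N) :
    coeffMat 0 (laxP N x) = ∑ a, x (a, l) • XDual a := by
  rw [← coeffMat_laxP_sub]
  congr 2
  omega

theorem isRegularAt_of_mem_weylChamber {N : ℕ} (hN : 1 ≤ N) {x : PhaseSpace N}
    (hx : x ∈ weylChamber N) : IsRegularAt N x ![1, 1, 1] := by
  obtain ⟨h1, h2⟩ := hx
  obtain ⟨h3, h4, h5⟩ := h2 ⟨N - 1, by omega⟩ (by simp; omega)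
  set l : Fin N := ⟨N - 1, by omega⟩
  have h6 : coeffMat 0 (laxP N x) =
      Matrix.diagonal ![x (0, l), x (1, l) - x (0, l), -x (1, l)] := by
    rw [coeffMat_zero_laxP x l (by simp [l]; omega), Fin.sum_univ_eight]
    simp only [h1 2 l (by decide) (by decide), h1 3 l (by decide) (by decide),
      h1 4 l (by decide) (by decide), h1 5 l (by decide) (by decide),
      h1 6 l (by decide) (by decide), h1 7 l (by decide) (by decide), zero_smul, add_zero]
    rw [XDual_eq]
    ext i j
    fin_cases i <;> fin_cases j <;> simp <;> ring
  rw [IsRegularAt, h6]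
  -- For a diagonal matrix the Krylov determinant of `(1,1,1)` is the Vandermonde determinant.
  have h7 : ∀ d : Fin 3 → ℂ, (krylov (Matrix.diagonal d) ![1, 1, 1]).det =
      (d 1 - d 0) * (d 2 - d 0) * (d 2 - d 1) := by
    intro d
    rw [Matrix.det_fin_three]
    simp only [krylov, Matrix.diagonal_pow, Matrix.of_apply, Matrix.mulVec_diagonal]
    simp
    ring
  rw [h7]
  refine mul_ne_zero (mul_ne_zero ?_ ?_) ?_
  · exact sub_ne_zero.2 h3.symm
  · exact sub_ne_zero.2 h5.symm
  · exact sub_ne_zero.2 h4.symm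

/-! ### Coadjoint orbits -/

theorem toSeries_monP (l : ℕ) (A : Matrix (Fin 3) (Fin 3) ℂ) :
    toSeries (monP l A) = (PowerSeries.X ^ l : PowerSeries ℂ) • A.map PowerSeries.C := by
  ext i j n
  rw [toSeries_apply, monP, Matrix.map_apply, Polynomial.coeff_coe, Polynomial.coeff_monomial,
    Matrix.smul_apply, Matrix.map_apply, smul_eq_mul, PowerSeries.coeff_mul_C,
    PowerSeries.coeff_X_pow]
  by_cases h : l = n
  · simp [h]
  · simp [h, Ne.symm h]

theorem coeff_trace_mul_toSeries_monP (n l : ℕ) (F : SeriesMat) (A : Matrix (Fin 3) (Fin 3) ℂ) :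
    PowerSeries.coeff n (F * toSeries (monP l A)).trace =
      if l ≤ n then (F.map (PowerSeries.coeff (n - l)) * A).trace else 0 := by
  rw [toSeries_monP, Matrix.mul_smul, Matrix.trace_smul, smul_eq_mul, PowerSeries.coeff_X_pow_mul']
  congr 1
  rw [trace_mul_fin_three, trace_mul_fin_three]
  simp [PowerSeries.coeff_mul_C]

theorem red_eq_iff {N : ℕ} {F G : SeriesMat} :
    red N F = red N G ↔ ∀ n < N, F.map (PowerSeries.coeff n) = G.map (PowerSeries.coeff n) := by
  constructor
  · intro h n hn
    ext i j
    exact trunc_eq_iff.1 (congrFun (congrFun h i) j) n hn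
  · intro h
    ext i j
    exact trunc_eq_iff.2 fun n hn => congrFun (congrFun (h n hn) i) j

/-- Pairing with `X_a z^ℓ` reads off the coefficient of `z^{N-1-ℓ}`, and gives nothing for `ℓ ≥ N`;
hence the infinitely many conditions amount to equality modulo `z^N`. -/
theorem red_eq_iff_trace {N : ℕ} (hN : 1 ≤ N) {F G : SeriesMat} (hF : F.trace = 0)
    (hG : G.trace = 0) : red N F = red N G ↔ ∀ (a : Fin 8) (l : ℕ),
      PowerSeries.coeff (N - 1) (F * toSeries (monP l (X a))).trace =
        PowerSeries.coeff (N - 1) (G * toSeries (monP l (X a))).trace := by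
  simp only [coeff_trace_mul_toSeries_monP]
  rw [red_eq_iff]
  constructor
  · intro h a l
    split_ifs
    · rw [h _ (by omega)]
    · rfl
  · intro h n hn
    have key : ∀ H : SeriesMat, H.trace = 0 → H.map (PowerSeries.coeff n) =
        ∑ a, (H.map (PowerSeries.coeff n) * X a).trace • XDual a := by
      intro H hH
      have h2 : (H.map (PowerSeries.coeff n)).trace = 0 := by
        rw [← map_zero (PowerSeries.coeff n), ← hH]
        simp [Matrix.trace_fin_three]
      rw [sum_trace_mul_X_smul_XDual, h2, zero_div, zero_smul, sub_zero]
    rw [key F hF, key G hG]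
    refine Finset.sum_congr rfl fun a _ => ?_
    have h3 := h a (N - 1 - n)
    rw [if_pos (by omega), if_pos (by omega), show N - 1 - (N - 1 - n) = n by omega] at h3
    rw [h3]

/-- The shift and the corrections pair to zero with power series, so the coadjoint action only sees
`Q` modulo `z^N` and becomes conjugation there. -/
theorem mem_coadjointOrbit_iff {N : ℕ} (hN : 1 ≤ N) {x y : PhaseSpace N} :
    y ∈ coadjointOrbit N x ↔ ∃ g : LoopGroup,
      redP N (laxP N y) * red N g = red N g * redP N (laxP N x) := by
  refine exists_congr fun g => ?_
  have h1 : ∀ (a : Fin 8) (l : ℕ), pairing (lax N y) (loopBasis a l) =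
      PowerSeries.coeff (N - 1) (toSeries (laxP N y) * toSeries (monP l (X a))).trace := by
    intro a l
    rw [loopBasis_eq, ← map_ofPowerSeries_toSeries, pairing_lax_eq_coeff_laxP N hN]
  have h2 : ∀ (a : Fin 8) (l : ℕ), pairing (lax N x)
      (LoopGroup.toMat g⁻¹ * loopBasis a l * LoopGroup.toMat g) = PowerSeries.coeff (N - 1)
        ((g : SeriesMat) * toSeries (laxP N x) * ((g⁻¹ : LoopGroup) : SeriesMat) *
          toSeries (monP l (X a))).trace := by
    intro a l
    have h3 : LoopGroup.toMat g⁻¹ * loopBasis a l * LoopGroup.toMat g =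
        (((g⁻¹ : LoopGroup) : SeriesMat) * toSeries (monP l (X a)) * (g : SeriesMat)).map
          (HahnSeries.ofPowerSeries ℤ ℂ) := by
      rw [loopBasis_eq, ← map_ofPowerSeries_toSeries, Matrix.map_mul, Matrix.map_mul]
      rfl
    rw [h3, pairing_lax_eq_coeff_laxP N hN, ← mul_assoc, Matrix.trace_mul_comm _ (g : SeriesMat)]
    simp only [mul_assoc]
  simp only [h1, h2]
  have hg : ((g⁻¹ : LoopGroup) : SeriesMat) * (g : SeriesMat) = 1 := by
    rw [← Matrix.SpecialLinearGroup.coe_mul, inv_mul_cancel, Matrix.SpecialLinearGroup.coe_one]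
  have hg' : (g : SeriesMat) * ((g⁻¹ : LoopGroup) : SeriesMat) = 1 := by
    rw [← Matrix.SpecialLinearGroup.coe_mul, mul_inv_cancel, Matrix.SpecialLinearGroup.coe_one]
  have ht : ∀ z, (toSeries (laxP N z)).trace = 0 := by
    intro z
    rw [trace_toSeries, trace_laxP, Polynomial.coe_zero]
  rw [← red_eq_iff_trace hN (ht y)
    (by rw [mul_assoc, Matrix.trace_mul_comm, mul_assoc, hg, mul_one, ht])]
  rw [map_mul, map_mul]
  change redP N (laxP N y) = red N g * redP N (laxP N x) * red N (g⁻¹ : LoopGroup) ↔ _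
  constructor
  · intro h
    rw [h, mul_assoc, ← map_mul, hg, map_one, mul_one]
  · intro h
    rw [← h, mul_assoc, ← map_mul, hg', map_one, mul_one]

theorem exists_trunc_pow_three_eq {u : PowerSeries ℂ} (hu : IsUnit u) (N : ℕ) :
    ∃ r : PowerSeries ℂ, IsUnit r ∧ trunc N (r ^ 3) = trunc N u := by
  suffices h : ∃ r : PowerSeries ℂ, IsUnit r ∧ PowerSeries.X ^ (N + 1) ∣ u - r ^ 3 by
    obtain ⟨r, hr, h⟩ := h
    refine ⟨r, hr, (trunc_eq_iff.2 fun n hn => ?_)⟩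
    have := PowerSeries.X_pow_dvd_iff.1 h n (by omega)
    rw [map_sub, sub_eq_zero] at this
    exact this.symm
  rw [PowerSeries.isUnit_iff_constantCoeff, isUnit_iff_ne_zero] at hu
  induction N with
  | zero =>
    obtain ⟨c, hc⟩ := IsAlgClosed.exists_pow_nat_eq (PowerSeries.constantCoeff u) (n := 3)
      (by norm_num)
    refine ⟨PowerSeries.C c, ?_, ?_⟩
    · rw [PowerSeries.isUnit_iff_constantCoeff, isUnit_iff_ne_zero, PowerSeries.constantCoeff_C]
      rintro rfl
      exact hu (by rw [← hc]; norm_num)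
    · rw [zero_add, pow_one, PowerSeries.X_dvd_iff]
      simp [hc]
  | succ N ih =>
    obtain ⟨r, hr, w, hw⟩ := ih
    rw [PowerSeries.isUnit_iff_constantCoeff, isUnit_iff_ne_zero] at hr
    -- One Newton step: `c` solves `w(0) = 3 r(0)² c`, which removes the next coefficient of `u -
    -- r³`.
    set c := PowerSeries.constantCoeff w / (3 * PowerSeries.constantCoeff r ^ 2) with hc
    refine ⟨r + PowerSeries.C c * PowerSeries.X ^ (N + 1), ?_, ?_⟩
    · rw [PowerSeries.isUnit_iff_constantCoeff, isUnit_iff_ne_zero]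
      simpa using hr
    · have h1 : u - (r + PowerSeries.C c * PowerSeries.X ^ (N + 1)) ^ 3 =
          PowerSeries.X ^ (N + 1) * (w - 3 * r ^ 2 * PowerSeries.C c -
            PowerSeries.X ^ (N + 1) * (3 * r * PowerSeries.C c ^ 2 +
              PowerSeries.X ^ (N + 1) * PowerSeries.C c ^ 3)) := by
        linear_combination hw
      rw [h1, pow_succ PowerSeries.X (N + 1)]
      refine mul_dvd_mul_left _ (PowerSeries.X_dvd_iff.2 ?_)
      have h3 : PowerSeries.constantCoeff (3 : PowerSeries ℂ) = 3 := map_ofNat _ 3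
      simp [hc, h3]
      field_simp
      ring

/-- An intertwiner modulo `z ^ N` in `GL(3, ℂ[[z]])` may be replaced by one in `SL(3, ℂ[[z]])`. -/
theorem mem_coadjointOrbit_of_isUnit_det {N : ℕ} (hN : 1 ≤ N) {x y : PhaseSpace N} {G : SeriesMat}
    (hG : IsUnit G.det)
    (h : redP N (laxP N y) * red N G = red N G * redP N (laxP N x)) : y ∈ coadjointOrbit N x := by
  rw [mem_coadjointOrbit_iff hN]
  obtain ⟨r, hr, hr3⟩ := exists_trunc_pow_three_eq hG N
  obtain ⟨s, hs⟩ := hr.exists_right_inv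
  have hd : IsUnit (s ^ 3 * G.det) := by
    refine IsUnit.mul (IsUnit.pow 3 ?_) hG
    exact IsUnit.of_mul_eq_one r (by rw [mul_comm, hs])
  -- `s³ det G` is `1` only modulo `z^N`. Placing its exact inverse `e ≡ 1` in one diagonal entry
  -- makes the determinant equal to `1`, while modulo `z^N` the correcting matrix is still scalar.
  obtain ⟨e, he⟩ := hd.exists_right_inv
  have he1 : trunc N e = 1 := by
    have h1 : trunc N (s ^ 3 * G.det) = 1 := by
      rw [map_mul, ← hr3, ← map_mul, ← mul_pow, mul_comm, hs, one_pow, map_one]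
    have h2 := congrArg (trunc N) he
    rwa [map_mul, h1, one_mul, map_one] at h2
  have h3 : red N (Matrix.diagonal ![s * e, s, s]) = Matrix.scalar (Fin 3) (trunc N s) := by
    ext i j
    rw [red_apply]
    fin_cases i <;> fin_cases j <;> simp [he1]
  refine ⟨⟨G * Matrix.diagonal ![s * e, s, s], ?_⟩, ?_⟩
  · rw [Matrix.det_mul, Matrix.det_diagonal, Fin.prod_univ_three]
    simp only [Matrix.cons_val_zero, Matrix.cons_val_one, Matrix.cons_val_two, Matrix.head_cons,
      Matrix.tail_cons]
    linear_combination he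
  · change _ * red N (G * Matrix.diagonal ![s * e, s, s]) =
      red N (G * Matrix.diagonal ![s * e, s, s]) * _
    rw [map_mul, h3, ← mul_assoc, h, mul_assoc, mul_assoc,
      (Matrix.scalar_commute (trunc N s) (fun r => mul_comm _ r) (redP N (laxP N x))).eq]

theorem krylov_intertwine {R : Type*} [CommRing R] {P Q g : Matrix (Fin 3) (Fin 3) R}
    (h : Q * g = g * P) (v : Fin 3 → R) : krylov Q (g.mulVec v) = g * krylov P v := by
  refine Matrix.ext_col fun j => ?_
  have h2 : ∀ n : ℕ, Q ^ n * g = g * P ^ n := by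
    intro n
    induction n with
    | zero => simp
    | succ n ih => rw [pow_succ, mul_assoc, h, ← mul_assoc, ih, mul_assoc, pow_succ]
  rw [krylov_col, Matrix.mulVec_mulVec, h2, ← Matrix.mulVec_mulVec, ← krylov_col]
  rfl

theorem trace_redP_laxP (N : ℕ) (x : PhaseSpace N) : (redP N (laxP N x)).trace = 0 := by
  rw [trace_redP, trace_laxP, Polynomial.coe_zero, map_zero]

theorem red_mul_red_inv {N : ℕ} (g : LoopGroup) :
    red N g * red N (g⁻¹ : LoopGroup) = 1 := by
  rw [← map_mul, ← Matrix.SpecialLinearGroup.coe_mul, mul_inv_cancel,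
    Matrix.SpecialLinearGroup.coe_one, map_one]

theorem trace_pow_of_mem_coadjointOrbit {N : ℕ} (hN : 1 ≤ N) {x y : PhaseSpace N}
    (h : y ∈ coadjointOrbit N x) (n : ℕ) :
    (redP N (laxP N y) ^ n).trace = (redP N (laxP N x) ^ n).trace := by
  obtain ⟨g, hg⟩ := (mem_coadjointOrbit_iff hN).1 h
  have h2 : redP N (laxP N y) ^ n * red N g = red N g * redP N (laxP N x) ^ n := by
    induction n with
    | zero => simp
    | succ n ih => rw [pow_succ, mul_assoc, hg, ← mul_assoc, ih, mul_assoc, pow_succ]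
  rw [← mul_one (redP N (laxP N y) ^ n), ← red_mul_red_inv g, ← mul_assoc, h2, mul_assoc,
    Matrix.trace_mul_comm, mul_assoc, mul_eq_one_comm.1 (red_mul_red_inv g), mul_one]

/-- At `z = 0` the intertwiner becomes `g(0)`, of determinant one, and it carries cyclic vectors to
cyclic vectors. -/
theorem exists_isRegularAt_of_mem_coadjointOrbit {N : ℕ} (hN : 1 ≤ N) {x y : PhaseSpace N}
    (h : y ∈ coadjointOrbit N x) {v : Fin 3 → ℂ} (hv : IsRegularAt N x v) :
    ∃ w, IsRegularAt N y w := by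
  obtain ⟨g, hg⟩ := (mem_coadjointOrbit_iff hN).1 h
  have h1 : PowerSeries.constantCoeff.mapMatrix (toSeries (laxP N y) * (g : SeriesMat)) =
      PowerSeries.constantCoeff.mapMatrix ((g : SeriesMat) * toSeries (laxP N x)) := by
    have h2 : red N (toSeries (laxP N y) * (g : SeriesMat)) = red N ((g : SeriesMat) * toSeries (laxP N x)) := by
      rw [map_mul, map_mul]
      exact hg
    have h3 := red_eq_iff.1 h2 0 (by omega)
    ext i j
    have h4 := congrFun (congrFun h3 i) j
    simp only [Matrix.map_apply, PowerSeries.coeff_zero_eq_constantCoeff_apply] at h4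
    exact h4
  rw [map_mul, map_mul, constantCoeff_toSeries, constantCoeff_toSeries] at h1
  refine ⟨(PowerSeries.constantCoeff.mapMatrix (g : SeriesMat)).mulVec v, ?_⟩
  rw [IsRegularAt, krylov_intertwine h1, Matrix.det_mul, ← RingHom.map_det, g.2, map_one, one_mul]
  exact hv

theorem mem_coadjointOrbit_of_isRegularAt {N : ℕ} (hN : 1 ≤ N) {x y : PhaseSpace N}
    {v w : Fin 3 → ℂ} (hv : IsRegularAt N x v) (hw : IsRegularAt N y w)
    (h2 : (redP N (laxP N x) ^ 2).trace = (redP N (laxP N y) ^ 2).trace)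
    (h3 : (redP N (laxP N x) ^ 3).trace = (redP N (laxP N y) ^ 3).trace) :
    y ∈ coadjointOrbit N x := by
  have hv' := isUnit_det_laxKrylov hv
  have hw' := isUnit_det_laxKrylov hw
  refine mem_coadjointOrbit_of_isUnit_det hN (G := laxKrylov N y w * (laxKrylov N x v)⁻¹) ?_ ?_
  · rw [Matrix.det_mul]
    exact hw'.mul (Matrix.isUnit_nonsing_inv_det _ hv')
  · have hu := isUnit_det_red (N := N) hv'
    rw [map_mul, red_inv hv']
    rw [red_laxKrylov] at hu
    rw [red_laxKrylov, red_laxKrylov]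
    exact conj_of_krylov (trace_redP_laxP N x) (trace_redP_laxP N y) h2 h3 hu

/-- The Casimirs: the coefficients of `z ^ n`, `n < N`, in the invariants of the Lax matrix. -/
def casimir (N : ℕ) (x : PhaseSpace N) (k : Fin N ⊕ Fin N) : ℂ :=
  Sum.elim (fun n : Fin N => quadInv N n x) (fun n => cubInv N n x) k

theorem analyticOnNhd_casimir (N : ℕ) : AnalyticOnNhd ℂ (casimir N) Set.univ := by
  intro x hx
  rw [analyticAt_pi_iff]
  rintro (n | n)
  · exact analyticOnNhd_quadInv N n x hx
  · exact analyticOnNhd_cubInv N n x hx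

theorem fderiv_casimir (N : ℕ) (x v : PhaseSpace N) :
    fderiv ℂ (casimir N) x v = dCasimir N x v := by
  have h : ∀ k, DifferentiableAt ℂ (fun x => casimir N x k) x := by
    rintro (n | n)
    · exact (analyticOnNhd_quadInv N n x trivial).differentiableAt
    · exact (analyticOnNhd_cubInv N n x trivial).differentiableAt
  have h2 : fderiv ℂ (casimir N) x = ContinuousLinearMap.pi fun k =>
      fderiv ℂ (fun x => casimir N x k) x := fderiv_pi h
  rw [h2]
  funext k
  rw [ContinuousLinearMap.pi_apply]
  cases k with
  | inl n => exact fderiv_quadInv N n x v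
  | inr n => exact fderiv_cubInv N n x v

theorem casimir_eq_iff {N : ℕ} {x y : PhaseSpace N} : casimir N x = casimir N y ↔
    (redP N (laxP N x) ^ 2).trace = (redP N (laxP N y) ^ 2).trace ∧
      (redP N (laxP N x) ^ 3).trace = (redP N (laxP N y) ^ 3).trace := by
  simp only [← map_pow, trace_redP, trunc_eq_iff, Polynomial.coeff_coe]
  rw [funext_iff, Sum.forall]
  refine and_congr ⟨fun h n hn => ?_, fun h n => ?_⟩ ⟨fun h n hn => ?_, fun h n => ?_⟩
  · exact mul_left_cancel₀ (by norm_num) (h ⟨n, hn⟩)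
  · exact congrArg ((1 / 2 : ℂ) * ·) (h n n.2)
  · exact mul_left_cancel₀ (by norm_num) (h ⟨n, hn⟩)
  · exact congrArg ((1 / 3 : ℂ) * ·) (h n n.2)

theorem casimir_eq_of_mem_coadjointOrbit {N : ℕ} (hN : 1 ≤ N) {x y : PhaseSpace N}
    (h : y ∈ coadjointOrbit N x) : casimir N y = casimir N x :=
  casimir_eq_iff.2 ⟨trace_pow_of_mem_coadjointOrbit hN h 2, trace_pow_of_mem_coadjointOrbit hN h 3⟩

/-- Regularity of `y` is essential: a level set of the Casimirs may contain points that are not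
regular, and these lie on other orbits. -/
theorem mem_coadjointOrbit_iff_casimir {N : ℕ} (hN : 1 ≤ N) {x y : PhaseSpace N}
    {v w : Fin 3 → ℂ} (hv : IsRegularAt N x v) (hw : IsRegularAt N y w) :
    y ∈ coadjointOrbit N x ↔ casimir N y = casimir N x := by
  refine ⟨casimir_eq_of_mem_coadjointOrbit hN, fun h => ?_⟩
  obtain ⟨h2, h3⟩ := casimir_eq_iff.1 h
  exact mem_coadjointOrbit_of_isRegularAt hN hv hw h2.symm h3.symm

theorem isOpen_isRegularAt (N : ℕ) (v : Fin 3 → ℂ) : IsOpen {x | IsRegularAt N x v} := by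
  refine isOpen_ne_fun (Continuous.matrix_det ?_) continuous_const
  have h1 : Continuous fun x => coeffMat 0 (laxP N x) := by
    simp only [laxP, map_add]
    exact continuous_const.add (coeffMat 0 ∘ₗ dirn N).continuous_of_finiteDimensional
  exact continuous_matrix fun i j =>
    (continuous_apply i).comp ((h1.pow j).matrix_mulVec continuous_const)

theorem isComplexSubmanifold_coadjointOrbit {N : ℕ} (hN : 1 ≤ N) {x : PhaseSpace N}
    {v : Fin 3 → ℂ} (hv : IsRegularAt N x v) :
    IsComplexSubmanifold (coadjointOrbit N x) (2 * (3 * N)) := by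
  intro p hp
  obtain ⟨w, hw⟩ := exists_isRegularAt_of_mem_coadjointOrbit hN hp hv
  let e := LinearEquiv.funCongrLeft ℂ ℂ (finSumFinEquiv (m := N) (n := N)).symm
  let e' := e.toContinuousLinearEquiv
  refine ⟨N + N, {y | IsRegularAt N y w}, fun y => e' (casimir N y - casimir N x), ?_,
    isOpen_isRegularAt N w, hw, ?_, ?_, ?_⟩
  · simp
    omega
  · intro y _
    exact (e'.analyticAt _).comp ((analyticOnNhd_casimir N y trivial).sub analyticAt_const)
  · intro y hy
    rw [mem_coadjointOrbit_iff_casimir hN hv hy, map_eq_zero_iff e' e'.injective, sub_eq_zero]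
  · intro y hy _
    have h1 : HasFDerivAt (fun y => e' (casimir N y - casimir N x))
        ((e' : _ →L[ℂ] _).comp (fderiv ℂ (casimir N) y)) y :=
      e'.hasFDerivAt.comp y
        ((analyticOnNhd_casimir N y trivial).differentiableAt.hasFDerivAt.sub_const _)
    rw [h1.fderiv]
    refine e'.surjective.comp fun α => ?_
    obtain ⟨u, hu⟩ := dCasimir_surjective hy α
    exact ⟨u, (fderiv_casimir N y u).trans hu⟩

/-- Every vector in the kernel of the differentials of the Casimirs is the velocity of a curve in
the orbit. -/
theorem exists_curve_coadjointOrbit {N : ℕ} (hN : 1 ≤ N) {x : PhaseSpace N}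
    {v : Fin 3 → ℂ} (hv : IsRegularAt N x v) {p : PhaseSpace N} (hp : p ∈ coadjointOrbit N x)
    {u : PhaseSpace N} (hu : dCasimir N p u = 0) :
    ∃ γ : ℂ → PhaseSpace N, γ 0 = p ∧ (∀ᶠ t in 𝓝 (0 : ℂ), γ t ∈ coadjointOrbit N x) ∧
      HasDerivAt γ u 0 := by
  obtain ⟨w, hw⟩ := exists_isRegularAt_of_mem_coadjointOrbit hN hp hv
  have hf := (analyticOnNhd_casimir N p trivial).hasStrictFDerivAt
  set f' := fderiv ℂ (casimir N) p with hf'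
  have hr : f'.range = ⊤ := by
    refine LinearMap.range_eq_top.2 fun α => ?_
    obtain ⟨u, hu⟩ := dCasimir_surjective hw α
    exact ⟨u, (fderiv_casimir N p u).trans hu⟩
  have huk : u ∈ f'.ker := (fderiv_casimir N p u).trans hu
  -- The implicit function parametrizes the level set of the Casimirs through `p` by the kernel of
  -- their differential; the curve is the image of the line spanned by `u`.
  let φ := hf.implicitFunction (casimir N) f' hr (casimir N p)
  have hφ : HasFDerivAt φ f'.ker.subtypeL 0 := (hf.to_implicitFunction hr).hasFDerivAt
  have hlin : HasDerivAt (fun t : ℂ => t • (⟨u, huk⟩ : f'.ker)) ⟨u, huk⟩ 0 := by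
    simpa using (hasDerivAt_id (0 : ℂ)).smul_const (⟨u, huk⟩ : f'.ker)
  have hγ : HasDerivAt (fun t : ℂ => φ (t • (⟨u, huk⟩ : f'.ker))) u 0 := by
    have := HasFDerivAt.comp_hasDerivAt_of_eq (0 : ℂ) hφ hlin (by simp)
    exact this
  have h0 : φ 0 = p := hf.implicitFunction_apply_image hr
  have h0' : (fun t : ℂ => φ (t • (⟨u, huk⟩ : f'.ker))) 0 = p := by
    simp only [zero_smul, h0]
  refine ⟨fun t => φ (t • (⟨u, huk⟩ : f'.ker)), h0', ?_, hγ⟩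
  have h3 : Filter.Tendsto (fun t : ℂ => (casimir N p, t • (⟨u, huk⟩ : f'.ker))) (𝓝 0)
      (𝓝 (casimir N p, 0)) := by
    refine Filter.Tendsto.prodMk_nhds tendsto_const_nhds ?_
    have := hlin.continuousAt.tendsto
    rwa [zero_smul] at this
  have h4 := h3.eventually (hf.map_implicitFunction_eq hr)
  -- Regularity is an open condition, so the nearby points of the level set do lie on the orbit.
  have h5 : ∀ᶠ t : ℂ in 𝓝 0, IsRegularAt N (φ (t • (⟨u, huk⟩ : f'.ker))) w := by
    refine hγ.continuousAt.eventually_mem ((isOpen_isRegularAt N w).mem_nhds ?_)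
    exact (congrArg (IsRegularAt N · w) h0').mpr hw
  filter_upwards [h4, h5] with t ht1 ht2
  rw [mem_coadjointOrbit_iff_casimir hN hv ht2]
  exact ht1.trans (casimir_eq_of_mem_coadjointOrbit hN hp)

theorem tangentSpace_coadjointOrbit {N : ℕ} (hN : 1 ≤ N) {x : PhaseSpace N}
    {v : Fin 3 → ℂ} (hv : IsRegularAt N x v) {p : PhaseSpace N} (hp : p ∈ coadjointOrbit N x) :
    tangentSpace (coadjointOrbit N x) p = hamiltonianDirections (liePoisson N) p := by
  obtain ⟨w, hw⟩ := exists_isRegularAt_of_mem_coadjointOrbit hN hp hv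
  rw [hamiltonianDirections_eq_ker hN hw]
  refine le_antisymm (Submodule.span_le.2 ?_) fun u hu => Submodule.subset_span
    (exists_curve_coadjointOrbit hN hv hp hu)
  rintro u ⟨γ, h0, hγ, hd⟩
  have h1 := (analyticOnNhd_casimir N p trivial).differentiableAt.hasFDerivAt
  have h2 := HasFDerivAt.comp_hasDerivAt_of_eq (0 : ℂ) h1 hd h0.symm
  have h3 : casimir N ∘ γ =ᶠ[𝓝 0] fun _ => casimir N x := by
    filter_upwards [hγ] with t ht using casimir_eq_of_mem_coadjointOrbit hN ht
  have h4 := (h2.congr_of_eventuallyEq h3.symm).unique (hasDerivAt_const (0 : ℂ) (casimir N x))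
  exact (fderiv_casimir N p u).symm.trans h4

/-! ### Matrices without a cyclic vector -/

section NoCyclicVector

variable (A : Matrix (Fin 3) (Fin 3) ℂ)

/-- The complex numbers which are eigenvalues. -/
def eigSet : Set ℂ := {μ | ∃ v ≠ 0, A.mulVec v = μ • v}

theorem finite_eigSet : (eigSet A).Finite := by
  refine (Module.End.finite_hasEigenvalue A.mulVecLin).subset ?_
  rintro μ ⟨v, hv, h⟩
  exact Module.End.hasEigenvalue_of_hasEigenvector
    ⟨Module.End.mem_eigenspace_iff.2 h, hv⟩

theorem nonempty_eigSet : (eigSet A).Nonempty := by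
  obtain ⟨μ, hμ⟩ := Module.End.exists_eigenvalue A.mulVecLin
  obtain ⟨v, hv⟩ := hμ.exists_hasEigenvector
  exact ⟨μ, v, hv.2, Module.End.mem_eigenspace_iff.1 hv.1⟩

variable {A}

theorem sub_smul_one_mulVec (μ : ℂ) (v : Fin 3 → ℂ) :
    (A - μ • 1).mulVec v = A.mulVec v - μ • v := by
  rw [Matrix.sub_mulVec, Matrix.smul_mulVec, Matrix.one_mulVec]

theorem sub_smul_one_comm (μ ν : ℂ) :
    (A - μ • 1) * (A - ν • 1) = (A - ν • 1) * (A - μ • 1) := by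
  simp only [sub_mul, mul_sub, Matrix.mul_smul, Matrix.smul_mul, mul_one, one_mul, smul_smul,
    mul_comm μ ν]
  abel

/-- Taking the roots among the eigenvalues of `A` leaves finitely many quadratic polynomials, as the
covering argument requires. -/
theorem exists_eigSet_of_mulVec_eq_zero {v : Fin 3 → ℂ} (hv : v ≠ 0) {μ ν : ℂ}
    (h : ((A - μ • 1) * (A - ν • 1)).mulVec v = 0) :
    ∃ κ ∈ eigSet A, ∃ κ' ∈ eigSet A, ((A - κ • 1) * (A - κ' • 1)).mulVec v = 0 := by
  have key : ∀ κ : ℂ, (A - κ • 1).mulVec v = 0 → κ ∈ eigSet A := fun κ hκ =>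
    ⟨v, hv, by rwa [sub_smul_one_mulVec, sub_eq_zero] at hκ⟩
  have key2 : ∀ κ κ' : ℂ, (A - κ' • 1).mulVec v ≠ 0 →
      ((A - κ • 1) * (A - κ' • 1)).mulVec v = 0 → κ ∈ eigSet A := by
    intro κ κ' h1 h2
    rw [← Matrix.mulVec_mulVec, sub_smul_one_mulVec, sub_eq_zero] at h2
    exact ⟨_, h1, h2⟩
  by_cases h1 : (A - ν • 1).mulVec v = 0
  · exact ⟨ν, key ν h1, ν, key ν h1, by rw [← Matrix.mulVec_mulVec, h1, Matrix.mulVec_zero]⟩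
  by_cases h2 : (A - μ • 1).mulVec v = 0
  · exact ⟨μ, key μ h2, μ, key μ h2, by rw [← Matrix.mulVec_mulVec, h2, Matrix.mulVec_zero]⟩
  · exact ⟨μ, key2 _ _ h1 h, ν, key2 _ _ h2 (by rwa [sub_smul_one_comm]), h⟩

theorem exists_mulVec_eq_zero_of_krylov {v : Fin 3 → ℂ} (hv : v ≠ 0)
    (h : (krylov A v).det = 0) : ∃ μ ν : ℂ, ((A - μ • 1) * (A - ν • 1)).mulVec v = 0 := by
  obtain ⟨c, hc, h⟩ := Matrix.exists_mulVec_eq_zero_iff.2 h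
  rw [krylov_mulVec] at h
  by_cases h2 : c 2 = 0
  · rw [h2, zero_smul, add_zero] at h
    have h1 : c 1 ≠ 0 := by
      intro h1
      rw [h1, zero_smul, add_zero, Matrix.smul_mulVec, Matrix.one_mulVec,
        smul_eq_zero_iff_left hv] at h
      refine hc (funext fun i => ?_)
      fin_cases i
      · exact h
      · exact h1
      · exact h2
    refine ⟨0, -(c 0 / c 1), ?_⟩
    have h3 : (A - (-(c 0 / c 1)) • 1) = (c 1)⁻¹ • (c 0 • 1 + c 1 • A) := by
      rw [smul_add, smul_smul, smul_smul, inv_mul_cancel₀ h1, one_smul, neg_smul, sub_neg_eq_add,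
        add_comm, div_eq_inv_mul]
    rw [← Matrix.mulVec_mulVec, h3, Matrix.smul_mulVec, h, smul_zero, Matrix.mulVec_zero]
  · obtain ⟨s, hs⟩ := IsAlgClosed.exists_pow_nat_eq (c 1 ^ 2 - 4 * c 2 * c 0) (n := 2) (by norm_num)
    refine ⟨(-c 1 + s) / (2 * c 2), (-c 1 - s) / (2 * c 2), ?_⟩
    have h3 : (A - ((-c 1 + s) / (2 * c 2)) • 1) * (A - ((-c 1 - s) / (2 * c 2)) • 1) =
        (c 2)⁻¹ • (c 0 • 1 + c 1 • A + c 2 • A ^ 2) := by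
      have h4 : (-c 1 + s) / (2 * c 2) + (-c 1 - s) / (2 * c 2) = - ((c 2)⁻¹ * c 1) := by
        field_simp
        ring
      have h5 : (-c 1 - s) / (2 * c 2) * ((-c 1 + s) / (2 * c 2)) = (c 2)⁻¹ * c 0 := by
        field_simp
        linear_combination -hs
      simp only [sub_mul, mul_sub, Matrix.mul_smul, Matrix.smul_mul, mul_one, one_mul, smul_add,
        smul_smul, h5, inv_mul_cancel₀ h2, one_smul, ← pow_two]
      have h6 : (c 2)⁻¹ * c 1 = -((-c 1 + s) / (2 * c 2) + (-c 1 - s) / (2 * c 2)) := by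
        rw [h4, neg_neg]
      rw [h6, neg_smul, add_smul]
      abel
    rw [h3, Matrix.smul_mulVec, h, smul_zero]

/-- Every vector is killed by one of finitely many quadratic polynomials in `A`. A vector space over
an infinite field is not a finite union of proper subspaces, so one of these polynomials kills all
vectors. -/
theorem exists_mul_eq_zero_of_forall_krylov (h : ∀ v, (krylov A v).det = 0) :
    ∃ μ ν : ℂ, (A - μ • 1) * (A - ν • 1) = 0 := by
  have := (finite_eigSet A).to_subtype
  let p : eigSet A × eigSet A → Subspace ℂ (Fin 3 → ℂ) := fun q =>
    LinearMap.ker ((A - (q.1 : ℂ) • 1) * (A - (q.2 : ℂ) • 1)).mulVecLin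
  have hcov : ⋃ q, (p q : Set (Fin 3 → ℂ)) = Set.univ := by
    refine Set.eq_univ_of_forall fun v => Set.mem_iUnion.2 ?_
    by_cases hv : v = 0
    · obtain ⟨μ, hμ⟩ := nonempty_eigSet A
      exact ⟨(⟨μ, hμ⟩, ⟨μ, hμ⟩), by rw [hv]; exact (p _).zero_mem⟩
    · obtain ⟨μ, ν, h1⟩ := exists_mulVec_eq_zero_of_krylov hv (h v)
      obtain ⟨κ, hκ, κ', hκ', h2⟩ := exists_eigSet_of_mulVec_eq_zero hv h1
      exact ⟨(⟨κ, hκ⟩, ⟨κ', hκ'⟩), h2⟩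
  obtain ⟨q, hq⟩ := Subspace.exists_eq_top_of_iUnion_eq_univ hcov
  refine ⟨q.1, q.2, ?_⟩
  have h1 := LinearMap.ker_eq_top.1 hq
  rw [← Matrix.mulVecLin_zero] at h1
  exact Matrix.mulVec_injective (funext fun v => LinearMap.congr_fun h1 v)

/-- A matrix without cyclic vector differs from a scalar by a matrix of rank at most one. -/
theorem exists_eq_smul_one_add_vecMulVec (h : ∀ v, (krylov A v).det = 0) :
    ∃ (μ : ℂ) (u w : Fin 3 → ℂ), u ≠ 0 ∧ A = μ • 1 + Matrix.vecMulVec u w := by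
  obtain ⟨μ, ν, hμν⟩ := exists_mul_eq_zero_of_forall_krylov h
  -- The image of `A - ν` lies in the kernel of `A - μ`; in dimension three, one of the two matrices
  -- therefore has rank at most one.
  have key : ∃ κ : ℂ, Module.finrank ℂ (LinearMap.range (A - κ • 1).mulVecLin) ≤ 1 := by
    by_cases h1 : Module.finrank ℂ (LinearMap.range (A - μ • 1).mulVecLin) ≤ 1
    · exact ⟨μ, h1⟩
    · refine ⟨ν, ?_⟩
      have h2 := LinearMap.finrank_range_add_finrank_ker (A - μ • 1).mulVecLin
      rw [Module.finrank_fin_fun] at h2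
      have h3 : LinearMap.range (A - ν • 1).mulVecLin ≤ LinearMap.ker (A - μ • 1).mulVecLin := by
        rintro _ ⟨v, rfl⟩
        rw [LinearMap.mem_ker, Matrix.mulVecLin_apply, Matrix.mulVecLin_apply,
          Matrix.mulVec_mulVec, hμν, Matrix.zero_mulVec]
      have h4 := Submodule.finrank_mono h3
      omega
  obtain ⟨κ, hκ⟩ := key
  obtain ⟨u, hu⟩ := finrank_le_one_iff.1 hκ
  have hcol : ∀ j, ∃ c : ℂ, c • (u : Fin 3 → ℂ) = (A - κ • 1).mulVec (Pi.single j 1) := by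
    intro j
    obtain ⟨c, hc⟩ := hu ⟨_, LinearMap.mem_range_self _ (Pi.single j 1)⟩
    exact ⟨c, congrArg Subtype.val hc⟩
  choose w hw using hcol
  have hA : A = κ • 1 + Matrix.vecMulVec (u : Fin 3 → ℂ) w := by
    rw [← sub_eq_iff_eq_add']
    ext i j
    have := congrFun (hw j) i
    rw [Matrix.mulVec_single_one] at this
    rw [Matrix.vecMulVec_apply, mul_comm]
    exact this.symm
  -- If `A` is scalar the generator may vanish, and any nonzero `u` with `w = 0` serves; `u ≠ 0` is
  -- needed to lose a dimension in the next result.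
  by_cases hu0 : (u : Fin 3 → ℂ) = 0
  · refine ⟨κ, 1, 0, one_ne_zero, ?_⟩
    rw [hu0] at hA
    simpa using hA
  · exact ⟨κ, u, w, hu0, hA⟩

/-- The commutators with a matrix without cyclic vector form a space of dimension at most five. -/
theorem finrank_commutator_le (h : ∀ v, (krylov A v).det = 0) :
    ∃ T : Submodule ℂ (Matrix (Fin 3) (Fin 3) ℂ), Module.finrank ℂ T ≤ 5 ∧
      ∀ Y, Y * A - A * Y ∈ T := by
  obtain ⟨μ, u, w, hu, rfl⟩ := exists_eq_smul_one_add_vecMulVec h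
  let f : ((Fin 3 → ℂ) × (Fin 3 → ℂ)) →ₗ[ℂ] Matrix (Fin 3) (Fin 3) ℂ :=
    { toFun := fun p => Matrix.vecMulVec p.1 w - Matrix.vecMulVec u p.2
      map_add' := by
        intro p q
        simp only [Prod.fst_add, Prod.snd_add, Matrix.add_vecMulVec, Matrix.vecMulVec_add]
        abel
      map_smul' := by
        intro r p
        simp only [Prod.smul_fst, Prod.smul_snd, Matrix.smul_vecMulVec, Matrix.vecMulVec_smul,
          smul_sub, RingHom.id_apply] }
  refine ⟨LinearMap.range f, ?_, fun Y => ⟨(Y.mulVec u, Matrix.vecMul w Y), ?_⟩⟩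
  · have h1 := LinearMap.finrank_range_add_finrank_ker f
    -- The pair `(u, w)` is a nonzero element of the kernel, so the six-dimensional source has image
    -- of dimension at most five.
    have h2 : 0 < Module.finrank ℂ (LinearMap.ker f) := by
      refine Module.finrank_pos_iff_exists_ne_zero.2 ⟨⟨(u, w), ?_⟩, fun h0 => hu ?_⟩
      · exact sub_self _
      · exact congrArg (fun p => (p : LinearMap.ker f).1.1) h0
    simp at h1
    omega
  · change Matrix.vecMulVec (Y.mulVec u) w - Matrix.vecMulVec u (Matrix.vecMul w Y) = _
    rw [mul_add, add_mul, Matrix.mul_vecMulVec, Matrix.vecMulVec_mul, Matrix.mul_smul,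
      Matrix.smul_mul, mul_one, one_mul]
    abel

end NoCyclicVector

/-! ### Orbits of maximal dimension are regular -/

/-- Along the complex line from `y` to a point of the Weyl chamber the Krylov determinant is a
polynomial in the parameter, nonzero at `t = 1`, so its zeros are isolated. -/
theorem exists_isRegularAt_near {N : ℕ} (hN : 1 ≤ N) (y : PhaseSpace N) {O : Set (PhaseSpace N)}
    (hO : IsOpen O) (hy : y ∈ O) : ∃ z ∈ O, ∃ v, IsRegularAt N z v := by
  let x : PhaseSpace N := fun i => if i.1 = 0 ∨ i.1 = 1 then 1 else 0
  have hx : x ∈ weylChamber N := by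
    refine ⟨fun a l h0 h1 => if_neg (by simp [h0, h1]), fun l _ => ?_⟩
    simp only [x, true_or, or_true, if_true]
    norm_num
  have hreg := isRegularAt_of_mem_weylChamber hN hx
  set A := coeffMat 0 (laxP N y)
  set B := coeffMat 0 (laxP N x)
  set v : Fin 3 → ℂ := ![1, 1, 1]
  let P : Matrix (Fin 3) (Fin 3) ℂ[X] := A.map Polynomial.C +
    (Polynomial.X : ℂ[X]) • (B - A).map Polynomial.C
  let p : ℂ[X] := (krylov P (Polynomial.C ∘ v)).det
  have hp : ∀ t : ℂ, p.eval t = (krylov (A + t • (B - A)) v).det := by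
    intro t
    change Polynomial.evalRingHom t p = _
    rw [RingHom.map_det, map_krylov]
    congr 2
    · ext i j
      simp [P]
    · funext i
      simp
  have hp0 : p ≠ 0 := by
    intro h0
    have := hp 1
    rw [h0, one_smul, add_sub_cancel, Polynomial.eval_zero] at this
    exact hreg this.symm
  have hd : Dense {t : ℂ | p.eval t ≠ 0} := by
    have h1 : {t : ℂ | p.eval t = 0}.Countable :=
      ((Polynomial.finite_setOfPred_isRoot hp0).subset fun t ht => ht).countable
    exact h1.dense_compl ℂ
  have hcont : Continuous fun t : ℂ => y + t • (x - y) := by fun_prop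
  obtain ⟨t, ht, ht2⟩ := hd.inter_open_nonempty _ (hO.preimage hcont) ⟨0, by simpa using hy⟩
  refine ⟨y + t • (x - y), ht, v, ?_⟩
  have h2 : coeffMat 0 (laxP N (y + t • (x - y))) = A + t • (B - A) := by
    simp only [A, B, laxP, map_add, map_smul, map_sub]
    rw [← add_assoc, add_sub_add_left_eq_sub]
  rw [IsRegularAt, h2, ← hp]
  exact ht2

theorem continuous_liePoisson {N : ℕ} (hN : 1 ≤ N) : Continuous (liePoisson N) := by
  refine continuous_matrix fun i j => ?_
  obtain ⟨c, f, -, h⟩ := liePoisson_affine N hN i j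
  rw [h]
  exact continuous_const.add f.continuous

/-- Lower semicontinuity of the rank: `6N + 1` independent vectors in the range at `y` would persist
at nearby regular points, where the rank is `6N`. -/
theorem finrank_range_liePoisson_le {N : ℕ} (hN : 1 ≤ N) (y : PhaseSpace N) :
    orbitDim N y ≤ 6 * N := by
  by_contra! hlt
  obtain ⟨f, hf⟩ := exists_linearIndependent_of_le_finrank (show 6 * N + 1 ≤ orbitDim N y from hlt)
  have h1 : ∀ i, ∃ η, (liePoisson N y).mulVec η = f i := fun i => (f i).2
  choose η hη using h1
  have hO : IsOpen {z : PhaseSpace N | LinearIndependent ℂ fun i => (liePoisson N z).mulVec (η i)} := by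
    refine isOpen_setOfPred_linearIndependent.preimage ?_
    exact continuous_pi fun i => (continuous_liePoisson hN).matrix_mulVec continuous_const
  obtain ⟨z, hz, v, hv⟩ := exists_isRegularAt_near hN y hO (by
    have h2 := hf.map' _ (Submodule.ker_subtype _)
    rw [Set.mem_ofPred_eq, funext hη]
    exact h2)
  have h3 := orbitDim_of_isRegularAt hN hv
  have h4 : LinearIndependent ℂ fun i : Fin (6 * N + 1) =>
      (⟨(liePoisson N z).mulVec (η i), LinearMap.mem_range_self (liePoisson N z).mulVecLin (η i)⟩ :
        hamiltonianDirections (liePoisson N) z) :=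
    LinearIndependent.of_comp (Submodule.subtype _) hz
  have h5 := h4.fintype_card_le_finrank
  rw [Fintype.card_fin] at h5
  rw [orbitDim] at h3
  omega

/-- Elements of the loop algebra commuting with `F` modulo `z ^ M`. -/
def centralizerMod (M : ℕ) (F : PolyMat) : Submodule ℂ (PhaseSpace M) where
  carrier := {η | ∀ n < M, coeffMat n (alg M η * F - F * alg M η) = 0}
  add_mem' := by
    intro η ξ hη hξ n hn
    rw [map_add, add_mul, mul_add, add_sub_add_comm, map_add, hη n hn, hξ n hn, add_zero]
  zero_mem' := by
    intro n _
    rw [map_zero, zero_mul, mul_zero, sub_zero, map_zero]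
  smul_mem' := by
    intro c η hη n hn
    rw [map_smul, Matrix.smul_mul, Matrix.mul_smul, ← smul_sub, map_smul, hη n hn, smul_zero]

theorem mem_centralizerMod_iff {M : ℕ} {F : PolyMat} {η : PhaseSpace M} :
    η ∈ centralizerMod M F ↔ redP M (alg M η) * redP M F = redP M F * redP M (alg M η) := by
  rw [← map_mul, ← map_mul, ← sub_eq_zero, ← map_sub, redP_eq_zero_iff]
  rfl

theorem centralizerMod_laxP {M : ℕ} (hM : 1 ≤ M) (x : PhaseSpace M) :
    centralizerMod M (laxP M x) = LinearMap.ker (liePoisson M x).mulVecLin := by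
  ext η
  rw [LinearMap.mem_ker, Matrix.mulVecLin_apply, liePoisson_mulVec_eq_zero_iff M hM]
  rfl

theorem orbitDim_add_finrank_centralizerMod {M : ℕ} (hM : 1 ≤ M) (x : PhaseSpace M) :
    orbitDim M x + Module.finrank ℂ (centralizerMod M (laxP M x)) = 8 * M := by
  rw [centralizerMod_laxP hM]
  exact (LinearMap.finrank_range_add_finrank_ker (liePoisson M x).mulVecLin).trans (card_idx M)

/-- Modulo `z^M` any traceless `F` is the Lax matrix of a point of `PhaseSpace M`, so the bound on
the rank applies there. The truncation `M` is kept independent of `N` because `M = N + 1` will be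
needed. -/
theorem le_finrank_centralizerMod {M : ℕ} (hM : 1 ≤ M) {F : PolyMat} (hF : F.trace = 0) :
    2 * M ≤ Module.finrank ℂ (centralizerMod M F) := by
  obtain ⟨y, hy⟩ := exists_redP_dirn_eq (N := M) (M := redP M F)
    (by rw [trace_redP, hF, Polynomial.coe_zero, map_zero])
  rw [← redP_laxP] at hy
  have h1 : centralizerMod M F = centralizerMod M (laxP M y) := by
    ext η
    rw [mem_centralizerMod_iff, mem_centralizerMod_iff, hy]
  have h2 := orbitDim_add_finrank_centralizerMod hM y
  have h3 := finrank_range_liePoisson_le hM y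
  rw [h1]
  omega

/-- Leading coefficients of the elements commuting with `F` modulo `z ^ M`. -/
def leadingMod (M : ℕ) (F : PolyMat) : Submodule ℂ (Matrix (Fin 3) (Fin 3) ℂ) :=
  (centralizerMod M F).map (coeffMat 0 ∘ₗ alg M)

/-- Multiplication by `z` in the coordinates of the loop algebra. -/
def mulZ (M : ℕ) : PhaseSpace M →ₗ[ℂ] PhaseSpace (M + 1) where
  toFun η i := Fin.cons (α := fun _ => ℂ) 0 (fun l => η (i.1, l)) i.2
  map_add' η ξ := by
    funext ⟨a, l⟩
    cases l using Fin.cases <;> simp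
  map_smul' c η := by
    funext ⟨a, l⟩
    cases l using Fin.cases <;> simp

theorem mulZ_zero (M : ℕ) (η : PhaseSpace M) (a : Fin 8) : mulZ M η (a, 0) = 0 := rfl

theorem mulZ_succ (M : ℕ) (η : PhaseSpace M) (a : Fin 8) (l : Fin M) :
    mulZ M η (a, l.succ) = η (a, l) := rfl

theorem alg_mulZ (M : ℕ) (η : PhaseSpace M) :
    alg (M + 1) (mulZ M η) = (Polynomial.X : ℂ[X]) ^ 1 • alg M η := by
  refine polyMat_ext fun n => ?_
  cases n with
  | zero =>
    rw [coeffMat_X_pow_smul_of_lt 1 0 _ one_pos]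
    have h := coeffMat_alg (M + 1) (mulZ M η) 0
    rw [Fin.val_zero] at h
    rw [h]
    exact Finset.sum_eq_zero fun a _ => by rw [mulZ_zero, zero_smul]
  | succ n =>
    rw [coeffMat_X_pow_smul]
    by_cases hn : n < M
    · have h := coeffMat_alg (M + 1) (mulZ M η) (Fin.succ ⟨n, hn⟩)
      have h2 := coeffMat_alg M η ⟨n, hn⟩
      rw [Fin.val_succ] at h
      simp only [mulZ_succ] at h
      exact h.trans h2.symm
    · rw [coeffMat_alg_of_le _ _ _ (by omega), coeffMat_alg_of_le _ _ _ (by omega)]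

theorem mulZ_injective (M : ℕ) : Function.Injective (mulZ M) := by
  intro η ξ h
  funext ⟨a, l⟩
  exact congrFun h (a, l.succ)

theorem mulZ_mem_iff {M : ℕ} {F : PolyMat} {η : PhaseSpace M} :
    mulZ M η ∈ centralizerMod (M + 1) F ↔ η ∈ centralizerMod M F := by
  have h : alg (M + 1) (mulZ M η) * F - F * alg (M + 1) (mulZ M η) =
      (Polynomial.X : ℂ[X]) ^ 1 • (alg M η * F - F * alg M η) := by
    rw [alg_mulZ, Matrix.smul_mul, Matrix.mul_smul, smul_sub]
  change (∀ n < M + 1, coeffMat n (_ - _) = 0) ↔ ∀ n < M, coeffMat n (_ - _) = 0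
  rw [h]
  constructor
  · intro h1 n hn
    rw [← coeffMat_X_pow_smul 1 n]
    exact h1 _ (by omega)
  · intro h1 n hn
    cases n with
    | zero => exact coeffMat_X_pow_smul_of_lt 1 0 _ one_pos
    | succ n => rw [coeffMat_X_pow_smul]; exact h1 n (by omega)

theorem exists_mulZ_eq {M : ℕ} {η : PhaseSpace (M + 1)}
    (h : coeffMat 0 (alg (M + 1) η) = 0) : ∃ ξ, mulZ M ξ = η := by
  refine ⟨fun i => η (i.1, i.2.succ), ?_⟩
  have h1 := coeffMat_alg (M + 1) η 0
  rw [Fin.val_zero, h] at h1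
  funext ⟨a, l⟩
  cases l using Fin.cases with
  | zero =>
    rw [mulZ_zero, ← trace_sum_smul_X_mul_XDual (fun a => η (a, 0)) a, ← h1, zero_mul,
      Matrix.trace_zero]
  | succ l => rfl

/-- Rank–nullity for evaluation at `z = 0`: an element vanishing there is `z` times an element
commuting with `F` to one order less. -/
theorem finrank_centralizerMod_succ (M : ℕ) (F : PolyMat) :
    Module.finrank ℂ (centralizerMod (M + 1) F) =
      Module.finrank ℂ (leadingMod (M + 1) F) + Module.finrank ℂ (centralizerMod M F) := by
  let f := (coeffMat 0 ∘ₗ alg (M + 1)).domRestrict (centralizerMod (M + 1) F)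
  rw [← LinearMap.finrank_range_add_finrank_ker f]
  congr 1
  · rw [leadingMod, LinearMap.range_domRestrict]
  · let g : centralizerMod M F →ₗ[ℂ] centralizerMod (M + 1) F :=
      (mulZ M).restrict fun η hη => mulZ_mem_iff.2 hη
    have hg : Function.Injective g := fun η ξ h =>
      Subtype.ext (mulZ_injective M (congrArg Subtype.val h))
    rw [← LinearMap.finrank_range_of_inj hg]
    suffices hker : LinearMap.ker f = LinearMap.range g by rw [hker]
    ext η
    constructor
    · intro h
      obtain ⟨ξ, hξ⟩ := exists_mulZ_eq (M := M) (η := η) h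
      exact ⟨⟨ξ, mulZ_mem_iff.1 (hξ ▸ η.2)⟩, Subtype.ext hξ⟩
    · rintro ⟨ξ, rfl⟩
      change coeffMat 0 (alg (M + 1) (mulZ M ξ)) = 0
      rw [alg_mulZ, coeffMat_X_pow_smul_of_lt 1 0 _ one_pos]

theorem leadingMod_anti {M : ℕ} (hM : 1 ≤ M) (F : PolyMat) :
    leadingMod (M + 1) F ≤ leadingMod M F := by
  rintro _ ⟨η, hη, rfl⟩
  obtain ⟨ξ, hξ⟩ := exists_redP_alg_eq (N := M) (M := redP M (alg (M + 1) η))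
    (by rw [trace_redP, trace_alg, Polynomial.coe_zero, map_zero])
  refine ⟨ξ, ?_, redP_eq_iff.1 hξ 0 (by omega)⟩
  rw [SetLike.mem_coe, mem_centralizerMod_iff, hξ, ← map_mul, ← map_mul, ← sub_eq_zero, ← map_sub,
    redP_eq_zero_iff]
  exact fun n hn => hη n (by omega)

/-- Taking commutators with `F(0)` maps the eight-dimensional `sl(3)` into a space of dimension at
most five. -/
theorem le_finrank_leadingMod_one {F : PolyMat} (h : ∀ v, (krylov (coeffMat 0 F) v).det = 0) :
    3 ≤ Module.finrank ℂ (centralizerMod 1 F) := by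
  obtain ⟨T, hT, hY⟩ := finrank_commutator_le h
  let f : PhaseSpace 1 →ₗ[ℂ] T :=
    { toFun := fun η => ⟨coeffMat 0 (alg 1 η) * coeffMat 0 F - coeffMat 0 F * coeffMat 0 (alg 1 η),
        hY _⟩
      map_add' := by
        intro η ξ
        refine Subtype.ext ?_
        simp only [map_add, add_mul, mul_add, Submodule.coe_add]
        abel
      map_smul' := by
        intro c η
        refine Subtype.ext ?_
        simp only [map_smul, Matrix.smul_mul, Matrix.mul_smul, smul_sub, RingHom.id_apply,
          Submodule.coe_smul] }
  have h1 := LinearMap.finrank_range_add_finrank_ker f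
  have h2 := (LinearMap.range f).finrank_le
  have h3 : LinearMap.ker f ≤ centralizerMod 1 F := by
    intro η hη n hn
    obtain rfl : n = 0 := by omega
    rw [map_sub, coeffMat_mul, coeffMat_mul]
    have h5 : coeffMat 0 (alg 1 η) * coeffMat 0 F - coeffMat 0 F * coeffMat 0 (alg 1 η) = 0 :=
      congrArg Subtype.val (LinearMap.mem_ker.1 hη)
    simpa using h5
  have h4 := Submodule.finrank_mono h3
  rw [card_idx] at h1
  omega

/-- Orbits of dimension `6N` consist of regular elements. -/
theorem exists_isRegularAt_of_orbitDim {N : ℕ} (hN : 1 ≤ N) {x : PhaseSpace N}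
    (h : orbitDim N x = 6 * N) : ∃ v, IsRegularAt N x v := by
  by_contra! hx
  simp only [IsRegularAt, not_not] at hx
  set F := laxP N x with hF
  have h1 : Module.finrank ℂ (centralizerMod N F) = 2 * N := by
    have h2 := orbitDim_add_finrank_centralizerMod hN x
    rw [h, ← hF] at h2
    omega
  -- Going one order beyond `N`: the centralizer has dimension exactly `2N` modulo `z^N` but at
  -- least `2N + 2` modulo `z^{N+1}`. Since the spaces of leading coefficients shrink with the
  -- order, all earlier ones also have dimension at least two.
  have h2 : 2 ≤ Module.finrank ℂ (leadingMod (N + 1) F) := by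
    have h3 := le_finrank_centralizerMod (M := N + 1) (by omega) (trace_laxP N x)
    rw [finrank_centralizerMod_succ, ← hF, h1] at h3
    omega
  have h3 : ∀ j k, k + j = N + 1 → 1 ≤ k → 2 ≤ Module.finrank ℂ (leadingMod k F) := by
    intro j
    induction j with
    | zero =>
      rintro k hk -
      rw [add_zero] at hk
      rwa [hk]
    | succ j ih =>
      exact fun k hk hk1 => (ih (k + 1) (by omega) (by omega)).trans
        (Submodule.finrank_mono (leadingMod_anti hk1 F))
  -- Without a cyclic vector the count starts at `3` instead of `2` and grows by at least two at
  -- each order, which exceeds `2N` at `k = N`.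
  have h4 : ∀ k, 1 ≤ k → k ≤ N → 2 * k + 1 ≤ Module.finrank ℂ (centralizerMod k F) := by
    intro k hk
    induction k, hk using Nat.le_induction with
    | base => exact fun _ => le_finrank_leadingMod_one hx
    | succ k hk ih =>
      intro hk'
      rw [finrank_centralizerMod_succ]
      have := ih (by omega)
      have := h3 (N - k) (k + 1) (by omega) (by omega)
      omega
  have := h4 N hN le_rfl
  omega

/-! ### Independence of the hamiltonians at a point of each orbit -/

section SpecialMatrix

variable {R : Type*} [CommRing R]

/-- The form of the Lax matrix at the point where the independence is verified. -/
def specialMat (ζ c p q : R) : Matrix (Fin 3) (Fin 3) R := !![0, ζ, 1; c, 0, ζ; p, q, 0]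

theorem specialMat_sq (ζ c p q : R) : specialMat ζ c p q ^ 2 =
    !![ζ * c + p, q, ζ ^ 2; ζ * p, c * ζ + ζ * q, c; q * c, p * ζ, p + q * ζ] := by
  rw [specialMat, pow_two]
  ext i j
  fin_cases i <;> fin_cases j <;> simp [Matrix.mul_apply, Fin.sum_univ_three] <;> ring

theorem apply_of_eq_combination {ζ c p q α β γ : R} {Y : Matrix (Fin 3) (Fin 3) R}
    (h : Y = γ • 1 + α • specialMat ζ c p q + β • specialMat ζ c p q ^ 2) :
    Y 0 2 = α + β * ζ ^ 2 ∧ Y 1 2 = α * ζ + β * c := by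
  rw [h, specialMat_sq, specialMat]
  simp

theorem eq_zero_of_combination [IsDomain R] {ζ c p q α β γ : R} (hne : c - ζ ^ 3 ≠ 0)
    (h : γ • 1 + α • specialMat ζ c p q + β • specialMat ζ c p q ^ 2 = 0) : α = 0 ∧ β = 0 := by
  obtain ⟨h1, h2⟩ := apply_of_eq_combination h.symm
  rw [Matrix.zero_apply] at h1 h2
  have hβ : β = 0 := by
    refine (mul_eq_zero.1 (?_ : β * (c - ζ ^ 3) = 0)).resolve_right hne
    linear_combination ζ * h1 - h2
  rw [hβ] at h1
  exact ⟨by linear_combination -h1, hβ⟩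

theorem specialMat_commute_iff (ζ c p q : R) (Y : Matrix (Fin 3) (Fin 3) R)
    (h : Y * specialMat ζ c p q = specialMat ζ c p q * Y) :
    Y 0 1 * c + Y 0 2 * p = ζ * Y 1 0 + Y 2 0 ∧ Y 0 0 * ζ + Y 0 2 * q = ζ * Y 1 1 + Y 2 1 ∧
    Y 0 0 + Y 0 1 * ζ = ζ * Y 1 2 + Y 2 2 ∧ Y 1 1 * c + Y 1 2 * p = c * Y 0 0 + ζ * Y 2 0 ∧
    Y 1 0 * ζ + Y 1 2 * q = c * Y 0 1 + ζ * Y 2 1 ∧ Y 1 0 + Y 1 1 * ζ = c * Y 0 2 + ζ * Y 2 2 := by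
  have h' : ∀ i j, (Y * specialMat ζ c p q) i j = (specialMat ζ c p q * Y) i j := fun i j => by
    rw [h]
  have h00 := h' 0 0
  have h01 := h' 0 1
  have h02 := h' 0 2
  have h10 := h' 1 0
  have h11 := h' 1 1
  have h12 := h' 1 2
  simp only [Matrix.mul_apply, Fin.sum_univ_three, specialMat] at h00 h01 h02 h10 h11 h12
  simp at h00 h01 h02 h10 h11 h12
  exact ⟨h00, h01, h02, h10, h11, h12⟩

/-- The special matrix is nonderogatory at every point of the `z`-line. -/
theorem exists_combination_of_commute [IsDomain R] {ζ c p q u w : R}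
    (hu : u * (q - c) + w * (c - ζ ^ 3) = 1) (hne : c - ζ ^ 3 ≠ 0)
    {Y : Matrix (Fin 3) (Fin 3) R}
    (h : Y * specialMat ζ c p q = specialMat ζ c p q * Y) :
    ∃ α β γ : R, Y = γ • 1 + α • specialMat ζ c p q + β • specialMat ζ c p q ^ 2 := by
  obtain ⟨h00, h01, h02, h10, h11, h12⟩ := specialMat_commute_iff ζ c p q Y h
  -- The coefficient `β` must satisfy `e1` and `e2` below. Their compatibility is `key`, and the
  -- Bézout relation then produces `β` without division.
  set β := u * (Y 0 1 - Y 1 2) + w * (Y 1 2 - ζ * Y 0 2) with hβ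
  set α := Y 0 2 - β * ζ ^ 2 with hα
  set γ := Y 0 0 - β * (ζ * c + p) with hγ
  refine ⟨α, β, γ, ?_⟩
  have key : (Y 0 1 - Y 1 2) * (c - ζ ^ 3) = (Y 1 2 - ζ * Y 0 2) * (q - c) := by
    linear_combination ζ * h01 - ζ ^ 2 * h02 - h11 + ζ * h12
  have e1 : β * (q - c) = Y 0 1 - Y 1 2 := by
    rw [hβ]
    linear_combination (Y 0 1 - Y 1 2) * hu - w * key
  have e2 : β * (c - ζ ^ 3) = Y 1 2 - ζ * Y 0 2 := by
    rw [hβ]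
    linear_combination (Y 1 2 - ζ * Y 0 2) * hu + u * key
  -- The difference `Z` still commutes with the special matrix. Four of its entries vanish by the
  -- choice of `α`, `β`, `γ`, and the commutation equations force the other five to vanish.
  rw [← sub_eq_zero]
  have hcomm : ∀ Z, Z = Y - (γ • 1 + α • specialMat ζ c p q + β • specialMat ζ c p q ^ 2) →
      Z * specialMat ζ c p q = specialMat ζ c p q * Z := by
    rintro _ rfl
    rw [sub_mul, mul_sub, h]
    simp only [add_mul, mul_add, smul_mul_assoc, mul_smul_comm, one_mul, mul_one, ← pow_succ,
        ← pow_succ']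
  generalize hZ : Y - (γ • 1 + α • specialMat ζ c p q + β • specialMat ζ c p q ^ 2) = Z
  have hc := hcomm Z hZ.symm
  obtain ⟨z00, z01, z02, z10, z11, z12⟩ := specialMat_commute_iff ζ c p q Z hc
  have a00 : Z 0 0 = 0 := by
    rw [← hZ, specialMat_sq, specialMat]
    simp [hγ]
  have a02 : Z 0 2 = 0 := by
    rw [← hZ, specialMat_sq, specialMat]
    simp [hα]
  have a12 : Z 1 2 = 0 := by
    rw [← hZ, specialMat_sq, specialMat]
    simp [hα]
    linear_combination -e2
  have a01 : Z 0 1 = 0 := by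
    rw [← hZ, specialMat_sq, specialMat]
    simp [hα]
    linear_combination -e1 - e2
  have a22 : Z 2 2 = 0 := by linear_combination -z02 + a00 + ζ * a01 - ζ * a12
  have a11 : Z 1 1 = 0 := by
    refine (mul_eq_zero.1 (?_ : Z 1 1 * (c - ζ ^ 3) = 0)).resolve_right hne
    linear_combination z10 - ζ * z00 + ζ ^ 2 * z12 * (-1) + (-p) * a12 + c * a00 + ζ * c * a01 +
      ζ * p * a02 - ζ ^ 2 * c * a02 - ζ ^ 3 * a22
  have a10 : Z 1 0 = 0 := by linear_combination z12 - ζ * a11 + c * a02 + ζ * a22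
  have a21 : Z 2 1 = 0 := by linear_combination -z01 + ζ * a00 + q * a02 - ζ * a11
  have a20 : Z 2 0 = 0 := by linear_combination -z00 + c * a01 + p * a02 - ζ * a10
  ext i j
  fin_cases i <;> fin_cases j
  · exact a00
  · exact a01
  · exact a02
  · exact a10
  · exact a11
  · exact a12
  · exact a20
  · exact a21
  · exact a22

end SpecialMatrix

/-! ### Linear relations between the differentials of the hamiltonians at a special point. -/

theorem redP_smul (N : ℕ) (p : ℂ[X]) (F : PolyMat) :
    redP N (p • F) = trunc N (p : PowerSeries ℂ) • redP N F := by
  ext i j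
  change trunc N _ = trunc N _ * trunc N _
  rw [← map_mul, toSeries_apply, toSeries_apply, ← Polynomial.coe_mul]
  rfl

theorem exists_polynomial_trunc_eq {N : ℕ} (r : TruncRing N) :
    ∃ p : ℂ[X], trunc N (p : PowerSeries ℂ) = r := by
  obtain ⟨f, rfl⟩ := trunc_surjective N r
  refine ⟨PowerSeries.trunc N f, trunc_eq_iff.2 fun n hn => ?_⟩
  rw [Polynomial.coeff_coe, PowerSeries.coeff_trunc, if_pos hn]

/-- An element whose commutator with the Lax matrix is divisible by `z ^ (3N)` commutes with it,
provided that it belongs to the complementary subalgebra. -/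
theorem commutator_eq_zero_of_isNeg {N : ℕ} (hN : 1 ≤ N) {x : PhaseSpace N} {F T : PolyMat}
    (hF : IsNeg N F)
    (h : laxP N x * F - F * laxP N x = (Polynomial.X : ℂ[X]) ^ (3 * N) • T) : T = 0 := by
  refine polyMat_ext fun n => ?_
  rw [map_zero]
  by_cases hn : n < 2 * N
  -- `[Q, F]` pairs to zero with the complementary subalgebra, whose elements have arbitrary
  -- coefficients in degrees below `2N`; this detects every coefficient of `T` below `z^{2N}`.
  · have key : ∀ A, (coeffMat n T * A).trace = 0 := by
      intro A
      have h1 := trForm_commutator_eq_zero N hN x hF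
        (isNeg_negPart N hN (monP (2 * N - 1 - n) A))
      rw [← trForm_commutator, h, show 5 * N - 1 = 2 * N - 1 + 3 * N by omega,
        trForm_X_pow_smul, trForm_congr (F' := T) (G' := monP (2 * N - 1 - n) A) (fun _ _ => rfl)
          (fun m hm => coeffMat_negPart N m _ (by omega)), trForm_monP_right _ _ _ _ (by omega),
        show 2 * N - 1 - (2 * N - 1 - n) = n by omega] at h1
      exact h1
    refine Matrix.ext_iff_trace_mul_right.2 fun A => ?_
    rw [key, Matrix.zero_mul, Matrix.trace_zero]
  -- The remaining coefficients correspond to degrees at least `5N` in `[Q, F]`, whose degree is at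
  -- most `3N + 1`.
  · rw [← coeffMat_X_pow_smul (3 * N), ← h, map_sub,
      coeffMat_mul_eq_zero (coeffMat_laxP_of_lt N · x) hF.coeff_eq_zero (by omega),
      coeffMat_mul_eq_zero hF.coeff_eq_zero (coeffMat_laxP_of_lt N · x) (by omega), sub_self]

theorem sum_smul_hamMat (N : ℕ) (x : PhaseSpace N) (a : Fin N ⊕ Fin (2 * N) → ℂ) :
    ∑ k, a k • hamMat N x k =
      (∑ k : Fin N, Polynomial.monomial (N + k : ℕ) (a (Sum.inl k))) • laxP N x +
      (∑ k : Fin (2 * N), Polynomial.monomial (k : ℕ) (a (Sum.inr k))) • laxP N x ^ 2 := by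
  have h : ∀ (c : ℂ) (n : ℕ) (F : PolyMat),
      c • (Polynomial.X : ℂ[X]) ^ n • F = Polynomial.monomial n c • F := by
    intro c n F
    rw [← Polynomial.C_mul_X_pow_eq_monomial, ← smul_smul]
    ext1 i j
    simp [Polynomial.smul_eq_C_mul]
  rw [Fintype.sum_sum_type, Finset.sum_smul, Finset.sum_smul]
  congr 1
  · exact Finset.sum_congr rfl fun k _ => h _ _ _
  · exact Finset.sum_congr rfl fun k _ => h _ _ _

theorem coeff_sum_monomial {m : ℕ} (s : ℕ) (a : Fin m → ℂ) (n : ℕ) :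
    (∑ k : Fin m, Polynomial.monomial (s + k : ℕ) (a k)).coeff n =
      if h : s ≤ n ∧ n - s < m then a ⟨n - s, h.2⟩ else 0 := by
  rw [Polynomial.finsetSum_coeff]
  simp only [Polynomial.coeff_monomial]
  split_ifs with h
  · rw [Finset.sum_eq_single ⟨n - s, h.2⟩]
    · rw [if_pos (by simp; omega)]
    · intro b _ hb
      exact if_neg fun h' => hb (Fin.ext (by simp; omega))
    · simp
  · refine Finset.sum_eq_zero fun b _ => if_neg fun h' => h ⟨by omega, ?_⟩
    have := b.2
    omega

/-- By skew-symmetry, a covector that vanishes on the range of the tensor lies in its kernel. -/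
theorem grad_mulVec_eq_zero {N : ℕ} (hN : 1 ≤ N) {x : PhaseSpace N} {H : PolyMat}
    (h : ∀ η, trForm (3 * N - 1) H (dirn N ((liePoisson N x).mulVec η)) = 0) :
    (liePoisson N x).mulVec (grad N H) = 0 := by
  funext j
  have h1 := h (Pi.single j 1)
  rw [trForm_dirn] at h1
  rw [Pi.zero_apply, ← neg_eq_zero, ← h1, Matrix.mulVec, dotProduct, ← Finset.sum_neg_distrib]
  refine Finset.sum_congr rfl fun i _ => ?_
  rw [Matrix.mulVec_single_one, Matrix.col_apply, liePoisson_skew N hN x i j]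
  ring

theorem degree_lt_of_coeffMat {F : PolyMat} {m : ℕ} {i j : Fin 3}
    (h : ∀ n, m ≤ n → coeffMat n F i j = 0) : (F i j).degree < m :=
  (Polynomial.degree_lt_iff_coeff_zero _ _).2 h

theorem sub_commutator_eq {Q H F K G : PolyMat} {r t : ℂ[X]} (hH : Q * H = H * Q)
    (hK : Q * K = K * Q) (h : H = F + r • K + t • G) :
    Q * F - F * Q = t • (G * Q - Q * G) := by
  have e1 : F = H - r • K - t • G := by
    rw [h]
    abel
  rw [e1, mul_sub, mul_sub, sub_mul, sub_mul, hH, Matrix.mul_smul, hK, Matrix.smul_mul,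
    Matrix.mul_smul, Matrix.smul_mul, smul_sub]
  abel

theorem mul_combination (Q : PolyMat) (r s t : ℂ[X]) : Q * (r • 1 + s • Q + t • Q ^ 2) =
    (r • 1 + s • Q + t • Q ^ 2) * Q := by
  simp only [add_mul, mul_add, smul_mul_assoc, mul_smul_comm, one_mul, mul_one, ← pow_succ,
    ← pow_succ']

theorem exists_combination_of_krylov {R : Type*} [CommRing R] {Y Q : Matrix (Fin 3) (Fin 3) R}
    (h : Y * Q = Q * Y) {v : Fin 3 → R} (hv : IsUnit (krylov Q v).det) :
    ∃ c : Fin 3 → R, Y = c 0 • 1 + c 1 • Q + c 2 • Q ^ 2 :=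
  ⟨_, eq_of_commute_krylov h hv rfl⟩

theorem exists_combination_redP {N : ℕ} {Y Q : PolyMat}
    (h : redP N Y * redP N Q = redP N Q * redP N Y) {v : Fin 3 → TruncRing N}
    (hv : IsUnit (krylov (redP N Q) v).det) :
    ∃ g0 g1 g2 : ℂ[X], redP N Y = redP N (g0 • 1 + g1 • Q + g2 • Q ^ 2) := by
  obtain ⟨c, hc⟩ := exists_combination_of_krylov h hv
  obtain ⟨g0, h0⟩ := exists_polynomial_trunc_eq (c 0)
  obtain ⟨g1, h1⟩ := exists_polynomial_trunc_eq (c 1)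
  obtain ⟨g2, h2⟩ := exists_polynomial_trunc_eq (c 2)
  refine ⟨g0, g1, g2, hc.trans ?_⟩
  rw [map_add, map_add, redP_smul, redP_smul, redP_smul, h0, h1, h2, map_one, map_pow]

theorem eq_add_of_sub_eq_smul {N : ℕ} {H F Z Q G : PolyMat} {s g0 g1 g2 : ℂ[X]}
    (hZ : H - F = (Polynomial.X : ℂ[X]) ^ (2 * N) • Z)
    (hG : Z - s • 1 - (g0 • 1 + g1 • Q + g2 • Q ^ 2) = (Polynomial.X : ℂ[X]) ^ N • G) :
    H = F + (Polynomial.X : ℂ[X]) ^ (2 * N) • ((s + g0) • 1 + g1 • Q + g2 • Q ^ 2) +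
      (Polynomial.X : ℂ[X]) ^ (3 * N) • G := by
  rw [show 3 * N = 2 * N + N by ring, pow_add _ (2 * N) N, mul_smul, ← hG, add_assoc, ← smul_add,
    ← sub_eq_iff_eq_add', hZ]
  congr 1
  rw [add_smul]
  abel

/-- A matrix with gradient in the kernel of the Poisson tensor at a regular point is the sum of
elements of the complementary subalgebra, of `z^{2N}` times a polynomial in the Lax matrix, and
of terms of high order. -/
theorem exists_decomposition {N : ℕ} (hN : 1 ≤ N) {x : PhaseSpace N} {v : Fin 3 → ℂ}
    (hv : IsRegularAt N x v) {H : PolyMat} (h1 : (liePoisson N x).mulVec (grad N H) = 0) :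
    ∃ (g0 g1 g2 : ℂ[X]) (G : PolyMat), H = negPart N H + (Polynomial.X : ℂ[X]) ^ (2 * N) •
      (g0 • 1 + g1 • laxP N x + g2 • laxP N x ^ 2) + (Polynomial.X : ℂ[X]) ^ (3 * N) • G := by
  rw [liePoisson_mulVec_eq_zero_iff_commute N hN] at h1
  have hu := isUnit_det_red (N := N) (isUnit_det_laxKrylov hv)
  rw [red_laxKrylov] at hu
  obtain ⟨g0, g1, g2, h3⟩ := exists_combination_redP h1 hu
  rw [redP_eq_iff] at h3
  obtain ⟨Z, hZ⟩ := exists_sub_negPart_eq N H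
  obtain ⟨G, hG⟩ := exists_eq_X_pow_smul N (Z - (Polynomial.C (1 / 3) * Z.trace) • 1 -
    (g0 • 1 + g1 • laxP N x + g2 • laxP N x ^ 2))
    (fun m hm => by rw [map_sub, ← h3 m hm, coeffMat_alg_grad N m hm H Z hZ, sub_self])
  exact ⟨_, g1, g2, G, eq_add_of_sub_eq_smul hZ hG⟩

/-- Independence of the differentials of the hamiltonians along the orbit, at special points. -/
theorem eq_zero_of_sum_fderiv_hamiltonian {N : ℕ} (hN : 1 ≤ N) {x : PhaseSpace N} {v : Fin 3 → ℂ}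
    (hv : IsRegularAt N x v) {c p q : ℂ[X]}
    (hx : laxP N x = specialMat ((Polynomial.X : ℂ[X]) ^ N) c p q)
    (hc : c.degree < (3 * N : ℕ))
    (hcop : IsCoprime (q - c) (c - ((Polynomial.X : ℂ[X]) ^ N) ^ 3))
    {a : Fin N ⊕ Fin (2 * N) → ℂ} (ha : ∀ η, ∑ k, a k * fderiv ℂ (hamiltonian N k) x
      ((liePoisson N x).mulVec η) = 0) : a = 0 := by
  set ζ : ℂ[X] := (Polynomial.X : ℂ[X]) ^ N with hζ
  set Q := laxP N x with hQ
  set H := ∑ k, a k • hamMat N x k with hH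
  set A : ℂ[X] := ∑ k : Fin N, Polynomial.monomial (N + k : ℕ) (a (Sum.inl k)) with hA
  set B : ℂ[X] := ∑ k : Fin (2 * N), Polynomial.monomial (k : ℕ) (a (Sum.inr k)) with hB
  have hHAB : H = A • Q + B • Q ^ 2 := sum_smul_hamMat N x a
  have hdeg : (c - ζ ^ 3).degree = (3 * N : ℕ) := by
    rw [Polynomial.degree_sub_eq_right_of_degree_lt] <;>
      rw [hζ, ← pow_mul, Polynomial.degree_X_pow, mul_comm N 3]
    exact hc
  have hne : c - ζ ^ 3 ≠ 0 := by
    intro h0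
    rw [h0, Polynomial.degree_zero] at hdeg
    exact WithBot.natCast_ne_bot _ hdeg.symm
  obtain ⟨u, w, huw⟩ := hcop
  -- the gradient commutes with `Q` modulo `z ^ N`
  have h1 : (liePoisson N x).mulVec (grad N H) = 0 := by
    refine grad_mulVec_eq_zero hN fun η => ?_
    rw [← ha η, hH, map_sum, LinearMap.sum_apply]
    refine Finset.sum_congr rfl fun k _ => ?_
    rw [map_smul, LinearMap.smul_apply, fderiv_hamiltonian, smul_eq_mul]
  obtain ⟨g0, g1, g2, G, hdec⟩ := exists_decomposition hN hv h1
  rw [← hQ] at hdec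
  set F := negPart N H with hF
  have hneg : IsNeg N F := isNeg_negPart N hN H
  have hHQ : Q * H = H * Q := by
    rw [hHAB]
    have := mul_combination Q 0 A B
    rwa [zero_smul, zero_add] at this
  -- As `H` and polynomials in `Q` commute with `Q`, `[Q, F]` equals `z^{3N} [G, Q]`, which must
  -- vanish because `F` is complementary. Both `F` and `G` are then polynomials in `Q`.
  have hFG := sub_commutator_eq hHQ (mul_combination Q g0 g1 g2) hdec
  have hGQ := commutator_eq_zero_of_isNeg hN hneg hFG
  have hFQ : Q * F - F * Q = 0 := by rw [hFG, hGQ, smul_zero]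
  rw [sub_eq_zero] at hGQ hFQ
  rw [hx] at hGQ hFQ
  obtain ⟨α, β, γ, hFc⟩ := exists_combination_of_commute huw hne hFQ.symm
  obtain ⟨α', β', γ', hGc⟩ := exists_combination_of_commute huw hne hGQ
  obtain ⟨f02, f12⟩ := apply_of_eq_combination hFc
  -- The last column of `kappa` is zero, which improves the degree bound for these two entries of
  -- `F` to `< 2N`.
  have hcol : ∀ i : Fin 3, i = 0 ∨ i = 1 → ∀ n, 2 * N ≤ n → coeffMat n F i 2 = 0 := by
    intro i hi n hn
    rcases hn.eq_or_lt with rfl | hn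
    · rw [hneg.coeff_top, kappa]
      rcases hi with rfl | rfl <;> simp
    · rw [hneg.coeff_eq_zero n hn, Matrix.zero_apply]
  have d02 : (F 0 2).degree < (2 * N : ℕ) := degree_lt_of_coeffMat (hcol 0 (Or.inl rfl))
  have d12 : (F 1 2).degree < (2 * N : ℕ) := degree_lt_of_coeffMat (hcol 1 (Or.inr rfl))
  -- A nonzero `β` would give `β (c - ζ³)` degree at least `3N`, whereas this combination of entries
  -- of `F` has degree less than `3N`.
  have hβ : β = 0 := by
    by_contra hβ
    have e1 : β * (c - ζ ^ 3) = F 1 2 - ζ * F 0 2 := by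
      rw [f02, f12]
      ring
    have e2 : (F 1 2 - ζ * F 0 2).degree < (3 * N : ℕ) := by
      refine (Polynomial.degree_lt_iff_coeff_zero _ _).2 fun n hn => ?_
      rw [Polynomial.coeff_sub, hζ, Polynomial.coeff_X_pow_mul',
        Polynomial.coeff_eq_zero_of_degree_lt (d12.trans_le (by exact_mod_cast (by omega))),
        zero_sub, neg_eq_zero]
      split_ifs
      · exact Polynomial.coeff_eq_zero_of_degree_lt
          (d02.trans_le (by exact_mod_cast (by omega)))
      · rfl
    rw [← e1, Polynomial.degree_mul, hdeg, Polynomial.degree_eq_natDegree hβ] at e2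
    norm_cast at e2
    omega
  rw [hβ, zero_mul, add_zero] at f12
  have hα : ∀ n, N ≤ n → α.coeff n = 0 := by
    intro n hn
    have e1 := Polynomial.coeff_eq_zero_of_degree_lt (n := n + N)
      (d12.trans_le (by exact_mod_cast (by omega)))
    rwa [f12, hζ, Polynomial.coeff_mul_X_pow] at e1
  rw [← hx] at hFc hGc
  -- The coefficients of `Q` and `Q²` in `H` are compared. `A` has exponents from `N` to `2N - 1`
  -- and `B` from `0` to `2N - 1`, while the other terms have exponents below `N` (from `α`) or at
  -- least `2N`.
  have hfin := eq_zero_of_combination (α := A - α - (Polynomial.X : ℂ[X]) ^ (2 * N) * g1 -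
      (Polynomial.X : ℂ[X]) ^ (3 * N) * α') (β := B - (Polynomial.X : ℂ[X]) ^ (2 * N) * g2 -
      (Polynomial.X : ℂ[X]) ^ (3 * N) * β') (γ := - γ - (Polynomial.X : ℂ[X]) ^ (2 * N) * g0 -
      (Polynomial.X : ℂ[X]) ^ (3 * N) * γ') (p := p) (q := q) hne (by
    rw [← hx]
    have e1 : A • Q + B • Q ^ 2 - (F + (Polynomial.X : ℂ[X]) ^ (2 * N) •
        (g0 • 1 + g1 • Q + g2 • Q ^ 2) + (Polynomial.X : ℂ[X]) ^ (3 * N) • G) = 0 := by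
      rw [← hdec, hHAB, sub_self]
    rw [← e1, hFc, hGc, hβ]
    module)
  obtain ⟨hA0, hB0⟩ := hfin
  funext k
  cases k with
  | inl k =>
    have e1 := congrArg (fun r : ℂ[X] => r.coeff (N + k)) hA0
    simp only [Polynomial.coeff_sub, Polynomial.coeff_X_pow_mul', hA, coeff_sum_monomial,
      Polynomial.coeff_zero] at e1
    have := k.2
    rw [hα _ (by omega), if_neg (by omega), if_neg (by omega), dif_pos ⟨by omega, by omega⟩] at e1
    simpa using e1
  | inr k =>
    have e1 := congrArg (fun r : ℂ[X] => r.coeff k) hB0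
    have e2 := coeff_sum_monomial 0 (fun k => a (Sum.inr k)) k
    simp only [zero_add] at e2
    have := k.2
    simp only [Polynomial.coeff_sub, Polynomial.coeff_X_pow_mul', hB, e2,
      Polynomial.coeff_zero] at e1
    rw [if_neg (by omega), if_neg (by omega), dif_pos ⟨by omega, by omega⟩] at e1
    simpa using e1

/-- The polar part of the Lax matrix at the special point. -/
def specialPolar (c : ℂ) (p q : ℂ[X]) : PolyMat := !![0, 0, 1; Polynomial.C c, 0, 0; p, q, 0]

/-- For `c ≠ 0` the polynomials `p` and `q` prescribe all Casimirs, so every regular orbit meets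
this family, with `c` left free. -/
theorem specialPolar_traces (c : ℂ) (p q : ℂ[X]) : (specialPolar c p q).trace = 0 ∧
    (specialPolar c p q ^ 2).trace = 2 * p ∧
    (specialPolar c p q ^ 3).trace = 3 * (Polynomial.C c * q) := by
  refine ⟨?_, ?_, ?_⟩
  · simp [specialPolar, Matrix.trace_fin_three]
  · rw [pow_two, trace_mul_fin_three, specialPolar]
    simp
    ring
  · rw [pow_succ, pow_two, Matrix.trace_fin_three]
    simp [specialPolar, Matrix.mul_apply, Fin.sum_univ_three]
    ring

theorem coeffMat_specialPolar (c : ℂ) (p q : ℂ[X]) (n : ℕ) : coeffMat n (specialPolar c p q) =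
    !![0, 0, if n = 0 then 1 else 0; if n = 0 then c else 0, 0, 0; p.coeff n, q.coeff n, 0] := by
  ext i j
  rw [coeffMat_apply, specialPolar]
  fin_cases i <;> fin_cases j <;> simp [Polynomial.coeff_one, Polynomial.coeff_C]

/-- The Lax matrix of a point with the special polar part. -/
theorem laxP_eq_specialMat {N : ℕ} (hN : 1 ≤ N) {y : PhaseSpace N} {c : ℂ} {p q : ℂ[X]}
    (hp : ∀ n, N ≤ n → p.coeff n = 0) (hq : ∀ n, N ≤ n → q.coeff n = 0)
    (h : redP N (laxP N y) = redP N (specialPolar c p q)) {l : ℂ} (hl : l = if N = 1 then 1 else 0) :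
    laxP N y = specialMat ((Polynomial.X : ℂ[X]) ^ N)
      (Polynomial.C c + Polynomial.C l * (Polynomial.X : ℂ[X]) ^ N)
      (p + (Polynomial.X : ℂ[X]) ^ (N + 1))
      (q - Polynomial.C (2 * l) * (Polynomial.X : ℂ[X]) ^ N) := by
  have hspec : ∀ n, coeffMat n (specialMat ((Polynomial.X : ℂ[X]) ^ N)
      (Polynomial.C c + Polynomial.C l * (Polynomial.X : ℂ[X]) ^ N)
      (p + (Polynomial.X : ℂ[X]) ^ (N + 1))
      (q - Polynomial.C (2 * l) * (Polynomial.X : ℂ[X]) ^ N)) =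
      !![0, if n = N then 1 else 0, if n = 0 then 1 else 0;
        (if n = 0 then c else 0) + l * (if n = N then 1 else 0), 0, if n = N then 1 else 0;
        p.coeff n + (if n = N + 1 then 1 else 0),
        q.coeff n - 2 * l * (if n = N then 1 else 0), 0] := by
    intro n
    ext i j
    rw [coeffMat_apply, specialMat]
    have e1 : (Polynomial.C (2 * l) * (Polynomial.X : ℂ[X]) ^ N).coeff n =
      2 * l * (if n = N then 1 else 0) := by
      rw [Polynomial.coeff_C_mul, Polynomial.coeff_X_pow]
    fin_cases i <;> fin_cases j
    · simp
    · simp [Polynomial.coeff_X_pow]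
    · simp [Polynomial.coeff_one, eq_comm]
    · simp [Polynomial.coeff_C, Polynomial.coeff_X_pow]
    · simp
    · simp [Polynomial.coeff_X_pow]
    · simp [Polynomial.coeff_X_pow]
    · change (q - Polynomial.C (2 * l) * (Polynomial.X : ℂ[X]) ^ N).coeff n = _
      rw [Polynomial.coeff_sub, e1]
      rfl
    · simp
  rw [redP_eq_iff] at h
  refine polyMat_ext fun n => ?_
  rw [hspec]
  rcases lt_trichotomy n N with hn | rfl | hn
  · rw [h n hn, coeffMat_specialPolar, if_neg (show n ≠ N by omega),
      if_neg (show n ≠ N + 1 by omega)]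
    simp
  · rw [coeffMat_laxP_self n hN, h _ (by omega), coeffMat_specialPolar, hp n le_rfl, hq n le_rfl,
      if_pos (rfl : n = n), if_neg (show n ≠ 0 by omega), if_neg (show n ≠ n + 1 by omega),
      if_neg (show n ≠ 0 by omega), E_zero_one, E_one_two]
    -- The constant entry `1` in the upper right corner reaches the coefficient of `z^{N-1}`, and so
    -- triggers a correction, only when `N = 1`.
    have hl' : (if n - 1 = 0 then (1 : ℂ) else 0) = l := by
      rw [hl]
      exact if_congr (by omega) rfl rfl
    rw [hl']
    ext i j
    fin_cases i <;> fin_cases j <;> simp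
    ring
  · rw [if_neg (show n ≠ N by omega), if_neg (show n ≠ 0 by omega), if_neg (show n ≠ 0 by omega),
      hp n hn.le, hq n hn.le]
    rcases (Nat.succ_le_of_lt hn).eq_or_lt with rfl | hn'
    · rw [coeffMat_laxP_succ, E_two_zero]
      simp
    · rw [coeffMat_laxP_of_lt N n y hn', if_neg (show n ≠ N + 1 by omega)]
      ext i j
      fin_cases i <;> fin_cases j <;> simp

theorem isRegularAt_special {N : ℕ} (hN : 1 ≤ N) {y : PhaseSpace N} {c : ℂ} (hc : c ≠ 0)
    {p q : ℂ[X]} (h : redP N (laxP N y) = redP N (specialPolar c p q)) :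
    IsRegularAt N y ![0, 0, 1] := by
  rw [IsRegularAt, redP_eq_iff.1 h 0 hN, coeffMat_specialPolar]
  have h1 : (krylov !![0, 0, if 0 = 0 then 1 else 0; if 0 = 0 then c else 0, 0, 0;
      p.coeff 0, q.coeff 0, 0] ![0, 0, 1]).det = c := by
    rw [Matrix.det_fin_three]
    simp [krylov, pow_two]
  rw [h1]
  exact hc

/-- A parameter for which the special matrix is nonderogatory at every point. -/
theorem exists_isCoprime {N : ℕ} (hN : 1 ≤ N) (l : ℂ) {q : ℂ[X]}
    (hq : ∀ n, N ≤ n → q.coeff n = 0) : ∃ c : ℂ, c ≠ 0 ∧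
      IsCoprime (Polynomial.C c⁻¹ * q - Polynomial.C (2 * l) * (Polynomial.X : ℂ[X]) ^ N -
        (Polynomial.C c + Polynomial.C l * (Polynomial.X : ℂ[X]) ^ N))
        (Polynomial.C c + Polynomial.C l * (Polynomial.X : ℂ[X]) ^ N -
          ((Polynomial.X : ℂ[X]) ^ N) ^ 3) := by
  -- At a common zero, `c = z^{3N} - l z^N` and `q = c (c + 3 l z^N)`; eliminating `c` gives `R(z) =
  -- 0`. As `R` does not involve `c` and has leading term `z^{6N}`, only finitely many `c` are
  -- excluded.
  let R : ℂ[X] := (Polynomial.X : ℂ[X]) ^ (6 * N) + Polynomial.C l * (Polynomial.X : ℂ[X]) ^ (4 * N)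
    - Polynomial.C (2 * l ^ 2) * (Polynomial.X : ℂ[X]) ^ (2 * N) - q
  have hR : R ≠ 0 := by
    intro h0
    have h1 := congrArg (fun r : ℂ[X] => r.coeff (6 * N)) h0
    simp only [R, Polynomial.coeff_sub, Polynomial.coeff_add, Polynomial.coeff_C_mul,
      Polynomial.coeff_X_pow, hq (6 * N) (by omega), Polynomial.coeff_zero] at h1
    rw [if_pos trivial, if_neg (by omega), if_neg (by omega)] at h1
    simp at h1
  have hfin : ({0} ∪ (fun z : ℂ => (z ^ N) ^ 3 - l * z ^ N) '' {z | R.IsRoot z}).Finite :=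
    (Set.finite_singleton 0).union ((Polynomial.finite_setOfPred_isRoot hR).image _)
  obtain ⟨c, hc⟩ := hfin.infinite_compl.nonempty
  rw [Set.mem_compl_iff, Set.mem_union, not_or] at hc
  obtain ⟨hc0, hc⟩ := hc
  have hc0 : c ≠ 0 := hc0
  refine ⟨c, hc0, (Polynomial.isCoprime_iff_aeval_ne_zero_of_isAlgClosed ℂ ℂ _ _).2 fun z => ?_⟩
  by_contra! hz
  obtain ⟨h1, h2⟩ := hz
  simp only [map_sub, map_add, map_mul, map_pow, Polynomial.aeval_X, Polynomial.aeval_C,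
    Algebra.algebraMap_self, RingHom.id_apply] at h1 h2
  refine hc ⟨z, ?_, by simp only; linear_combination -h2⟩
  have h3 : Polynomial.aeval z q = c * (c + 3 * l * z ^ N) := by
    have := mul_inv_cancel₀ hc0
    linear_combination c * h1 - (Polynomial.aeval z q) * this
  rw [Polynomial.coe_aeval_eq_eval] at h3
  have h4 : c = (z ^ N) ^ 3 - l * z ^ N := by linear_combination h2
  change R.IsRoot z
  rw [Polynomial.IsRoot.def]
  simp only [R, Polynomial.eval_sub, Polynomial.eval_add, Polynomial.eval_mul, Polynomial.eval_pow,
    Polynomial.eval_X, Polynomial.eval_C, h3]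
  rw [h4]
  ring

/-- Each regular orbit contains a point at which the hamiltonians are independent. -/
theorem exists_special_point {N : ℕ} (hN : 1 ≤ N) {x : PhaseSpace N} {v : Fin 3 → ℂ}
    (hv : IsRegularAt N x v) : ∃ y ∈ coadjointOrbit N x, ∀ a : Fin N ⊕ Fin (2 * N) → ℂ,
      (∀ η, ∑ k, a k * fderiv ℂ (hamiltonian N k) y ((liePoisson N y).mulVec η) = 0) → a = 0 := by
  set p : ℂ[X] := PowerSeries.trunc N (PowerSeries.mk fun n => quadInv N n x) with hp
  set q : ℂ[X] := PowerSeries.trunc N (PowerSeries.mk fun n => cubInv N n x) with hq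
  have hp0 : ∀ n, N ≤ n → p.coeff n = 0 := fun n hn => by
    rw [hp, PowerSeries.coeff_trunc, if_neg (by omega)]
  have hq0 : ∀ n, N ≤ n → q.coeff n = 0 := fun n hn => by
    rw [hq, PowerSeries.coeff_trunc, if_neg (by omega)]
  set l : ℂ := if N = 1 then 1 else 0 with hl
  obtain ⟨c, hc, hcop⟩ := exists_isCoprime hN l hq0
  set q' := Polynomial.C c⁻¹ * q with hq'
  have hq0' : ∀ n, N ≤ n → q'.coeff n = 0 := fun n hn => by
    rw [hq', Polynomial.coeff_C_mul, hq0 n hn, mul_zero]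
  obtain ⟨t1, t2, t3⟩ := specialPolar_traces c p q'
  obtain ⟨y, hy⟩ := exists_redP_dirn_eq (N := N) (M := redP N (specialPolar c p q'))
    (by rw [trace_redP, t1, Polynomial.coe_zero, map_zero])
  rw [← redP_laxP] at hy
  have hreg := isRegularAt_special hN hc hy
  refine ⟨y, ?_, fun a ha => eq_zero_of_sum_fderiv_hamiltonian hN hreg
    (laxP_eq_specialMat hN hp0 hq0' hy hl) ?_ hcop ha⟩
  · rw [mem_coadjointOrbit_iff_casimir hN hv hreg, casimir_eq_iff, hy]
    simp only [← map_pow, trace_redP, trunc_eq_iff, Polynomial.coeff_coe, t2, t3]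
    constructor
    · intro n hn
      rw [← map_ofNat Polynomial.C 2, Polynomial.coeff_C_mul, hp, PowerSeries.coeff_trunc,
        if_pos hn, PowerSeries.coeff_mk, quadInv]
      ring
    · intro n hn
      rw [hq', ← mul_assoc (Polynomial.C c), ← Polynomial.C_mul, mul_inv_cancel₀ hc,
        Polynomial.C_1, one_mul, ← map_ofNat Polynomial.C 3, Polynomial.coeff_C_mul, hq,
        PowerSeries.coeff_trunc, if_pos hn, PowerSeries.coeff_mk, cubInv]
      ring
  · refine (Polynomial.degree_lt_iff_coeff_zero _ _).2 fun n hn => ?_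
    rw [Polynomial.coeff_add, Polynomial.coeff_C_mul, Polynomial.coeff_X_pow, Polynomial.coeff_C,
      if_neg (by omega), if_neg (by omega), mul_zero, add_zero]

/-! ### Connecting points of an orbit by analytic curves -/

section Calculus

variable {E : Type*} [NormedAddCommGroup E] [NormedSpace ℂ E]

theorem CoeffAnalyticOn.sub {f g : E → PowerSeries ℂ} {s : Set E} (hf : CoeffAnalyticOn f s)
    (hg : CoeffAnalyticOn g s) : CoeffAnalyticOn (fun y => f y - g y) s := by
  intro n x hx
  simp only [map_sub]
  exact (hf n x hx).sub (hg n x hx)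

/-- The recursion for the coefficients of the inverse divides only by the constant term. -/
theorem CoeffAnalyticOn.inv {f : E → PowerSeries ℂ} {s : Set E} (hf : CoeffAnalyticOn f s)
    (h0 : ∀ x ∈ s, PowerSeries.constantCoeff (f x) ≠ 0) :
    CoeffAnalyticOn (fun y => (f y)⁻¹) s := by
  intro n
  induction n using Nat.strong_induction_on with
  | _ n ih =>
    intro x hx
    have h1 : AnalyticAt ℂ (fun y => (PowerSeries.constantCoeff (f y))⁻¹) x := by
      refine AnalyticAt.fun_inv ?_ (h0 x hx)
      have := hf 0 x hx
      simpa only [PowerSeries.coeff_zero_eq_constantCoeff_apply] using this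
    have h2 : (fun y => PowerSeries.coeff n (f y)⁻¹) = _ :=
      funext fun y => PowerSeries.coeff_inv n (f y)
    rw [h2]
    by_cases hn : n = 0
    · simpa only [hn, if_true] using h1
    · simp only [hn, if_false]
      refine h1.neg.mul (Finset.analyticAt_fun_sum _ fun p _ => ?_)
      by_cases hp : p.2 < n
      · simp only [hp, if_true]
        exact (hf p.1 x hx).mul (ih p.2 hp x hx)
      · simp only [hp, if_false]
        exact analyticAt_const

theorem MatAnalyticOn.det {F : E → SeriesMat} {s : Set E} (hF : MatAnalyticOn F s) :
    CoeffAnalyticOn (fun y => (F y).det) s := by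
  simp only [Matrix.det_fin_three]
  have h : ∀ i j k l m n, CoeffAnalyticOn (fun y => F y i j * F y k l * F y m n) s :=
    fun i j k l m n => ((hF i j).mul (hF k l)).mul (hF m n)
  exact (((((h _ _ _ _ _ _).sub (h _ _ _ _ _ _)).sub (h _ _ _ _ _ _)).add
    (h _ _ _ _ _ _)).add (h _ _ _ _ _ _)).sub (h _ _ _ _ _ _)

theorem MatAnalyticOn.const (A : SeriesMat) (s : Set E) : MatAnalyticOn (fun _ => A) s :=
  fun _ _ _ _ _ => analyticAt_const

theorem MatAnalyticOn.adjugate {F : E → SeriesMat} {s : Set E} (hF : MatAnalyticOn F s) :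
    MatAnalyticOn (fun y => (F y).adjugate) s := by
  intro i j
  simp only [Matrix.adjugate_apply]
  refine MatAnalyticOn.det fun k l => ?_
  by_cases hk : k = j
  · subst hk
    simp only [Matrix.updateRow_self]
    exact fun _ _ _ => analyticAt_const
  · simp only [Matrix.updateRow_ne hk]
    exact hF k l

end Calculus

/-- The point of the phase space with given polar part. -/
def ofSeries (N : ℕ) (F : SeriesMat) : PhaseSpace N := fun i =>
  (F.map (PowerSeries.coeff (N - 1 - i.2)) * X i.1).trace

theorem redP_laxP_ofSeries {N : ℕ} {F : SeriesMat} (hF : F.trace = 0) :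
    redP N (laxP N (ofSeries N F)) = red N F := by
  rw [redP_laxP]
  ext i j
  refine trunc_eq_iff.2 fun n hn => ?_
  rw [toSeries_apply, Polynomial.coeff_coe, ← coeffMat_apply, coeffMat_dirn N n _ hn]
  obtain ⟨l, rfl⟩ : ∃ l : Fin N, n = N - 1 - l := ⟨⟨N - 1 - n, by omega⟩, by simp; omega⟩
  have h := sum_trace_mul_X_smul_XDual (F.map (PowerSeries.coeff (N - 1 - l)))
  have h0 : (F.map (PowerSeries.coeff (N - 1 - l))).trace = 0 := by
    rw [← map_zero (PowerSeries.coeff (N - 1 - l)), ← hF]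
    simp [Matrix.trace_fin_three]
  rw [h0, zero_div, zero_smul, sub_zero] at h
  rw [coeffMat_polar]
  exact congrFun (congrFun h i) j

theorem analyticOnNhd_ofSeries {N : ℕ} {F : ℂ → SeriesMat} {s : Set ℂ} (hF : MatAnalyticOn F s) :
    AnalyticOnNhd ℂ (fun t => ofSeries N (F t)) s := by
  intro t ht
  rw [analyticAt_pi_iff]
  intro i
  simp only [ofSeries, trace_mul_fin_three, Matrix.map_apply]
  have h : ∀ j k c, AnalyticAt ℂ (fun t => PowerSeries.coeff (N - 1 - i.2) (F t j k) * c) t :=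
    fun j k c => (hF j k _ t ht).mul analyticAt_const
  exact ((((h _ _ _).add (h _ _ _)).add (h _ _ _)).add (((h _ _ _).add (h _ _ _)).add
    (h _ _ _))).add (((h _ _ _).add (h _ _ _)).add (h _ _ _))

theorem eq_of_redP_laxP {N : ℕ} {x y : PhaseSpace N}
    (h : redP N (laxP N x) = redP N (laxP N y)) : x = y := by
  rw [redP_laxP, redP_laxP] at h
  exact redP_dirn_injective h

theorem mem_coadjointOrbit_trans {N : ℕ} (hN : 1 ≤ N) {x y z : PhaseSpace N}
    (hy : y ∈ coadjointOrbit N x) (hz : z ∈ coadjointOrbit N y) : z ∈ coadjointOrbit N x := by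
  rw [mem_coadjointOrbit_iff hN] at *
  obtain ⟨g, hg⟩ := hy
  obtain ⟨k, hk⟩ := hz
  refine ⟨k * g, ?_⟩
  rw [Matrix.SpecialLinearGroup.coe_mul, map_mul, ← mul_assoc, hk, mul_assoc, hg, mul_assoc]

/-- Conjugation of a matrix of power series. -/
def conjMat (g Q : SeriesMat) : SeriesMat := g * Q * ((Matrix.scalar (Fin 3) g.det⁻¹) * g.adjugate)

theorem scalar_inv_det_mul_adjugate_mul {g : SeriesMat}
    (hg : PowerSeries.constantCoeff g.det ≠ 0) :
    Matrix.scalar (Fin 3) g.det⁻¹ * g.adjugate * g = 1 := by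
  rw [mul_assoc, Matrix.adjugate_mul, Matrix.scalar_apply, ← Matrix.smul_one_eq_diagonal,
    Matrix.smul_mul, one_mul, smul_smul, PowerSeries.inv_mul_cancel _ hg, one_smul]

theorem conjMat_mul {g Q : SeriesMat} (hg : PowerSeries.constantCoeff g.det ≠ 0) :
    conjMat g Q * g = g * Q := by
  rw [conjMat, mul_assoc (g * Q), scalar_inv_det_mul_adjugate_mul hg, mul_one]

theorem trace_conjMat {g Q : SeriesMat} (hg : PowerSeries.constantCoeff g.det ≠ 0)
    (hQ : Q.trace = 0) : (conjMat g Q).trace = 0 := by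
  rw [conjMat, Matrix.trace_mul_comm, ← mul_assoc, scalar_inv_det_mul_adjugate_mul hg, one_mul, hQ]

theorem eq_of_intertwine {N : ℕ} {x y z : PhaseSpace N} {g : SeriesMat} (hg : IsUnit g.det)
    (hy : redP N (laxP N y) * red N g = red N g * redP N (laxP N x))
    (hz : redP N (laxP N z) * red N g = red N g * redP N (laxP N x)) : y = z := by
  refine eq_of_redP_laxP ?_
  have hu := isUnit_det_red (N := N) hg
  rw [← Matrix.mul_nonsing_inv_cancel_right _ (redP N (laxP N y)) hu, hy, ← hz,
    Matrix.mul_nonsing_inv_cancel_right _ _ hu]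

/-- Two points of an orbit are connected by an analytic curve, defined on a connected set. -/
theorem exists_analytic_path {N : ℕ} (hN : 1 ≤ N) {y p : PhaseSpace N}
    (hp : p ∈ coadjointOrbit N y) : ∃ (T : Set ℂ) (γ : ℂ → PhaseSpace N), IsOpen T ∧
      IsPreconnected T ∧ 0 ∈ T ∧ 1 ∈ T ∧ AnalyticOnNhd ℂ γ T ∧ γ 0 = y ∧ γ 1 = p ∧
      ∀ t ∈ T, γ t ∈ coadjointOrbit N y := by
  obtain ⟨g, hg⟩ := (mem_coadjointOrbit_iff hN).1 hp
  -- The segment from `1` to `g` leaves `SL(3)`, but conjugation by any invertible matrix stays in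
  -- the orbit. Invertibility fails only at the zeros of a polynomial in `t`, the determinant at `z
  -- = 0`.
  let G : ℂ → SeriesMat := fun t => 1 + Matrix.scalar (Fin 3) (PowerSeries.C t) *
    ((g : SeriesMat) - 1)
  let Q := toSeries (laxP N y)
  have hG : MatAnalyticOn G Set.univ := by
    intro i j n t _
    simp only [G, Matrix.add_apply, Matrix.scalar_apply, Matrix.diagonal_mul, map_add,
      PowerSeries.coeff_C_mul]
    exact analyticAt_const.add (analyticAt_id.mul analyticAt_const)
  have hG0 : G 0 = 1 := by simp [G]
  have hG1 : G 1 = g := by simp [G]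
  let g0 : Matrix (Fin 3) (Fin 3) ℂ := PowerSeries.constantCoeff.mapMatrix (g : SeriesMat)
  let P : ℂ[X] := (1 + Matrix.scalar (Fin 3) Polynomial.X * (g0 - 1).map Polynomial.C).det
  have hP : ∀ t, P.eval t = PowerSeries.constantCoeff (G t).det := by
    intro t
    change Polynomial.evalRingHom t P = _
    rw [RingHom.map_det, RingHom.map_det]
    congr 1
    ext i j
    by_cases hij : i = j
    · subst hij
      simp [G, g0]
    · simp [G, g0, hij]
      ring
  let T : Set ℂ := {t | P.eval t = 0}ᶜ
  have hT : ∀ t ∈ T, PowerSeries.constantCoeff (G t).det ≠ 0 := fun t ht => by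
    rw [← hP]
    exact ht
  have h0 : (0 : ℂ) ∈ T := by
    change P.eval 0 ≠ 0
    rw [hP, hG0]
    simp
  have h1 : (1 : ℂ) ∈ T := by
    change P.eval 1 ≠ 0
    rw [hP, hG1, g.2]
    simp
  have hfin : {t | P.eval t = 0}.Finite := by
    refine (Polynomial.finite_setOfPred_isRoot (p := P) fun h => h0 ?_).subset fun t ht => ht
    rw [h]
    exact Polynomial.eval_zero
  have hQ : Q.trace = 0 := by
    rw [trace_toSeries, trace_laxP, Polynomial.coe_zero]
  have hγ : ∀ t ∈ T, redP N (laxP N (ofSeries N (conjMat (G t) Q))) * red N (G t) =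
      red N (G t) * redP N (laxP N y) := by
    intro t ht
    rw [redP_laxP_ofSeries (trace_conjMat (hT t ht) hQ), ← map_mul, conjMat_mul (hT t ht), map_mul]
    rfl
  have hunit : ∀ t ∈ T, IsUnit (G t).det := fun t ht =>
    PowerSeries.isUnit_iff_constantCoeff.2 (isUnit_iff_ne_zero.2 (hT t ht))
  refine ⟨T, fun t => ofSeries N (conjMat (G t) Q), hfin.isClosed.isOpen_compl, ?_, h0, h1, ?_, ?_,
    ?_, fun t ht => mem_coadjointOrbit_of_isUnit_det hN (hunit t ht) (hγ t ht)⟩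
  -- The complement of a countable set in the complex line is connected because the real dimension
  -- is two.
  · refine (hfin.countable.isConnected_compl_of_one_lt_rank ?_).isPreconnected
    rw [Complex.rank_real_complex]
    exact Nat.one_lt_ofNat
  · refine analyticOnNhd_ofSeries ?_
    have hG' : MatAnalyticOn G T := fun i j n t _ => hG i j n t trivial
    refine (hG'.mul (MatAnalyticOn.const Q T)).mul (MatAnalyticOn.mul ?_ hG'.adjugate)
    intro i j
    by_cases hij : i = j
    · subst hij
      simp only [Matrix.scalar_apply, Matrix.diagonal_apply_eq]
      exact hG'.det.inv hT
    · simp only [Matrix.scalar_apply, Matrix.diagonal_apply_ne _ hij]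
      exact fun _ _ _ => analyticAt_const
  · refine eq_of_intertwine (hunit 0 h0) (hγ 0 h0) ?_
    rw [hG0, map_one, mul_one, one_mul]
  · refine eq_of_intertwine (hunit 1 h1) (hγ 1 h1) ?_
    rw [hG1]
    exact hg

/-! ### Independence of the Hamiltonians on the orbits -/

theorem mem_coadjointOrbit_symm {N : ℕ} (hN : 1 ≤ N) {x y : PhaseSpace N}
    (hy : y ∈ coadjointOrbit N x) : x ∈ coadjointOrbit N y := by
  rw [mem_coadjointOrbit_iff hN] at *
  obtain ⟨g, hg⟩ := hy
  have h1 : red N (g : SeriesMat) * red N ((g⁻¹ : LoopGroup) : SeriesMat) = 1 := by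
    rw [← map_mul, ← Matrix.SpecialLinearGroup.coe_mul, mul_inv_cancel,
      Matrix.SpecialLinearGroup.coe_one, map_one]
  have h2 : red N ((g⁻¹ : LoopGroup) : SeriesMat) * red N (g : SeriesMat) = 1 := by
    rw [← map_mul, ← Matrix.SpecialLinearGroup.coe_mul, inv_mul_cancel,
      Matrix.SpecialLinearGroup.coe_one, map_one]
  refine ⟨g⁻¹, ?_⟩
  calc redP N (laxP N x) * red N ((g⁻¹ : LoopGroup) : SeriesMat)
      = red N ((g⁻¹ : LoopGroup) : SeriesMat) * (red N (g : SeriesMat) * redP N (laxP N x)) *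
          red N ((g⁻¹ : LoopGroup) : SeriesMat) := by
        rw [← mul_assoc (red N ((g⁻¹ : LoopGroup) : SeriesMat)), h2, one_mul]
    _ = red N ((g⁻¹ : LoopGroup) : SeriesMat) * redP N (laxP N y) := by
        rw [← hg, mul_assoc, mul_assoc, h1, mul_one]

/-- The derivatives of the Hamiltonian `k` along the Hamiltonian vector fields of the
coordinates. -/
def hamiltonianDeriv (N : ℕ) (x : PhaseSpace N) (k : Fin N ⊕ Fin (2 * N)) : Idx N → ℂ :=
  fun j => fderiv ℂ (hamiltonian N k) x ((liePoisson N x).mulVec (Pi.single j 1))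

theorem analyticOnNhd_hamiltonianDeriv {N : ℕ} (hN : 1 ≤ N) (k : Fin N ⊕ Fin (2 * N)) :
    AnalyticOnNhd ℂ (fun x => hamiltonianDeriv N x k) Set.univ := by
  intro x _
  rw [analyticAt_pi_iff]
  intro j
  have h1 : AnalyticAt ℂ (fderiv ℂ (hamiltonian N k)) x :=
    (analyticOnNhd_hamiltonian N k x trivial).fderiv
  have h2 : AnalyticAt ℂ (fun x => (liePoisson N x).mulVec (Pi.single j 1)) x := by
    rw [analyticAt_pi_iff]
    intro i
    simp only [Matrix.mulVec_single_one, Matrix.col_apply]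
    exact (isPoissonTensor_liePoisson N hN).analytic i j x trivial
  exact ((ContinuousLinearMap.id ℂ (PhaseSpace N →L[ℂ] ℂ)).analyticAt_bilinear _).comp
    (h1.prod h2)

theorem linearIndependent_hamiltonianDeriv_iff {N : ℕ} {x : PhaseSpace N} :
    LinearIndependent ℂ (hamiltonianDeriv N x) ↔ ∀ a : Fin N ⊕ Fin (2 * N) → ℂ,
      (∀ η, ∑ k, a k * fderiv ℂ (hamiltonian N k) x ((liePoisson N x).mulVec η) = 0) → a = 0 := by
  rw [Fintype.linearIndependent_iff]
  have key : ∀ a : Fin N ⊕ Fin (2 * N) → ℂ, (∑ k, a k • hamiltonianDeriv N x k = 0) ↔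
      ∀ η, ∑ k, a k * fderiv ℂ (hamiltonian N k) x ((liePoisson N x).mulVec η) = 0 := by
    intro a
    let Λ : PhaseSpace N →ₗ[ℂ] ℂ :=
      (∑ k, a k • (fderiv ℂ (hamiltonian N k) x).toLinearMap) ∘ₗ (liePoisson N x).mulVecLin
    have hΛ : ∀ η, Λ η = ∑ k, a k * fderiv ℂ (hamiltonian N k) x ((liePoisson N x).mulVec η) := by
      intro η
      simp [Λ]
    simp only [← hΛ]
    constructor
    · intro h η
      suffices Λ = 0 by rw [this, LinearMap.zero_apply]
      refine LinearMap.pi_ext' fun j => LinearMap.ext_ring ?_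
      have := congrFun h j
      simpa [hΛ, hamiltonianDeriv] using this
    · intro h
      ext j
      have := h (Pi.single j 1)
      simpa [hΛ, hamiltonianDeriv] using this
  exact ⟨fun h a ha => funext (h a ((key a).2 ha)), fun h a ha => congrFun (h a ((key a).1 ha))⟩

/-- A linearly independent family of vectors depending analytically on a parameter remains
linearly independent away from the zeros of an analytic function. -/
theorem exists_analytic_ne_zero_imp_linearIndependent {E ι κ : Type*} [NormedAddCommGroup E]
    [NormedSpace ℂ E] [Fintype ι] [Fintype κ] [DecidableEq κ] {D : E → κ → ι → ℂ} {y : E}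
    (hD : ∀ k, AnalyticOnNhd ℂ (fun x => D x k) Set.univ) (hy : LinearIndependent ℂ (D y)) :
    ∃ φ : E → ℂ, AnalyticOnNhd ℂ φ Set.univ ∧ φ y ≠ 0 ∧
      ∀ x, φ x ≠ 0 → LinearIndependent ℂ (D x) := by
  -- A left inverse `B` at `y` replaces the choice of a minor: `φ` is the determinant of the square
  -- matrix `B ∘ D(x)`, which is the identity at `y`.
  obtain ⟨B, hB⟩ := (Fintype.linearCombination ℂ (D y)).exists_leftInverse_of_injective
    (LinearMap.ker_eq_bot.2 (linearIndependent_iff_injective_fintypeLinearCombination.1 hy))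
  refine ⟨fun x => (Matrix.of fun k => B (D x k)).det, ?_, ?_, fun x hx => ?_⟩
  · intro x _
    simp only [Matrix.det_apply']
    refine Finset.analyticAt_fun_sum _ fun σ _ => ?_
    refine analyticAt_const.mul ?_
    refine Finset.analyticAt_fun_prod _ fun i _ => ?_
    have := (LinearMap.toContinuousLinearMap (LinearMap.proj i ∘ₗ B)).analyticAt (D x (σ i))
    exact AnalyticAt.comp (f := fun x => D x (σ i)) this (hD (σ i) x trivial)
  · have : (Matrix.of fun k => B (D y k)) = 1 := by
      ext k l
      have := LinearMap.congr_fun hB (Pi.single k 1)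
      simp at this
      simp [this, Matrix.one_apply, Pi.single_apply, eq_comm]
    simp only [this, Matrix.det_one]
    exact one_ne_zero
  · exact LinearIndependent.of_comp B (Matrix.linearIndependent_rows_of_det_ne_zero hx)

/-- If `φ` vanished at parameters accumulating at the end of an analytic curve from `y` to `p`
inside the orbit, the identity theorem would make it vanish at `y`. -/
theorem coadjointOrbit_subset_closure {N : ℕ} (hN : 1 ≤ N) {x y : PhaseSpace N}
    (hy : y ∈ coadjointOrbit N x) {φ : PhaseSpace N → ℂ} (hφ : AnalyticOnNhd ℂ φ Set.univ)
    (hφy : φ y ≠ 0) : coadjointOrbit N x ⊆ closure (coadjointOrbit N x ∩ {p | φ p ≠ 0}) := by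
  intro p hp
  obtain ⟨T, γ, hTo, hTc, h0, h1, hγ, hγ0, hγ1, hγT⟩ := exists_analytic_path hN
    (mem_coadjointOrbit_trans hN (mem_coadjointOrbit_symm hN hy) hp)
  have ha : AnalyticOnNhd ℂ (φ ∘ γ) T := fun t ht => (hφ (γ t) trivial).comp (hγ t ht)
  have h2 : ∀ᶠ t in 𝓝[≠] (1 : ℂ), φ (γ t) ≠ 0 := by
    by_contra hcon
    refine hφy ?_
    have := ha.eqOn_zero_of_preconnected_of_frequently_eq_zero hTc h1 (z₀ := 1)
      ((Filter.not_eventually.1 hcon).mono fun t ht => not_not.1 ht) h0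
    rwa [Function.comp_apply, hγ0] at this
  have h3 : ∀ᶠ t in 𝓝[≠] (1 : ℂ), t ∈ T := mem_nhdsWithin_of_mem_nhds (hTo.mem_nhds h1)
  refine mem_closure_of_tendsto (b := 𝓝[≠] (1 : ℂ)) (f := γ) ?_ ?_
  · rw [← hγ1]
    exact (hγ 1 h1).continuousAt.tendsto.mono_left nhdsWithin_le_nhds
  · filter_upwards [h2, h3] with t ht ht'
    exact ⟨mem_coadjointOrbit_trans hN hy (hγT t ht'), ht⟩

theorem exists_independent_hamiltonian {N : ℕ} (hN : 1 ≤ N) {x : PhaseSpace N} {v : Fin 3 → ℂ}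
    (hv : IsRegularAt N x v) : ∃ U : Set (PhaseSpace N), IsOpen U ∧
      coadjointOrbit N x ⊆ closure (coadjointOrbit N x ∩ U) ∧
      ∀ p ∈ coadjointOrbit N x ∩ U, LinearIndependent ℂ (fun k =>
        (fderiv ℂ (hamiltonian N k) p).toLinearMap.domRestrict
          (tangentSpace (coadjointOrbit N x) p)) := by
  obtain ⟨y, hy, hyi⟩ := exists_special_point hN hv
  obtain ⟨φ, hφ, hφy, hφi⟩ := exists_analytic_ne_zero_imp_linearIndependent
    (analyticOnNhd_hamiltonianDeriv hN) (linearIndependent_hamiltonianDeriv_iff.2 hyi)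
  refine ⟨{p | φ p ≠ 0}, ?_, coadjointOrbit_subset_closure hN hy hφ hφy, ?_⟩
  · exact isOpen_ne_fun (continuousOn_univ.1 hφ.continuousOn) continuous_const
  · rintro p ⟨hp, hφp⟩
    have hi := linearIndependent_hamiltonianDeriv_iff.1 (hφi p hφp)
    rw [Fintype.linearIndependent_iff]
    intro a ha
    refine congrFun (hi a fun η => ?_)
    have hη : (liePoisson N p).mulVec η ∈ tangentSpace (coadjointOrbit N x) p := by
      rw [tangentSpace_coadjointOrbit hN hv hp]
      exact ⟨η, rfl⟩
    have := LinearMap.congr_fun ha ⟨_, hη⟩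
    simpa using this

end Boussinesq

end

theorem mainTheorem5 (N : ℕ) (hN : 1 ≤ N) :
    (∀ L ∈ Boussinesq.weylChamber N, Boussinesq.orbitDim N L = 6 * N) ∧
    (∀ j k L, Boussinesq.bracket (Boussinesq.liePoisson N)
      (Boussinesq.hamiltonian N j) (Boussinesq.hamiltonian N k) L = 0) ∧
    (∀ L : Boussinesq.PhaseSpace N, Boussinesq.orbitDim N L = 6 * N →
      Boussinesq.IsLiouvilleIntegrable (Boussinesq.liePoisson N)
        (Boussinesq.coadjointOrbit N L) (3 * N) (Boussinesq.hamiltonian N)) := by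
  refine ⟨fun L hL => Boussinesq.orbitDim_of_isRegularAt hN
    (Boussinesq.isRegularAt_of_mem_weylChamber hN hL),
    Boussinesq.bracket_hamiltonian N hN, fun L hL => ?_⟩
  obtain ⟨v, hv⟩ := Boussinesq.exists_isRegularAt_of_orbitDim hN hL
  exact
    { poisson := Boussinesq.isPoissonTensor_liePoisson N hN
      submanifold := Boussinesq.isComplexSubmanifold_coadjointOrbit hN hv
      symplectic := fun p hp => Boussinesq.tangentSpace_coadjointOrbit hN hv hp
      card := by
        rw [Fintype.card_sum, Fintype.card_fin, Fintype.card_fin]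
        omega
      analytic := Boussinesq.analyticOnNhd_hamiltonian N
      involution := fun j k p _ => Boussinesq.bracket_hamiltonian N hN j k p
      independent := Boussinesq.exists_independent_hamiltonian hN hv }
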